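/- **Setting.** For $k\in\mathbb N_0$ let $C^k(\mathbb R)$ be the space of $k$ times continuously differentiable functions whose derivatives up to order $k$ are bounded, $\|f\|_C=\sup_x|f(x)|$, and $X^k=C^k(\mathbb R)\cap W^{k,1}(\mathbb R)$ with the sum of the two norms. For $l\ge 0$ let $E_l$ be the set of $f\in C^1(\mathbb R)$ with $f'\ge l-1$, with the norm of $C^1(\mathbb R)$. Consider the Cauchy problem $$\partial_t u=(1-\partial_x^2)^{-1}\partial_x[m(u-\partial_xu)(v+\partial_xv)],\qquad \partial_t v=(1-\partial_x^2)^{-1}\partial_x[n(u-\partial_xu)(v+\partial_xv)],$$ $$m=u-\partial_x^2u,\qquad n=v-\partial_x^2v,\qquad m(0,\cdot)=m_0,\qquad n(0,\cdot)=n_0,$$ where $(1-\partial_x^2)^{-1}g=\frac12 e^{-|\cdot|}*g$. A *solution* on an open interval $I\ni 0$ is a pair $(u,v)$ satisfying these equations pointwise on $I\times\mathbb R$ such that, for $w=u$ and $w=v$: $w\in C(I,X^0)$; $w(t,\cdot)\in X^2$ for $t\in I$, with $\|w(t,\cdot)\|_{X^2}$ bounded on compact subintervals of $I$; and $w-\partial_x^2w$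 is continuous on $I\times\mathbb R$. Let $m_0,n_0\in X^0$, and let $y_0:\mathbb R\to\mathbb R$ satisfy $y_0(\xi)-\xi\in X^1\cap E_c$ for some $c>0$. The characteristic $y(t,\xi)=\xi+\zeta(t,\xi)$ is the solution of $$\partial_t\zeta=(W-U)(Z+V),\qquad \zeta(0,\xi)=y_0(\xi)-\xi,$$ where $$U(t,\xi)=\tfrac12\int_{\mathbb R} e^{-|y(t,\xi)-y(t,\eta)|}m_0(y_0(\eta))y_0'(\eta)\,d\eta,$$ $$W(t,\xi)=-\tfrac12\int_{\mathbb R}\operatorname{sgn}(y(t,\xi)-y(t,\eta))e^{-|y(t,\xi)-y(t,\eta)|}m_0(y_0(\eta))y_0'(\eta)\,d\eta,$$ and $V$, $Z$ are given by the formulas for $U$, $W$ with $n_0$ in place of $m_0$. It is considered on its maximal interval $(-\tilde T_{\max},T_{\max})$, $0<\tilde T_{\max},T_{\max}\le\infty$: the largest open interval containing $0$ on which there is such a $\zeta$ that belongs to $C([a,b],E_l)$, with some $l=l(a,b)>0$, for every compact subinterval $[a,b]$. **Theorem (Blow up criteria).** There is a solution $(u,v)$ of the Cauchy problem on $(-\tilde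 T_{\max},T_{\max})$. Every solution on an open interval $(-S',T')$ with $0<S',T'\le\infty$ satisfies $S'\le\tilde T_{\max}$, $T'\le T_{\max}$ and coincides with $(u,v)$ there; so $(-\tilde T_{\max},T_{\max})$ is the maximal interval of existence of the solution. If moreover $m_0(x),n_0(x)\to0$ as $|x|\to\infty$, then $u,v\in C((-\tilde T_{\max},T_{\max}),X^2)$. If $T_{\max}<\infty$, then $\lim_{t\to T_{\max}}(\|m(t,\cdot)\|_C+\|n(t,\cdot)\|_C)=\infty$. Moreover, if $T_{\max}<\infty$, the following conditions are equivalent: (I) $\limsup_{t\to T_{\max}}(\|m(t,\cdot)\|_C+\|n(t,\cdot)\|_C)=\infty$; (II) $\lim_{t\to T_{\max}}\inf_{\xi\in\mathbb R}\partial_\xi y(t,\xi)=0$; (III) $\limsup_{t\to T_{\max}}\sup_{x\in\mathbb R}\big[(\partial_xu)n-un+(\partial_xv)m+vm\big](t,x)=\infty$; (IV) $\int_0^{T_{\max}}(\|m(t,\cdot)\|_C+\|n(t,\cdot)\|_C)\,dt=\infty$. If $\tilde T_{\max}<\infty$, then the same limit holds as $t\to-\tilde T_{\max}$, and the conditions (I)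 and (II) with $t\to-\tilde T_{\max}$, the condition (III) with $t\to-\tilde T_{\max}$ and with the bracket replaced by its negative, i.e. $\limsup_{t\to-\tilde T_{\max}}\sup_{x}\big(-\big[(\partial_xu)n-un+(\partial_xv)m+vm\big](t,x)\big)=\infty$, and the condition (IV) with $\int_{-\tilde T_{\max}}^0$, are equivalent. -/

import Mathlib

open Filter Topology MeasureTheory Set
open scoped ENNReal

namespace Peakon

noncomputable section

/-- The sup-norm `‖f‖_C`, with values in `[0, ∞]`. -/
def supNorm (f : ℝ → ℝ) : ℝ≥0∞ := ⨆ x, ‖f x‖ₑ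

/-- The norm of `C^k(ℝ)`, with values in `[0, ∞]`. -/
def normC (k : ℕ) (f : ℝ → ℝ) : ℝ≥0∞ :=
  ∑ i ∈ Finset.range (k + 1), supNorm (iteratedDeriv i f)

/-- The norm of `W^{k,1}(ℝ)`, for functions of class `C^k`, with values in `[0, ∞]`. -/
def normW (k : ℕ) (f : ℝ → ℝ) : ℝ≥0∞ :=
  ∑ i ∈ Finset.range (k + 1), ∫⁻ x, ‖iteratedDeriv i f x‖ₑ

/-- The norm of `X^k = C^k(ℝ) ∩ W^{k,1}(ℝ)`. -/
def normX (k : ℕ) (f : ℝ → ℝ) : ℝ≥0∞ := normC k f + normW k f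

/-- `f ∈ C^k(ℝ)`: `f` is of class `C^k`, with bounded derivatives up to order `k`. -/
def MemC (k : ℕ) (f : ℝ → ℝ) : Prop := ContDiff ℝ k f ∧ normC k f < ⊤

/-- `f ∈ X^k = C^k(ℝ) ∩ W^{k,1}(ℝ)`. -/
def MemX (k : ℕ) (f : ℝ → ℝ) : Prop := ContDiff ℝ k f ∧ normX k f < ⊤

/-- `f ∈ E_l`: `f ∈ C^1(ℝ)` and `f' ≥ l - 1`. -/
def MemE (l : ℝ) (f : ℝ → ℝ) : Prop := MemC 1 f ∧ ∀ ξ, l - 1 ≤ deriv f ξ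

/-- `f ∈ C(I, X^k)`. -/
def ContInX (k : ℕ) (I : Set ℝ) (f : ℝ → ℝ → ℝ) : Prop :=
  ∀ t ∈ I, MemX k (f t) ∧ Tendsto (fun s => normX k (f s - f t)) (𝓝[I] t) (𝓝 0)

/-- The time interval `(-S, T)`, for `S, T ∈ (0, ∞]`. -/
def timeInterval (S T : EReal) : Set ℝ := {t : ℝ | -S < (t : EReal) ∧ (t : EReal) < T}

/-! ### Characteristics -/

/-- `(1/2) ∫ e^{-|y(ξ) - y(η)|} w₀(y₀(η)) y₀'(η) dη`; this is `U` for `w₀ = m₀`, `V` for `w₀ = n₀`. -/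
def lagU (w₀ y₀ y : ℝ → ℝ) (ξ : ℝ) : ℝ :=
  (1 / 2) * ∫ η, Real.exp (-|y ξ - y η|) * (w₀ (y₀ η) * deriv y₀ η)

/-- `-(1/2) ∫ sgn(y(ξ) - y(η)) e^{-|y(ξ) - y(η)|} w₀(y₀(η)) y₀'(η) dη`;
this is `W` for `w₀ = m₀`, `Z` for `w₀ = n₀`. -/
def lagW (w₀ y₀ y : ℝ → ℝ) (ξ : ℝ) : ℝ :=
  -(1 / 2) * ∫ η, Real.sign (y ξ - y η) * Real.exp (-|y ξ - y η|) * (w₀ (y₀ η) * deriv y₀ η)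

/-- `y(t, ξ) = ξ + ζ(t, ξ)` where `ζ` solves `∂ₜζ = (W - U)(Z + V)`, `ζ(0, ξ) = y₀(ξ) - ξ` on
`(-S, T)` and, on each compact subinterval `[a, b]`, lies in `C([a, b], E_l)` for some `l > 0`. -/
structure IsCharacteristic (m₀ n₀ y₀ : ℝ → ℝ) (S T : EReal) (y : ℝ → ℝ → ℝ) : Prop where
  memE : ∀ a ∈ timeInterval S T, ∀ b ∈ timeInterval S T,
    ∃ l > 0, ∀ t ∈ Icc a b, MemE l (fun ξ => y t ξ - ξ)
  cont : ∀ t ∈ timeInterval S T,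
    Tendsto (fun s => normC 1 (fun ξ => (y s ξ - ξ) - (y t ξ - ξ))) (𝓝 t) (𝓝 0)
  init : ∀ ξ, y 0 ξ = y₀ ξ
  ode : ∀ t ∈ timeInterval S T, ∀ ξ,
    HasDerivAt (fun s => y s ξ)
      ((lagW m₀ y₀ (y t) ξ - lagU m₀ y₀ (y t) ξ) * (lagW n₀ y₀ (y t) ξ + lagU n₀ y₀ (y t) ξ)) t

/-- `y` is the characteristic on its maximal interval `(-S, T)`, `0 < S, T ≤ ∞`. -/
structure IsMaximalCharacteristic (m₀ n₀ y₀ : ℝ → ℝ) (S T : EReal) (y : ℝ → ℝ → ℝ) : Prop where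
  pos_left : 0 < S
  pos_right : 0 < T
  isChar : IsCharacteristic m₀ n₀ y₀ S T y
  maximal : ∀ (S' T' : EReal) (y' : ℝ → ℝ → ℝ), 0 < S' → 0 < T' →
    IsCharacteristic m₀ n₀ y₀ S' T' y' → S' ≤ S ∧ T' ≤ T

/-! ### Solutions of the Cauchy problem -/

/-- `(1 - ∂ₓ²) f`. -/
def momentum (f : ℝ → ℝ) (x : ℝ) : ℝ := f x - iteratedDeriv 2 f x

/-- `(1 - ∂ₓ²)⁻¹ g = (1/2) e^{-|·|} * g`. -/
def helmholtzInv (g : ℝ → ℝ) (x : ℝ) : ℝ := (1 / 2) * ∫ z, Real.exp (-|x - z|) * g z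

/-- `(u - ∂ₓu)(v + ∂ₓv)`. -/
def velocity (f g : ℝ → ℝ) (x : ℝ) : ℝ := (f x - deriv f x) * (g x + deriv g x)

/-- `w ∈ C(I, X^0)`, `w(t) ∈ X^2` with a bound on compact subintervals of `I`, and `(1 - ∂ₓ²)w` is
continuous in `(t, x)`. Every `w ∈ C(I, X^2)` has these properties. -/
structure IsRegular (I : Set ℝ) (w : ℝ → ℝ → ℝ) : Prop where
  cont : ContInX 0 I w
  memX : ∀ t ∈ I, MemX 2 (w t)
  bdd : ∀ a ∈ I, ∀ b ∈ I, ∃ C < (⊤ : ℝ≥0∞), ∀ t ∈ Icc a b, normX 2 (w t) ≤ C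
  cont_momentum : ContinuousOn (fun p : ℝ × ℝ => momentum (w p.1) p.2) (I ×ˢ univ)

/-- `(u, v)` solves, on `(-S, T)`, the Cauchy problem
`∂ₜu = (1 - ∂ₓ²)⁻¹ ∂ₓ[m (u - ∂ₓu)(v + ∂ₓv)]`, `∂ₜv = (1 - ∂ₓ²)⁻¹ ∂ₓ[n (u - ∂ₓu)(v + ∂ₓv)]`,
`m = u - ∂ₓ²u`, `n = v - ∂ₓ²v`, `m(0) = m₀`, `n(0) = n₀`. The operator `(1 - ∂ₓ²)⁻¹ ∂ₓ` is written
as `∂ₓ (1 - ∂ₓ²)⁻¹`. -/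
structure IsSolution (m₀ n₀ : ℝ → ℝ) (S T : EReal) (u v : ℝ → ℝ → ℝ) : Prop where
  regular_u : IsRegular (timeInterval S T) u
  regular_v : IsRegular (timeInterval S T) v
  init_u : ∀ x, momentum (u 0) x = m₀ x
  init_v : ∀ x, momentum (v 0) x = n₀ x
  eq_u : ∀ t ∈ timeInterval S T, ∀ x, HasDerivAt (fun s => u s x)
    (deriv (helmholtzInv fun z => momentum (u t) z * velocity (u t) (v t) z) x) t
  eq_v : ∀ t ∈ timeInterval S T, ∀ x, HasDerivAt (fun s => v s x)
    (deriv (helmholtzInv fun z => momentum (v t) z * velocity (u t) (v t) z) x) t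

/-- `‖m(t)‖_C + ‖n(t)‖_C`. -/
def size (u v : ℝ → ℝ → ℝ) (t : ℝ) : ℝ≥0∞ :=
  supNorm (momentum (u t)) + supNorm (momentum (v t))

/-- `((∂ₓu) n - u n + (∂ₓv) m + v m)(t, x)`. -/
def compression (u v : ℝ → ℝ → ℝ) (t x : ℝ) : ℝ :=
  deriv (u t) x * momentum (v t) x - u t x * momentum (v t) x
    + deriv (v t) x * momentum (u t) x + v t x * momentum (u t) x

end

end Peakon

open Peakon

/-! The proof works in Lagrangian coordinates. With M = m₀(y₀) y₀' and N = n₀(y₀) y₀', the densities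
are transported by the characteristics: m(t, y) ∂_ξ y = M and n(t, y) ∂_ξ y = N for all times. The
factors u - ∂ₓu and v + ∂ₓv of the velocity are one-sided exponential integrals. At the point y(t,
ξ) they become A = `expL (y t) M ξ` and B = `expR (y t) N ξ`, so the characteristic equation reads
∂ₜy = -AB.

Two facts make this a good ODE in C^1. First, A and B are bounded by the L^1 norms of M and N and
are Lipschitz in y for the sup norm, as long as y is increasing. Second, in the ξ-derivative of AB
the terms containing ∂_ξ y cancel (`hasDerivAt_expL_mul_expR`), which leaves ∂ₜ∂_ξ y = NA - MB. The
field is therefore bounded and Lipschitz in C^1 on increasing maps, and the time of existence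
depends only on a lower bound for ∂_ξ y (`exists_local_characteristic`). Gluing shows that at a
finite end of the maximal interval inf ∂_ξ y must tend to 0.

Everything about blow-up follows from this breaking and the equation for q = ∂_ξ y. Since |∂ₜq| ≤
K(|M| + |N|) at the same label, q can become small in finite time only where |M| + |N| is bounded
below, and there |m| + |n| = (|M| + |N|)/q is large (`CharOn.tendsto_size`). Since |∂ₜ log q| ≤
K(‖m‖ + ‖n‖), the time integral of the norms diverges (`CharOn.lintegral_size_eq_top`). Since ∂ₜq
equals minus the compression bracket times q, a bracket bounded above would allow only exponential
decay of q forward in time (`CharOn.limsup_compression_right`), and backward in time the same holds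
with the opposite sign. So each of the four conditions holds at a finite end point, and the
equivalences follow.

Conversely, pushing M and N forward along the characteristics gives a solution
(`CharOn.isSolution`). Its momentum is jointly continuous, and continuous in time with values in
L^1. Convergence in the sup norm needs uniform continuity of the momentum in x, which vanishing at
infinity supplies (`CharOn.contInX_eulerField`).

For uniqueness (`IsSolution.eq_of_characteristic`), the difference of the mass functions of two
solutions is followed along the characteristics of the constructed one. Up to a constant in x, its
time derivative is a momentum times the difference of the velocities. That difference is controlled
by the oscillation of the mass differences, so a Grönwall argument closes without derivatives of the
momentum. A solution living past a finite end point would agree with the constructed one up to there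
and have bounded momentum, contradicting the divergence of the norms. -/

namespace Peakon

noncomputable section

/-! ### Exponential integrals along an increasing map -/

/-- `∫_{η ≤ ξ} e^{-(y(ξ) - y(η))} M(η) dη`. -/
def expL (y M : ℝ → ℝ) (ξ : ℝ) : ℝ := ∫ η in Iic ξ, Real.exp (y η - y ξ) * M η

/-- `∫_{η > ξ} e^{-(y(η) - y(ξ))} M(η) dη`. -/
def expR (y M : ℝ → ℝ) (ξ : ℝ) : ℝ := ∫ η in Ioi ξ, Real.exp (y ξ - y η) * M η

/-- The reflection η ↦ -η keeps increasing maps increasing and exchanges the two one-sided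
integrals, so only `expL` needs direct estimates. -/
theorem expR_eq_expL (y M : ℝ → ℝ) (ξ : ℝ) :
    expR y M ξ = expL (fun η => -y (-η)) (fun η => M (-η)) (-ξ) := by
  unfold expR expL
  have := integral_comp_neg_Iic (-ξ) (fun η => Real.exp (y ξ - y η) * M η)
  rw [neg_neg] at this
  rw [← this]
  congr 1; ext η; simp only [neg_neg]; ring_nf

theorem monotone_reflect {y : ℝ → ℝ} (hy : Monotone y) : Monotone fun η => -y (-η) :=
  fun _ _ h => neg_le_neg (hy (neg_le_neg h))

theorem norm_exp_mul_le {y M : ℝ → ℝ} (hy : Monotone y) {η ξ : ℝ} (h : η ≤ ξ) :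
    ‖Real.exp (y η - y ξ) * M η‖ ≤ ‖M η‖ := by
  rw [norm_mul, Real.norm_eq_abs, Real.abs_exp]
  have : Real.exp (y η - y ξ) ≤ 1 := Real.exp_le_one_iff.2 (sub_nonpos.2 (hy h))
  exact mul_le_of_le_one_left (norm_nonneg _) this

theorem expL_integrableOn {y M : ℝ → ℝ} (hy : Monotone y) (hM : Integrable M) (ξ : ℝ) :
    IntegrableOn (fun η => Real.exp (y η - y ξ) * M η) (Iic ξ) := by
  refine Integrable.mono hM.integrableOn ?_ ?_
  · exact ((Real.measurable_exp.comp (hy.measurable.sub_const _)).aestronglyMeasurable).mul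
      hM.aestronglyMeasurable.restrict
  · exact (ae_restrict_mem measurableSet_Iic).mono fun η hη => norm_exp_mul_le hy hη

theorem abs_expL_le {y M : ℝ → ℝ} (hy : Monotone y) (hM : Integrable M) (ξ : ℝ) :
    |expL y M ξ| ≤ ∫ η, |M η| := by
  unfold expL
  calc ‖∫ η in Iic ξ, Real.exp (y η - y ξ) * M η‖
      ≤ ∫ η in Iic ξ, ‖Real.exp (y η - y ξ) * M η‖ := norm_integral_le_integral_norm _
    _ ≤ ∫ η in Iic ξ, |M η| := by
        refine setIntegral_mono_on (expL_integrableOn hy hM ξ).norm hM.abs.integrableOn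
          measurableSet_Iic fun η hη => norm_exp_mul_le hy hη
    _ ≤ ∫ η, |M η| := setIntegral_le_integral hM.abs (Eventually.of_forall fun _ => abs_nonneg _)

theorem integral_abs_reflect (M : ℝ → ℝ) : ∫ η, |M (-η)| = ∫ η, |M η| :=
  integral_neg_eq_self (fun η => |M η|) volume

theorem abs_expR_le {y M : ℝ → ℝ} (hy : Monotone y) (hM : Integrable M) (ξ : ℝ) :
    |expR y M ξ| ≤ ∫ η, |M η| := by
  rw [expR_eq_expL, ← integral_abs_reflect M]
  exact abs_expL_le (monotone_reflect hy) hM.comp_neg _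

theorem abs_exp_sub_exp_le {a b : ℝ} (ha : a ≤ 0) (hb : b ≤ 0) :
    |Real.exp a - Real.exp b| ≤ |a - b| := by
  have key : ∀ {a b : ℝ}, a ≤ b → b ≤ 0 → Real.exp b - Real.exp a ≤ b - a := by
    intro a b hab hb
    have h1 : Real.exp a = Real.exp b * Real.exp (a - b) := by rw [← Real.exp_add]; ring_nf
    have h2 := Real.add_one_le_exp (a - b)
    have h3 : Real.exp b ≤ 1 := Real.exp_le_one_iff.2 hb
    have h4 := Real.exp_pos b
    nlinarith
  rcases le_total a b with h | h
  · rw [abs_sub_comm, abs_sub_comm a b, abs_of_nonneg (sub_nonneg.2 h),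
      abs_of_nonneg (sub_nonneg.2 (Real.exp_le_exp.2 h))]
    exact key h hb
  · rw [abs_of_nonneg (sub_nonneg.2 h), abs_of_nonneg (sub_nonneg.2 (Real.exp_le_exp.2 h))]
    exact key h ha

/-- On η ≤ ξ both exponents are nonpositive, where exp is 1-Lipschitz, and they differ by at most
2d. Only the sup distance of the maps and the L^1 norm of M enter, not the derivatives of the maps.
-/
theorem abs_expL_sub_le {y₁ y₂ M : ℝ → ℝ} (h₁ : Monotone y₁) (h₂ : Monotone y₂)
    (hM : Integrable M) {d : ℝ} (hd : ∀ ξ, |y₁ ξ - y₂ ξ| ≤ d) (ξ : ℝ) :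
    |expL y₁ M ξ - expL y₂ M ξ| ≤ 2 * d * ∫ η, |M η| := by
  have hd0 : 0 ≤ d := (abs_nonneg _).trans (hd 0)
  unfold expL
  rw [← integral_sub (expL_integrableOn h₁ hM ξ) (expL_integrableOn h₂ hM ξ)]
  calc ‖∫ η in Iic ξ, (Real.exp (y₁ η - y₁ ξ) * M η - Real.exp (y₂ η - y₂ ξ) * M η)‖
      ≤ ∫ η in Iic ξ, ‖Real.exp (y₁ η - y₁ ξ) * M η - Real.exp (y₂ η - y₂ ξ) * M η‖ :=
        norm_integral_le_integral_norm _
    _ ≤ ∫ η in Iic ξ, 2 * d * |M η| := by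
        refine setIntegral_mono_on
          ((expL_integrableOn h₁ hM ξ).sub (expL_integrableOn h₂ hM ξ)).norm
          (hM.abs.const_mul _).integrableOn measurableSet_Iic fun η hη => ?_
        rw [← sub_mul, norm_mul, Real.norm_eq_abs, Real.norm_eq_abs]
        refine mul_le_mul_of_nonneg_right ?_ (abs_nonneg _)
        refine (abs_exp_sub_exp_le (sub_nonpos.2 (h₁ hη)) (sub_nonpos.2 (h₂ hη))).trans ?_
        have e1 := abs_le.1 (hd η)
        have e2 := abs_le.1 (hd ξ)
        rw [abs_le]; constructor <;> linarith
    _ ≤ ∫ η, 2 * d * |M η| := setIntegral_le_integral (hM.abs.const_mul _)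
        (Eventually.of_forall fun _ => by positivity)
    _ = _ := integral_const_mul _ _

theorem abs_expR_sub_le {y₁ y₂ M : ℝ → ℝ} (h₁ : Monotone y₁) (h₂ : Monotone y₂)
    (hM : Integrable M) {d : ℝ} (hd : ∀ ξ, |y₁ ξ - y₂ ξ| ≤ d) (ξ : ℝ) :
    |expR y₁ M ξ - expR y₂ M ξ| ≤ 2 * d * ∫ η, |M η| := by
  rw [expR_eq_expL, expR_eq_expL, ← integral_abs_reflect M]
  refine abs_expL_sub_le (monotone_reflect h₁) (monotone_reflect h₂) hM.comp_neg (fun ξ => ?_) _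
  have := hd (-ξ)
  rwa [neg_sub_neg, abs_sub_comm]

theorem hasDerivAt_setIntegral_Iic {f : ℝ → ℝ} (hf : Continuous f) {x : ℝ}
    (hi : ∀ z, IntegrableOn f (Iic z)) : HasDerivAt (fun z => ∫ t in Iic z, f t) (f x) x := by
  have h1 : (fun z => ∫ t in Iic z, f t) = fun z => (∫ t in Iic x, f t) + ∫ t in x..z, f t := by
    ext z
    have := intervalIntegral.integral_Iic_sub_Iic (hi x) (hi z)
    linarith
  rw [h1]
  exact (intervalIntegral.integral_hasDerivAt_right (hf.intervalIntegrable _ _)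
    (hf.stronglyMeasurableAtFilter _ _) hf.continuousAt).const_add _

/-- Factoring out exp(-y(ξ)) leaves an integral that depends on ξ only through its end point. -/
theorem hasDerivAt_expL {y M : ℝ → ℝ} (hy : Monotone y) (hyc : Continuous y) (hM : Integrable M)
    (hMc : Continuous M) {y' ξ : ℝ} (hd : HasDerivAt y y' ξ) :
    HasDerivAt (expL y M) (M ξ - y' * expL y M ξ) ξ := by
  have hE : ∀ z, expL y M z = Real.exp (-y z) * ∫ η in Iic z, Real.exp (y η) * M η := by
    intro z
    unfold expL
    rw [← integral_const_mul]
    congr 1; ext η; rw [sub_eq_add_neg, Real.exp_add]; ring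
  have hintg : ∀ z, IntegrableOn (fun η => Real.exp (y η) * M η) (Iic z) := by
    intro z
    have := (expL_integrableOn hy hM z).const_mul (Real.exp (y z))
    refine this.congr (Eventually.of_forall fun η => ?_)
    simp only
    rw [← mul_assoc, ← Real.exp_add]; congr 2; ring
  have h1 := hasDerivAt_setIntegral_Iic (f := fun η => Real.exp (y η) * M η)
    (by fun_prop) (x := ξ) hintg
  have h2 := (hd.neg.exp).mul h1
  have : expL y M = fun z => Real.exp (-y z) * ∫ η in Iic z, Real.exp (y η) * M η := funext hE
  rw [this]
  convert! h2 using 1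
  have : Real.exp (-y ξ) * Real.exp (y ξ) = 1 := by rw [← Real.exp_add]; simp
  linear_combination (-M ξ) * this

theorem hasDerivAt_expR {y M : ℝ → ℝ} (hy : Monotone y) (hyc : Continuous y) (hM : Integrable M)
    (hMc : Continuous M) {y' ξ : ℝ} (hd : HasDerivAt y y' ξ) :
    HasDerivAt (expR y M) (y' * expR y M ξ - M ξ) ξ := by
  have h0 : HasDerivAt (fun η => -y (-η)) y' (-ξ) := by
    have h := (HasDerivAt.scomp (-ξ) (g₁ := y) (h := fun η => -η) (g₁' := y') (h' := -1)
      (by simpa using hd) (hasDerivAt_neg _)).neg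
    simpa [Function.comp_def] using! h
  have h1 := hasDerivAt_expL (M := fun η => M (-η)) (monotone_reflect hy) (by fun_prop) hM.comp_neg
    (by fun_prop) h0
  have h2 := HasDerivAt.scomp ξ (h := fun η => -η) h1 (hasDerivAt_neg ξ)
  have h3 : expR y M = expL (fun η => -y (-η)) (fun η => M (-η)) ∘ fun η => -η :=
    funext fun z => expR_eq_expL y M z
  rw [h3]
  convert! h2 using 1
  simp

theorem expL_comp {y y' m : ℝ → ℝ} (hy : StrictMono y) (hs : Function.Surjective y)
    (hd : ∀ ξ, HasDerivAt y (y' ξ) ξ) (ξ : ℝ) :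
    expL id m (y ξ) = expL y (fun η => m (y η) * y' η) ξ := by
  have him : image y (Iic ξ) = Iic (y ξ) := by
    ext z
    constructor
    · rintro ⟨w, hw, rfl⟩; exact hy.monotone hw
    · intro hz
      obtain ⟨w, rfl⟩ := hs z
      exact ⟨w, hy.le_iff_le.1 hz, rfl⟩
  have h0 : ∀ ξ, 0 ≤ y' ξ := fun ξ => by
    rw [← (hd ξ).deriv]; exact hy.monotone.deriv_nonneg
  unfold expL
  rw [← him, integral_image_eq_integral_abs_deriv_smul measurableSet_Iic
    (fun x _ => (hd x).hasDerivWithinAt) hy.injective.injOn]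
  congr 1; ext η
  rw [abs_of_nonneg (h0 η), smul_eq_mul]; simp only [id]; ring

theorem expR_comp {y y' m : ℝ → ℝ} (hy : StrictMono y) (hs : Function.Surjective y)
    (hd : ∀ ξ, HasDerivAt y (y' ξ) ξ) (ξ : ℝ) :
    expR id m (y ξ) = expR y (fun η => m (y η) * y' η) ξ := by
  have him : image y (Ioi ξ) = Ioi (y ξ) := by
    ext z
    constructor
    · rintro ⟨w, hw, rfl⟩; exact hy hw
    · intro hz
      obtain ⟨w, rfl⟩ := hs z
      exact ⟨w, hy.lt_iff_lt.1 hz, rfl⟩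
  have h0 : ∀ ξ, 0 ≤ y' ξ := fun ξ => by
    rw [← (hd ξ).deriv]; exact hy.monotone.deriv_nonneg
  unfold expR
  rw [← him, integral_image_eq_integral_abs_deriv_smul measurableSet_Ioi
    (fun x _ => (hd x).hasDerivWithinAt) hy.injective.injOn]
  congr 1; ext η
  rw [abs_of_nonneg (h0 η), smul_eq_mul]; simp only [id]; ring

theorem integral_comp_mul_deriv_of_strictMono {y y' g : ℝ → ℝ} (hy : StrictMono y)
    (hs : Function.Surjective y) (hd : ∀ ξ, HasDerivAt y (y' ξ) ξ) :
    ∫ x, g x = ∫ η, g (y η) * y' η := by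
  have h0 : ∀ ξ, 0 ≤ y' ξ := fun ξ => by
    rw [← (hd ξ).deriv]; exact hy.monotone.deriv_nonneg
  have := integral_image_eq_integral_abs_deriv_smul MeasurableSet.univ
    (fun x _ => (hd x).hasDerivWithinAt) hy.injective.injOn g
  rw [image_univ, hs.range_eq, setIntegral_univ, setIntegral_univ] at this
  rw [this]
  congr 1; ext η; rw [abs_of_nonneg (h0 η), smul_eq_mul, mul_comm]

theorem integrable_comp_mul_deriv_iff {y y' g : ℝ → ℝ} (hy : StrictMono y)
    (hs : Function.Surjective y) (hd : ∀ ξ, HasDerivAt y (y' ξ) ξ) :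
    Integrable g ↔ Integrable fun η => g (y η) * y' η := by
  have h0 : ∀ ξ, 0 ≤ y' ξ := fun ξ => by
    rw [← (hd ξ).deriv]; exact hy.monotone.deriv_nonneg
  have := integrableOn_image_iff_integrableOn_abs_deriv_smul MeasurableSet.univ
    (fun x _ => (hd x).hasDerivWithinAt) hy.injective.injOn g
  rw [image_univ, hs.range_eq, integrableOn_univ, integrableOn_univ] at this
  rw [this]
  refine integrable_congr (Eventually.of_forall fun η => ?_)
  simp only
  rw [abs_of_nonneg (h0 η), smul_eq_mul, mul_comm]

/-! ### The Lagrangian integrals -/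

theorem integrable_exp_abs {y M : ℝ → ℝ} (hy : Measurable y) (hM : Integrable M) (x : ℝ) :
    Integrable fun η => Real.exp (-|x - y η|) * M η := by
  refine hM.mono ?_ (Eventually.of_forall fun η => ?_)
  · exact (Measurable.aestronglyMeasurable (by fun_prop)).mul hM.aestronglyMeasurable
  · rw [norm_mul, Real.norm_eq_abs, Real.abs_exp]
    exact mul_le_of_le_one_left (norm_nonneg _) (Real.exp_le_one_iff.2 (by simp))

theorem measurable_real_sign : Measurable Real.sign := by
  unfold Real.sign
  exact Measurable.ite measurableSet_Iio measurable_const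
    (Measurable.ite measurableSet_Ioi measurable_const measurable_const)

theorem abs_real_sign_le (x : ℝ) : |Real.sign x| ≤ 1 := by
  rcases Real.sign_apply_eq x with h | h | h <;> simp [h]

theorem integrable_sign_exp_abs {y M : ℝ → ℝ} (hy : Measurable y) (hM : Integrable M) (x : ℝ) :
    Integrable fun η => Real.sign (x - y η) * Real.exp (-|x - y η|) * M η := by
  refine (integrable_exp_abs hy hM x).mono ?_ (Eventually.of_forall fun η => ?_)
  · exact ((measurable_real_sign.comp (hy.const_sub x)).mul
      (by fun_prop)).aestronglyMeasurable.mul hM.aestronglyMeasurable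
  · rw [mul_assoc, norm_mul]
    exact mul_le_of_le_one_left (norm_nonneg _) (abs_real_sign_le _)

theorem integral_exp_abs_eq {y M : ℝ → ℝ} (hy : Monotone y) (hM : Integrable M) (ξ : ℝ) :
    ∫ η, Real.exp (-|y ξ - y η|) * M η = expL y M ξ + expR y M ξ := by
  rw [← intervalIntegral.integral_Iic_add_Ioi
    (integrable_exp_abs hy.measurable hM (y ξ)).integrableOn
    (integrable_exp_abs hy.measurable hM (y ξ)).integrableOn (b := ξ)]
  unfold expL expR
  congr 1
  · refine setIntegral_congr_fun measurableSet_Iic fun η hη => ?_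
    rw [abs_of_nonneg (sub_nonneg.2 (hy hη)), neg_sub]
  · refine setIntegral_congr_fun measurableSet_Ioi fun η hη => ?_
    rw [abs_of_nonpos (sub_nonpos.2 (hy (le_of_lt hη))), neg_neg]

theorem integral_sign_exp_abs_eq {y M : ℝ → ℝ} (hy : StrictMono y) (hM : Integrable M) (ξ : ℝ) :
    ∫ η, Real.sign (y ξ - y η) * Real.exp (-|y ξ - y η|) * M η = expL y M ξ - expR y M ξ := by
  have hi := integrable_sign_exp_abs hy.monotone.measurable hM (y ξ)
  rw [← intervalIntegral.integral_Iic_add_Ioi hi.integrableOn hi.integrableOn (b := ξ)]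
  unfold expL expR
  rw [sub_eq_add_neg, ← integral_neg]
  congr 1
  -- The sign vanishes at η = ξ, so the end point has to be dropped as a null set.
  · rw [← setIntegral_congr_set Iio_ae_eq_Iic, ← setIntegral_congr_set Iio_ae_eq_Iic]
    refine setIntegral_congr_fun measurableSet_Iio fun η hη => ?_
    have h : 0 < y ξ - y η := sub_pos.2 (hy hη)
    rw [abs_of_pos h, neg_sub, Real.sign_of_pos h, one_mul]
  · refine setIntegral_congr_fun measurableSet_Ioi fun η hη => ?_
    have h : y ξ - y η < 0 := sub_neg.2 (hy hη)
    rw [abs_of_neg h, neg_neg, Real.sign_of_neg h]; ring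

/-! ### Norms -/

theorem enorm_le_supNorm (f : ℝ → ℝ) (x : ℝ) : ‖f x‖ₑ ≤ supNorm f := le_iSup (fun x => ‖f x‖ₑ) x

theorem supNorm_le_ofReal {f : ℝ → ℝ} {C : ℝ} (h : ∀ x, |f x| ≤ C) :
    supNorm f ≤ ENNReal.ofReal C :=
  iSup_le fun x => by
    rw [← ofReal_norm]; exact ENNReal.ofReal_le_ofReal (h x)

theorem abs_le_of_supNorm_le {f : ℝ → ℝ} {C : ℝ} (hC : 0 ≤ C) (h : supNorm f ≤ ENNReal.ofReal C)
    (x : ℝ) : |f x| ≤ C := by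
  have := (enorm_le_supNorm f x).trans h
  rw [← ofReal_norm] at this
  exact (ENNReal.ofReal_le_ofReal_iff hC).1 this

theorem supNorm_lt_top_iff {f : ℝ → ℝ} : supNorm f < ⊤ ↔ ∃ C, ∀ x, |f x| ≤ C := by
  constructor
  · intro h
    refine ⟨(supNorm f).toReal, abs_le_of_supNorm_le ENNReal.toReal_nonneg ?_⟩
    rw [ENNReal.ofReal_toReal h.ne]
  · rintro ⟨C, hC⟩
    exact (supNorm_le_ofReal hC).trans_lt ENNReal.ofReal_lt_top

theorem iteratedDeriv_two (f : ℝ → ℝ) : iteratedDeriv 2 f = deriv (deriv f) := by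
  rw [iteratedDeriv_succ, iteratedDeriv_one]

theorem normC_one (f : ℝ → ℝ) : normC 1 f = supNorm f + supNorm (deriv f) := by
  simp [normC, Finset.sum_range_succ]

theorem normX_zero (f : ℝ → ℝ) : normX 0 f = supNorm f + ∫⁻ x, ‖f x‖ₑ := by
  simp [normX, normC, normW]

theorem normX_two (f : ℝ → ℝ) : normX 2 f =
    (supNorm f + supNorm (deriv f) + supNorm (deriv (deriv f))) +
    ((∫⁻ x, ‖f x‖ₑ) + (∫⁻ x, ‖deriv f x‖ₑ) + ∫⁻ x, ‖deriv (deriv f) x‖ₑ) := by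
  simp [normX, normC, normW, Finset.sum_range_succ, iteratedDeriv_two]

theorem memX_zero_iff {f : ℝ → ℝ} :
    MemX 0 f ↔ Continuous f ∧ (∃ C, ∀ x, |f x| ≤ C) ∧ Integrable f := by
  have hc : ContDiff ℝ ((0 : ℕ) : WithTop ℕ∞) f ↔ Continuous f := by
    rw [Nat.cast_zero]; exact contDiff_zero
  unfold MemX
  rw [hc, normX_zero, ENNReal.add_lt_top, supNorm_lt_top_iff]
  constructor
  · rintro ⟨h1, h2, h3⟩
    exact ⟨h1, h2, h1.aestronglyMeasurable, h3⟩
  · rintro ⟨h1, h2, h3⟩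
    exact ⟨h1, h2, h3.2⟩

theorem memC_one_iff {f : ℝ → ℝ} : MemC 1 f ↔ Differentiable ℝ f ∧ Continuous (deriv f) ∧
    (∃ C, ∀ x, |f x| ≤ C) ∧ ∃ C, ∀ x, |deriv f x| ≤ C := by
  unfold MemC
  rw [normC_one, ENNReal.add_lt_top, supNorm_lt_top_iff, supNorm_lt_top_iff, Nat.cast_one,
    contDiff_one_iff_deriv, and_assoc]

theorem contDiff_two_iff {f : ℝ → ℝ} : ContDiff ℝ ((2 : ℕ) : WithTop ℕ∞) f ↔
    Differentiable ℝ f ∧ Differentiable ℝ (deriv f) ∧ Continuous (deriv (deriv f)) := by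
  have : ((2 : ℕ) : WithTop ℕ∞) = 1 + 1 := by norm_num
  rw [this, contDiff_succ_iff_deriv, contDiff_one_iff_deriv]
  simp

theorem momentum_eq (f : ℝ → ℝ) (x : ℝ) : momentum f x = f x - deriv (deriv f) x := by
  rw [momentum, iteratedDeriv_two]

/-! ### The operator `(1 - ∂ₓ²)⁻¹` -/

theorem helmholtzInv_eq {f : ℝ → ℝ} (hf : Integrable f) (x : ℝ) :
    helmholtzInv f x = (1 / 2) * (expL id f x + expR id f x) := by
  rw [helmholtzInv, ← integral_exp_abs_eq monotone_id hf]; rfl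

theorem hasDerivAt_expL_id {f : ℝ → ℝ} (hf : Integrable f) (hc : Continuous f) (x : ℝ) :
    HasDerivAt (expL id f) (f x - expL id f x) x := by
  simpa using hasDerivAt_expL monotone_id continuous_id hf hc (hasDerivAt_id x)

theorem hasDerivAt_expR_id {f : ℝ → ℝ} (hf : Integrable f) (hc : Continuous f) (x : ℝ) :
    HasDerivAt (expR id f) (expR id f x - f x) x := by
  simpa using hasDerivAt_expR monotone_id continuous_id hf hc (hasDerivAt_id x)

theorem hasDerivAt_helmholtzInv {f : ℝ → ℝ} (hf : Integrable f) (hc : Continuous f) (x : ℝ) :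
    HasDerivAt (helmholtzInv f) ((1 / 2) * (expR id f x - expL id f x)) x := by
  have : helmholtzInv f = fun x => (1 / 2) * (expL id f x + expR id f x) :=
    funext (helmholtzInv_eq hf)
  rw [this]
  convert! ((hasDerivAt_expL_id hf hc x).add (hasDerivAt_expR_id hf hc x)).const_mul (1 / 2) using 1
  ring

theorem deriv_helmholtzInv {f : ℝ → ℝ} (hf : Integrable f) (hc : Continuous f) :
    deriv (helmholtzInv f) = fun x => (1 / 2) * (expR id f x - expL id f x) :=
  funext fun x => (hasDerivAt_helmholtzInv hf hc x).deriv

theorem hasDerivAt_deriv_helmholtzInv {f : ℝ → ℝ} (hf : Integrable f) (hc : Continuous f) (x : ℝ) :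
    HasDerivAt (deriv (helmholtzInv f)) (helmholtzInv f x - f x) x := by
  rw [deriv_helmholtzInv hf hc, helmholtzInv_eq hf]
  convert! ((hasDerivAt_expR_id hf hc x).sub (hasDerivAt_expL_id hf hc x)).const_mul (1 / 2) using 1
  ring

theorem deriv_deriv_helmholtzInv {f : ℝ → ℝ} (hf : Integrable f) (hc : Continuous f) :
    deriv (deriv (helmholtzInv f)) = fun x => helmholtzInv f x - f x :=
  funext fun x => (hasDerivAt_deriv_helmholtzInv hf hc x).deriv

theorem momentum_helmholtzInv {f : ℝ → ℝ} (hf : Integrable f) (hc : Continuous f) :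
    momentum (helmholtzInv f) = f := by
  ext x
  rw [momentum_eq, deriv_deriv_helmholtzInv hf hc]; ring

theorem helmholtzInv_sub_deriv {f : ℝ → ℝ} (hf : Integrable f) (hc : Continuous f) (x : ℝ) :
    helmholtzInv f x - deriv (helmholtzInv f) x = expL id f x := by
  rw [helmholtzInv_eq hf, deriv_helmholtzInv hf hc]; ring

theorem helmholtzInv_add_deriv {f : ℝ → ℝ} (hf : Integrable f) (hc : Continuous f) (x : ℝ) :
    helmholtzInv f x + deriv (helmholtzInv f) x = expR id f x := by
  rw [helmholtzInv_eq hf, deriv_helmholtzInv hf hc]; ring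

theorem velocity_helmholtzInv {f g : ℝ → ℝ} (hf : Integrable f) (hfc : Continuous f)
    (hg : Integrable g) (hgc : Continuous g) (x : ℝ) :
    velocity (helmholtzInv f) (helmholtzInv g) x = expL id f x * expR id g x := by
  rw [velocity, helmholtzInv_sub_deriv hf hfc, helmholtzInv_add_deriv hg hgc]

theorem helmholtzInv_sub {f g : ℝ → ℝ} (hf : Integrable f) (hg : Integrable g) :
    helmholtzInv (f - g) = helmholtzInv f - helmholtzInv g := by
  ext x
  simp only [helmholtzInv, Pi.sub_apply, mul_sub]
  have := integral_sub (integrable_exp_abs measurable_id hf x)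
    (integrable_exp_abs measurable_id hg x)
  simp only [id] at this
  rw [this, mul_sub]

theorem abs_helmholtzInv_le {f : ℝ → ℝ} (hf : Integrable f) (x : ℝ) :
    |helmholtzInv f x| ≤ ∫ z, |f z| := by
  rw [helmholtzInv_eq hf]
  have h1 := abs_le.1 (abs_expL_le monotone_id hf x)
  have h2 := abs_le.1 (abs_expR_le monotone_id hf x)
  rw [abs_le]; constructor <;> linarith

theorem abs_deriv_helmholtzInv_le {f : ℝ → ℝ} (hf : Integrable f) (hc : Continuous f) (x : ℝ) :
    |deriv (helmholtzInv f) x| ≤ ∫ z, |f z| := by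
  rw [deriv_helmholtzInv hf hc]
  have h1 := abs_le.1 (abs_expL_le monotone_id hf x)
  have h2 := abs_le.1 (abs_expR_le monotone_id hf x)
  rw [abs_le]; constructor <;> linarith

/-! ### Norm bounds for `(1 - ∂ₓ²)⁻¹` -/

/-- Tonelli: for fixed η the kernel e^{η - x} on x ≥ η has total mass 1 in x. -/
theorem lintegral_expL_le {f : ℝ → ℝ} (hf : Integrable f) :
    ∫⁻ x, ‖expL id f x‖ₑ ≤ ∫⁻ x, ‖f x‖ₑ := by
  have hk : ∀ η : ℝ, ∫⁻ x, (Ici η).indicator (fun x => ENNReal.ofReal (Real.exp (η - x))) x = 1 := by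
    intro η
    rw [lintegral_indicator measurableSet_Ici, ← ofReal_integral_eq_lintegral_ofReal]
    · rw [integral_Ici_eq_integral_Ioi]
      have : ∀ x, Real.exp (η - x) = Real.exp η * Real.exp (-x) := fun x => by
        rw [← Real.exp_add]; ring_nf
      simp_rw [this]
      rw [integral_const_mul, integral_exp_neg_Ioi, ← Real.exp_add]; simp
    · have : ∀ x, Real.exp (η - x) = Real.exp η * Real.exp (-x) := fun x => by
        rw [← Real.exp_add]; ring_nf
      simp_rw [this]
      exact ((integrableOn_Ici_iff_integrableOn_Ioi (by simp)).2 (integrableOn_exp_neg_Ioi η)).const_mul _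
    · exact Eventually.of_forall fun x => (Real.exp_pos _).le
  have hsw : ∀ x η : ℝ, (Iic x).indicator (fun η => ENNReal.ofReal (Real.exp (η - x))) η
      = (Ici η).indicator (fun x => ENNReal.ofReal (Real.exp (η - x))) x := by
    intro x η
    by_cases h : η ≤ x <;> simp [indicator, h]
  have hm : Measurable (fun p : ℝ × ℝ =>
      (Ici p.2).indicator (fun x => ENNReal.ofReal (Real.exp (p.2 - x))) p.1) := by
    have : (fun p : ℝ × ℝ => (Ici p.2).indicator (fun x => ENNReal.ofReal (Real.exp (p.2 - x))) p.1)
      = {p : ℝ × ℝ | p.2 ≤ p.1}.indicator (fun p => ENNReal.ofReal (Real.exp (p.2 - p.1))) := by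
      ext p; simp [indicator]
    rw [this]
    exact Measurable.indicator (by fun_prop) (measurableSet_le measurable_snd measurable_fst)
  calc ∫⁻ x, ‖expL id f x‖ₑ
      ≤ ∫⁻ x, ∫⁻ η, (Ici η).indicator (fun x => ENNReal.ofReal (Real.exp (η - x))) x * ‖f η‖ₑ := by
        refine lintegral_mono fun x => ?_
        refine (enorm_integral_le_lintegral_enorm _).trans ?_
        rw [← lintegral_indicator measurableSet_Iic]
        refine lintegral_mono fun η => ?_
        simp only
        rw [← hsw]
        by_cases h : η ≤ x
        · simp only [indicator, mem_Iic, h, if_true, id, enorm_mul]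
          rw [Real.enorm_of_nonneg (Real.exp_pos _).le]
        · simp [indicator, h]
    _ = ∫⁻ η, ∫⁻ x, (Ici η).indicator (fun x => ENNReal.ofReal (Real.exp (η - x))) x * ‖f η‖ₑ := by
        refine lintegral_lintegral_swap ?_
        exact hm.aemeasurable.mul (hf.aestronglyMeasurable.enorm.comp_snd)
    _ = ∫⁻ η, ‖f η‖ₑ := by
        refine lintegral_congr fun η => ?_
        rw [lintegral_mul_const _ (Measurable.indicator (by fun_prop) measurableSet_Ici), hk, one_mul]

theorem lintegral_expR_le {f : ℝ → ℝ} (hf : Integrable f) :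
    ∫⁻ x, ‖expR id f x‖ₑ ≤ ∫⁻ x, ‖f x‖ₑ := by
  have h1 : ∀ x, expR id f x = expL id (fun η => f (-η)) (-x) := fun x => by
    rw [expR_eq_expL]; simp only [id, neg_neg]; rfl
  have h2 := lintegral_expL_le hf.comp_neg
  have e1 := (Measure.measurePreserving_neg (volume : Measure ℝ)).lintegral_comp_emb
    (MeasurableEquiv.neg ℝ).measurableEmbedding (fun x => ‖f x‖ₑ)
  have e2 := (Measure.measurePreserving_neg (volume : Measure ℝ)).lintegral_comp_emb
    (MeasurableEquiv.neg ℝ).measurableEmbedding (fun x => ‖expL id (fun η => f (-η)) x‖ₑ)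
  simp_rw [h1]
  rw [e2, ← e1]
  exact h2

theorem aemeasurable_enorm_of_continuous {f : ℝ → ℝ} (hf : Continuous f) :
    AEMeasurable (fun x => ‖f x‖ₑ) := hf.enorm.measurable.aemeasurable

theorem lintegral_half_le {f g : ℝ → ℝ} (hf : Continuous f) {I : ℝ≥0∞} {h : ℝ → ℝ}
    (hh : ∀ x, |h x| ≤ (1 / 2) * (|f x| + |g x|))
    (h1 : ∫⁻ x, ‖f x‖ₑ ≤ I) (h2 : ∫⁻ x, ‖g x‖ₑ ≤ I) : ∫⁻ x, ‖h x‖ₑ ≤ I := by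
  calc ∫⁻ x, ‖h x‖ₑ ≤ ∫⁻ x, ENNReal.ofReal (1 / 2) * (‖f x‖ₑ + ‖g x‖ₑ) := by
        refine lintegral_mono fun x => ?_
        simp only [← ofReal_norm, Real.norm_eq_abs]
        rw [← ENNReal.ofReal_add (abs_nonneg _) (abs_nonneg _),
          ← ENNReal.ofReal_mul (by norm_num)]
        exact ENNReal.ofReal_le_ofReal (hh x)
    _ = ENNReal.ofReal (1 / 2) * ((∫⁻ x, ‖f x‖ₑ) + ∫⁻ x, ‖g x‖ₑ) := by
        rw [lintegral_const_mul' _ _ ENNReal.ofReal_ne_top,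
          lintegral_add_left' (aemeasurable_enorm_of_continuous hf)]
    _ ≤ ENNReal.ofReal (1 / 2) * (I + I) := by gcongr
    _ = I := by
        rw [← two_mul, ← mul_assoc]
        have : ENNReal.ofReal (1 / 2) * 2 = 1 := by
          rw [show (2 : ℝ≥0∞) = ENNReal.ofReal 2 by simp, ← ENNReal.ofReal_mul (by norm_num)]; simp
        rw [this, one_mul]

theorem continuous_expL_id {f : ℝ → ℝ} (hf : Integrable f) (hc : Continuous f) :
    Continuous (expL id f) :=
  continuous_iff_continuousAt.2 fun x => (hasDerivAt_expL_id hf hc x).continuousAt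

theorem continuous_expR_id {f : ℝ → ℝ} (hf : Integrable f) (hc : Continuous f) :
    Continuous (expR id f) :=
  continuous_iff_continuousAt.2 fun x => (hasDerivAt_expR_id hf hc x).continuousAt

theorem lintegral_helmholtzInv_le {f : ℝ → ℝ} (hf : Integrable f) (hc : Continuous f) :
    ∫⁻ x, ‖helmholtzInv f x‖ₑ ≤ ∫⁻ x, ‖f x‖ₑ := by
  refine lintegral_half_le (continuous_expL_id hf hc) (fun x => ?_) (lintegral_expL_le hf)
    (lintegral_expR_le hf)
  rw [helmholtzInv_eq hf, abs_mul, abs_of_pos (by norm_num : (0 : ℝ) < 1 / 2)]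
  gcongr; exact abs_add_le _ _

theorem lintegral_deriv_helmholtzInv_le {f : ℝ → ℝ} (hf : Integrable f) (hc : Continuous f) :
    ∫⁻ x, ‖deriv (helmholtzInv f) x‖ₑ ≤ ∫⁻ x, ‖f x‖ₑ := by
  refine lintegral_half_le (continuous_expR_id hf hc) (fun x => ?_) (lintegral_expR_le hf)
    (lintegral_expL_le hf)
  rw [deriv_helmholtzInv hf hc, abs_mul, abs_of_pos (by norm_num : (0 : ℝ) < 1 / 2)]
  gcongr; exact abs_sub _ _

theorem ofReal_integral_abs {f : ℝ → ℝ} (hf : Integrable f) :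
    ENNReal.ofReal (∫ x, |f x|) = ∫⁻ x, ‖f x‖ₑ :=
  ofReal_integral_norm_eq_lintegral_enorm hf

theorem contDiff_helmholtzInv {f : ℝ → ℝ} (hf : Integrable f) (hc : Continuous f) :
    ContDiff ℝ ((2 : ℕ) : WithTop ℕ∞) (helmholtzInv f) := by
  refine contDiff_two_iff.2 ⟨fun x => (hasDerivAt_helmholtzInv hf hc x).differentiableAt,
    fun x => (hasDerivAt_deriv_helmholtzInv hf hc x).differentiableAt, ?_⟩
  rw [deriv_deriv_helmholtzInv hf hc]
  exact (continuous_iff_continuousAt.2 fun x =>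
    (hasDerivAt_helmholtzInv hf hc x).continuousAt).sub hc

theorem normX_zero_helmholtzInv_le {f : ℝ → ℝ} (hf : Integrable f) (hc : Continuous f) :
    normX 0 (helmholtzInv f) ≤ 2 * ∫⁻ x, ‖f x‖ₑ := by
  rw [normX_zero, two_mul]
  refine add_le_add ?_ (lintegral_helmholtzInv_le hf hc)
  rw [← ofReal_integral_abs hf]
  exact supNorm_le_ofReal (abs_helmholtzInv_le hf)

/-- The L^1 norm I of f controls the function and its first derivative in both norms. The second
derivative is the function minus f, which adds one sup norm of f and one more I. The six terms add
up to 7I plus that sup norm. -/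
theorem normX_two_helmholtzInv_le {f : ℝ → ℝ} (hf : Integrable f) (hc : Continuous f) :
    normX 2 (helmholtzInv f) ≤ 7 * normX 0 f := by
  set I := ∫⁻ x, ‖f x‖ₑ with hI
  set K := supNorm f with hK
  have h1 : supNorm (helmholtzInv f) ≤ I := by
    rw [hI, ← ofReal_integral_abs hf]; exact supNorm_le_ofReal (abs_helmholtzInv_le hf)
  have h2 : supNorm (deriv (helmholtzInv f)) ≤ I := by
    rw [hI, ← ofReal_integral_abs hf]; exact supNorm_le_ofReal (abs_deriv_helmholtzInv_le hf hc)
  have h3 : supNorm (deriv (deriv (helmholtzInv f))) ≤ I + K := by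
    rw [deriv_deriv_helmholtzInv hf hc]
    refine iSup_le fun x => (enorm_sub_le).trans
      (add_le_add ((enorm_le_supNorm _ x).trans h1) (enorm_le_supNorm _ x))
  have h4 := lintegral_helmholtzInv_le hf hc
  have h5 := lintegral_deriv_helmholtzInv_le hf hc
  have h6 : ∫⁻ x, ‖deriv (deriv (helmholtzInv f)) x‖ₑ ≤ I + I := by
    rw [deriv_deriv_helmholtzInv hf hc]
    calc ∫⁻ x, ‖helmholtzInv f x - f x‖ₑ ≤ ∫⁻ x, (‖helmholtzInv f x‖ₑ + ‖f x‖ₑ) :=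
          lintegral_mono fun x => enorm_sub_le
      _ = (∫⁻ x, ‖helmholtzInv f x‖ₑ) + I := by
          rw [lintegral_add_right' _ (aemeasurable_enorm_of_continuous hc)]
      _ ≤ _ := by gcongr
  rw [normX_two, normX_zero]
  calc _ ≤ (I + I + (I + K)) + (I + I + (I + I)) := by gcongr
    _ = 7 * I + K := by ring
    _ ≤ 7 * I + 7 * K := by
        gcongr
        exact le_mul_of_one_le_left (zero_le) (by norm_num)
    _ = _ := by ring

theorem memX_two_helmholtzInv {f : ℝ → ℝ} (hf : MemX 0 f) : MemX 2 (helmholtzInv f) := by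
  obtain ⟨hc, -, hi⟩ := memX_zero_iff.1 hf
  exact ⟨contDiff_helmholtzInv hi hc, (normX_two_helmholtzInv_le hi hc).trans_lt
    (ENNReal.mul_lt_top (by norm_num) hf.2)⟩

/-! ### Injectivity of `1 - ∂ₓ²` on bounded functions -/

theorem eq_zero_of_abs_mul_exp_le {p C : ℝ} (h : ∀ t : ℝ, 0 ≤ t → |p| * Real.exp t ≤ C) : p = 0 := by
  by_contra hp
  have hp' := abs_pos.2 hp
  have hC : 0 ≤ C := le_trans (by positivity) (h 0 le_rfl)
  have h1 := h (C / |p|) (by positivity)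
  have h2 := Real.add_one_le_exp (C / |p|)
  have h3 : |p| * (C / |p| + 1) ≤ C := (mul_le_mul_of_nonneg_left h2 hp'.le).trans h1
  rw [mul_add, mul_div_cancel₀ _ hp'.ne'] at h3
  linarith

theorem eq_zero_of_deriv_eq_self {p : ℝ → ℝ} {C : ℝ} (hp : ∀ x, HasDerivAt p (p x) x)
    (hC : ∀ x, |p x| ≤ C) (x : ℝ) : p x = 0 := by
  have h1 : ∀ z, HasDerivAt (fun z => p z * Real.exp (-z)) 0 z := fun z => by
    convert! (hp z).mul (hasDerivAt_neg z).exp using 1; ring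
  have h2 : ∀ z w, p z * Real.exp (-z) = p w * Real.exp (-w) := fun z w =>
    is_const_of_deriv_eq_zero (fun z => (h1 z).differentiableAt) (fun z => (h1 z).deriv) z w
  refine eq_zero_of_abs_mul_exp_le (C := C) fun t _ => ?_
  have h3 := h2 x (x + t)
  have : p x * Real.exp t = p (x + t) := by
    have e : Real.exp t = Real.exp (-x) * Real.exp (x + t) := by rw [← Real.exp_add]; ring_nf
    have e' : Real.exp (-(x + t)) * Real.exp (x + t) = 1 := by rw [← Real.exp_add]; simp
    rw [e, ← mul_assoc, h3, mul_assoc, e', mul_one]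
  rw [← Real.abs_exp t, ← abs_mul, this]
  exact hC _

/-- Both z + z' and the reflection of z - z' solve p' = p, whose only bounded solution is 0. -/
theorem eq_zero_of_bounded_of_deriv_deriv_eq_self {z z' : ℝ → ℝ} {C C' : ℝ}
    (h1 : ∀ x, HasDerivAt z (z' x) x) (h2 : ∀ x, HasDerivAt z' (z x) x)
    (hC : ∀ x, |z x| ≤ C) (hC' : ∀ x, |z' x| ≤ C') (x : ℝ) : z x = 0 := by
  have e1 := eq_zero_of_deriv_eq_self (p := fun x => z x + z' x) (C := C + C')
    (fun x => by convert! (h1 x).add (h2 x) using 1; ring)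
    (fun x => (abs_add_le _ _).trans (add_le_add (hC x) (hC' x))) x
  have e2 := eq_zero_of_deriv_eq_self (p := fun x => z (-x) - z' (-x)) (C := C + C')
    (fun x => by
      have hn := hasDerivAt_neg x
      have a1 := HasDerivAt.scomp x (h1 (-x)) hn
      have a2 := HasDerivAt.scomp x (h2 (-x)) hn
      convert! a1.sub a2 using 1; simp; ring)
    (fun x => (abs_sub _ _).trans (add_le_add (hC _) (hC' _))) (-x)
  simp only [neg_neg] at e1 e2
  linarith

/-- What membership in `X^2` amounts to. -/
theorem MemX.two_spec {w : ℝ → ℝ} (h : MemX 2 w) :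
    (Differentiable ℝ w ∧ Differentiable ℝ (deriv w) ∧ Continuous (deriv (deriv w))) ∧
    (∃ C, ∀ x, |w x| ≤ C) ∧ (∃ C, ∀ x, |deriv w x| ≤ C) ∧
    Integrable w ∧ Integrable (deriv w) ∧ MemX 0 (momentum w) := by
  have h1 := contDiff_two_iff.1 h.1
  have h2 := h.2
  rw [normX_two] at h2
  simp only [ENNReal.add_lt_top, supNorm_lt_top_iff] at h2
  obtain ⟨⟨⟨b0, b1⟩, b2⟩, ⟨⟨i0, i1⟩, i2⟩⟩ := h2
  have j0 : Integrable w := ⟨h1.1.continuous.aestronglyMeasurable, i0⟩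
  have j1 : Integrable (deriv w) := ⟨h1.2.1.continuous.aestronglyMeasurable, i1⟩
  have j2 : Integrable (deriv (deriv w)) := ⟨h1.2.2.aestronglyMeasurable, i2⟩
  refine ⟨h1, b0, b1, j0, j1, ?_⟩
  have hm : momentum w = fun x => w x - deriv (deriv w) x := funext (momentum_eq w)
  rw [hm]
  obtain ⟨C0, hC0⟩ := b0
  obtain ⟨C2, hC2⟩ := b2
  exact memX_zero_iff.2 ⟨h1.1.continuous.sub h1.2.2,
    ⟨C0 + C2, fun x => (abs_sub _ _).trans (add_le_add (hC0 x) (hC2 x))⟩, j0.sub j2⟩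

theorem helmholtzInv_momentum {w : ℝ → ℝ} (h : MemX 2 w) : helmholtzInv (momentum w) = w := by
  obtain ⟨⟨d1, d2, -⟩, ⟨C, hC⟩, ⟨C', hC'⟩, -, -, hm⟩ := h.two_spec
  obtain ⟨hc, -, hi⟩ := memX_zero_iff.1 hm
  ext x
  have := eq_zero_of_bounded_of_deriv_deriv_eq_self
    (z := fun x => w x - helmholtzInv (momentum w) x)
    (z' := fun x => deriv w x - deriv (helmholtzInv (momentum w)) x)
    (fun x => (d1 x).hasDerivAt.sub
      (hasDerivAt_helmholtzInv hi hc x).differentiableAt.hasDerivAt)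
    (fun x => by
      convert! (d2 x).hasDerivAt.sub (hasDerivAt_deriv_helmholtzInv hi hc x) using 1
      rw [momentum_eq]; ring)
    (fun x => (abs_sub _ _).trans (add_le_add (hC x) (abs_helmholtzInv_le hi x)))
    (fun x => (abs_sub _ _).trans (add_le_add (hC' x) (abs_deriv_helmholtzInv_le hi hc x))) x
  linarith

/-! ### Increasing maps `y` with `y - id ∈ E_l` -/

theorem memE_sub_id_iff {l : ℝ} {y : ℝ → ℝ} : MemE l (fun ξ => y ξ - ξ) ↔
    Differentiable ℝ y ∧ Continuous (deriv y) ∧ (∃ C, ∀ ξ, |y ξ - ξ| ≤ C) ∧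
    (∃ C, ∀ ξ, |deriv y ξ - 1| ≤ C) ∧ ∀ ξ, l ≤ deriv y ξ := by
  have hd : Differentiable ℝ (fun ξ => y ξ - ξ) ↔ Differentiable ℝ y := by
    constructor
    · intro h
      have : y = fun ξ => (y ξ - ξ) + ξ := by ext; ring
      rw [this]; exact h.add differentiable_id
    · intro h; exact h.sub differentiable_id
  have key : Differentiable ℝ y → deriv (fun ξ => y ξ - ξ) = fun ξ => deriv y ξ - 1 := fun h => by
    ext ξ
    exact ((h ξ).hasDerivAt.sub (hasDerivAt_id ξ)).deriv
  rw [MemE, memC_one_iff, hd]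
  constructor
  · rintro ⟨⟨h1, h2, h3, h4⟩, h5⟩
    rw [key h1] at h2 h4 h5
    refine ⟨h1, ?_, h3, h4, fun ξ => by linarith [h5 ξ]⟩
    have : deriv y = fun ξ => (deriv y ξ - 1) + 1 := by ext; ring
    rw [this]; exact h2.add continuous_const
  · rintro ⟨h1, h2, h3, h4, h5⟩
    rw [key h1]
    exact ⟨⟨h1, h2.sub continuous_const, h3, h4⟩, fun ξ => by linarith [h5 ξ]⟩

theorem MemE.strictMono {l : ℝ} {y : ℝ → ℝ} (hl : 0 < l) (h : MemE l (fun ξ => y ξ - ξ)) :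
    StrictMono y :=
  strictMono_of_deriv_pos fun ξ => hl.trans_le ((memE_sub_id_iff.1 h).2.2.2.2 ξ)

/-- A continuous map at bounded distance from the identity tends to ±∞ at ±∞. -/
theorem MemE.surjective {l : ℝ} {y : ℝ → ℝ} (h : MemE l (fun ξ => y ξ - ξ)) :
    Function.Surjective y := by
  obtain ⟨hd, -, ⟨C, hC⟩, -⟩ := memE_sub_id_iff.1 h
  refine hd.continuous.surjective ?_ ?_
  · refine tendsto_atTop_mono (f := fun ξ => ξ - C) (fun ξ => ?_)
      (tendsto_atTop_add_const_right _ _ tendsto_id)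
    have := (abs_le.1 (hC ξ)).1; linarith
  · refine tendsto_atBot_mono (fun ξ => (?_ : y ξ ≤ ξ + C))
      (tendsto_atBot_add_const_right _ _ tendsto_id)
    have := (abs_le.1 (hC ξ)).2; linarith

theorem MemE.mono {l l' : ℝ} {f : ℝ → ℝ} (h : MemE l f) (hl : l' ≤ l) : MemE l' f :=
  ⟨h.1, fun ξ => (sub_le_sub_right hl 1).trans (h.2 ξ)⟩

/-! ### Local existence of characteristics -/

/-- Pairs of bounded continuous functions. -/
def BoundedPair : Type := BoundedContinuousFunction ℝ ℝ × BoundedContinuousFunction ℝ ℝ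

instance : NormedAddCommGroup BoundedPair :=
  inferInstanceAs (NormedAddCommGroup
    (BoundedContinuousFunction ℝ ℝ × BoundedContinuousFunction ℝ ℝ))

instance : NormedSpace ℝ BoundedPair :=
  inferInstanceAs (NormedSpace ℝ
    (BoundedContinuousFunction ℝ ℝ × BoundedContinuousFunction ℝ ℝ))

instance : CompleteSpace BoundedPair :=
  inferInstanceAs (CompleteSpace
    (BoundedContinuousFunction ℝ ℝ × BoundedContinuousFunction ℝ ℝ))

/-- The space `C^1(ℝ)`, as the pairs `(f, f')` of bounded continuous functions. -/
def boundedC1 : Submodule ℝ BoundedPair where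
  carrier := {p | ∀ x, HasDerivAt p.1 (p.2 x) x}
  add_mem' := fun ha hb x => (ha x).add (hb x)
  zero_mem' := fun x => hasDerivAt_const x 0
  smul_mem' := fun c _ ha x => (ha x).const_smul c

/-- If functions converge and their derivatives converge uniformly, the limit of the derivatives is
the derivative of the limit. This makes `boundedC1` a Banach space, as Picard–Lindelöf requires. -/
theorem isClosed_boundedC1 : IsClosed (boundedC1 : Set BoundedPair) := by
  refine IsSeqClosed.isClosed fun p q hp hpq x => ?_
  have h1 := (continuous_fst.tendsto q).comp hpq
  have h2 := (continuous_snd.tendsto q).comp hpq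
  refine hasDerivAt_of_tendstoUniformly
    (BoundedContinuousFunction.tendsto_iff_tendstoUniformly.1 h2)
    (Eventually.of_forall fun n x => hp n x) (fun x => ?_) x
  exact (BoundedContinuousFunction.tendsto_iff_tendstoUniformly.1 h1).tendsto_at x

instance : CompleteSpace boundedC1 := isClosed_boundedC1.completeSpace_coe

theorem abs_le_norm_fst (ζ : boundedC1) (ξ : ℝ) : |ζ.1.1 ξ| ≤ ‖ζ‖ :=
  (ζ.1.1.norm_coe_le_norm ξ).trans (norm_fst_le ζ.1)

theorem abs_le_norm_snd (ζ : boundedC1) (ξ : ℝ) : |ζ.1.2 ξ| ≤ ‖ζ‖ :=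
  (ζ.1.2.norm_coe_le_norm ξ).trans (norm_snd_le ζ.1)

theorem boundedC1_norm_le {ζ : boundedC1} {C : ℝ} (hC : 0 ≤ C) (h1 : ∀ ξ, |ζ.1.1 ξ| ≤ C)
    (h2 : ∀ ξ, |ζ.1.2 ξ| ≤ C) : ‖ζ‖ ≤ C := by
  change ‖ζ.1‖ ≤ C
  refine norm_prod_le_iff.2 ?_
  exact ⟨(BoundedContinuousFunction.norm_le hC).2 h1, (BoundedContinuousFunction.norm_le hC).2 h2⟩

theorem exists_boundedC1 {f f' : ℝ → ℝ} {C C' : ℝ} (hd : ∀ x, HasDerivAt f (f' x) x)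
    (hc : Continuous f') (hC : ∀ x, |f x| ≤ C) (hC' : ∀ x, |f' x| ≤ C') :
    ∃ ζ : boundedC1, (∀ x, ζ.1.1 x = f x) ∧ ∀ x, ζ.1.2 x = f' x := by
  refine ⟨⟨(BoundedContinuousFunction.ofNormedAddCommGroup f
    (continuous_iff_continuousAt.2 fun x => (hd x).continuousAt) C hC,
    BoundedContinuousFunction.ofNormedAddCommGroup f' hc C' hC'), fun x => ?_⟩,
    fun x => rfl, fun x => rfl⟩
  exact hd x

/-- The cancellation on which everything rests: A' = M - y'A and B' = y'B - N, so the terms y'AB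
drop out of (AB)'. The characteristic field thus has C^1 bounds and Lipschitz constants independent
of y'. -/
theorem hasDerivAt_expL_mul_expR {y y' M N : ℝ → ℝ} (hy : Monotone y)
    (hd : ∀ ξ, HasDerivAt y (y' ξ) ξ) (hM : MemX 0 M) (hN : MemX 0 N) (ξ : ℝ) :
    HasDerivAt (fun ξ => -(expL y M ξ * expR y N ξ)) (N ξ * expL y M ξ - M ξ * expR y N ξ) ξ := by
  obtain ⟨Mc, -, Mi⟩ := memX_zero_iff.1 hM
  obtain ⟨Nc, -, Ni⟩ := memX_zero_iff.1 hN
  have hyc : Continuous y := continuous_iff_continuousAt.2 fun x => (hd x).continuousAt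
  convert! ((hasDerivAt_expL hy hyc Mi Mc (hd ξ)).mul
    (hasDerivAt_expR hy hyc Ni Nc (hd ξ))).neg using 1
  ring

theorem continuous_expL {y y' M : ℝ → ℝ} (hy : Monotone y) (hd : ∀ ξ, HasDerivAt y (y' ξ) ξ)
    (hM : MemX 0 M) : Continuous (expL y M) := by
  obtain ⟨Mc, -, Mi⟩ := memX_zero_iff.1 hM
  have hyc : Continuous y := continuous_iff_continuousAt.2 fun x => (hd x).continuousAt
  exact continuous_iff_continuousAt.2 fun x => (hasDerivAt_expL hy hyc Mi Mc (hd x)).continuousAt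

theorem continuous_expR {y y' M : ℝ → ℝ} (hy : Monotone y) (hd : ∀ ξ, HasDerivAt y (y' ξ) ξ)
    (hM : MemX 0 M) : Continuous (expR y M) := by
  obtain ⟨Mc, -, Mi⟩ := memX_zero_iff.1 hM
  have hyc : Continuous y := continuous_iff_continuousAt.2 fun x => (hd x).continuousAt
  exact continuous_iff_continuousAt.2 fun x => (hasDerivAt_expR hy hyc Mi Mc (hd x)).continuousAt

theorem abs_mul_sub_mul_le {a b c d A B e f : ℝ} (ha : |a - c| ≤ e) (hb : |b - d| ≤ f)
    (hB : |b| ≤ B) (hA : |c| ≤ A) : |a * b - c * d| ≤ e * B + A * f := by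
  have : a * b - c * d = (a - c) * b + c * (b - d) := by ring
  rw [this]
  refine (abs_add_le _ _).trans ?_
  rw [abs_mul, abs_mul]
  have := abs_nonneg (a - c); have := abs_nonneg b; have := abs_nonneg c
  have := abs_nonneg (b - d)
  gcongr
  · exact (abs_nonneg _).trans ha
  · exact (abs_nonneg _).trans hA

/-- The map `ξ ↦ ξ + ζ(ξ)`. -/
def shift (ζ : boundedC1) (ξ : ℝ) : ℝ := ξ + ζ.1.1 ξ

theorem hasDerivAt_shift (ζ : boundedC1) (ξ : ℝ) :
    HasDerivAt (shift ζ) (1 + ζ.1.2 ξ) ξ := (hasDerivAt_id ξ).add (ζ.2 ξ)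

theorem strictMono_shift {ζ : boundedC1} (h : ∀ ξ, 0 < 1 + ζ.1.2 ξ) :
    StrictMono (shift ζ) :=
  strictMono_of_deriv_pos fun ξ => by rw [(hasDerivAt_shift ζ ξ).deriv]; exact h ξ

/-- The vector field of the characteristic equation on `C^1(ℝ)`, extended by `0`. -/
theorem exists_characteristic_field {M N : ℝ → ℝ} (hM : MemX 0 M) (hN : MemX 0 N) :
    ∃ (F : boundedC1 → boundedC1) (L K : NNReal), (∀ ζ, ‖F ζ‖ ≤ L) ∧
      (∀ ζ : boundedC1, (∀ ξ, 0 < 1 + ζ.1.2 ξ) →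
        ∀ ξ, (F ζ).1.1 ξ = -(expL (shift ζ) M ξ * expR (shift ζ) N ξ)) ∧
      ∀ ζ₁ ζ₂ : boundedC1, (∀ ξ, 0 < 1 + ζ₁.1.2 ξ) → (∀ ξ, 0 < 1 + ζ₂.1.2 ξ) →
        ‖F ζ₁ - F ζ₂‖ ≤ K * ‖ζ₁ - ζ₂‖ := by
  obtain ⟨Mc, ⟨CM, hCM⟩, Mi⟩ := memX_zero_iff.1 hM
  obtain ⟨Nc, ⟨CN, hCN⟩, Ni⟩ := memX_zero_iff.1 hN
  set IM := ∫ η, |M η| with hIM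
  set IN := ∫ η, |N η| with hIN
  have IM0 : 0 ≤ IM := integral_nonneg fun _ => abs_nonneg _
  have IN0 : 0 ≤ IN := integral_nonneg fun _ => abs_nonneg _
  have CM0 : 0 ≤ CM := (abs_nonneg _).trans (hCM 0)
  have CN0 : 0 ≤ CN := (abs_nonneg _).trans (hCN 0)
  have bd1 : ∀ ζ : boundedC1, (∀ ξ, 0 < 1 + ζ.1.2 ξ) → ∀ ξ,
      |-(expL (shift ζ) M ξ * expR (shift ζ) N ξ)| ≤ IM * IN := fun ζ hζ ξ => by
    have hm := (strictMono_shift hζ).monotone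
    rw [abs_neg, abs_mul]
    exact mul_le_mul (abs_expL_le hm Mi ξ) (abs_expR_le hm Ni ξ) (abs_nonneg _) IM0
  have bd2 : ∀ ζ : boundedC1, (∀ ξ, 0 < 1 + ζ.1.2 ξ) → ∀ ξ,
      |N ξ * expL (shift ζ) M ξ - M ξ * expR (shift ζ) N ξ| ≤ CN * IM + CM * IN := fun ζ hζ ξ => by
    have hm := (strictMono_shift hζ).monotone
    refine (abs_sub _ _).trans ?_
    rw [abs_mul, abs_mul]
    exact add_le_add (mul_le_mul (hCN ξ) (abs_expL_le hm Mi ξ) (abs_nonneg _) CN0)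
      (mul_le_mul (hCM ξ) (abs_expR_le hm Ni ξ) (abs_nonneg _) CM0)
  have hex : ∀ ζ : boundedC1, ∃ w : boundedC1, ((∀ ξ, 0 < 1 + ζ.1.2 ξ) →
      (∀ ξ, w.1.1 ξ = -(expL (shift ζ) M ξ * expR (shift ζ) N ξ)) ∧
      ∀ ξ, w.1.2 ξ = N ξ * expL (shift ζ) M ξ - M ξ * expR (shift ζ) N ξ) ∧
      ((¬ ∀ ξ, 0 < 1 + ζ.1.2 ξ) → w = 0) := by
    intro ζ
    by_cases hζ : ∀ ξ, 0 < 1 + ζ.1.2 ξ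
    · have hm := (strictMono_shift hζ).monotone
      have cL := continuous_expL hm (hasDerivAt_shift ζ) hM
      have cR := continuous_expR hm (hasDerivAt_shift ζ) hN
      obtain ⟨w, h1, h2⟩ := exists_boundedC1
        (hasDerivAt_expL_mul_expR hm (hasDerivAt_shift ζ) hM hN) (by fun_prop) (bd1 ζ hζ) (bd2 ζ hζ)
      exact ⟨w, fun _ => ⟨h1, h2⟩, fun h => absurd hζ h⟩
    · exact ⟨0, fun h => absurd h hζ, fun _ => rfl⟩
  choose F hF1 hF2 using hex
  -- The bound is the sum of the sup bounds for the field and its derivative. In the Lipschitz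
  -- constant each exponential integral contributes a factor 2: the product AB has two varying
  -- factors, hence 4, and each term of NA - MB has one, hence 2.
  refine ⟨F, ⟨IM * IN + (CN * IM + CM * IN), by positivity⟩,
    ⟨4 * IM * IN + 2 * (CN * IM + CM * IN), by positivity⟩, fun ζ => ?_,
    fun ζ hζ => (hF1 ζ hζ).1, fun ζ₁ ζ₂ h₁ h₂ => ?_⟩
  · change ‖F ζ‖ ≤ IM * IN + (CN * IM + CM * IN)
    by_cases hζ : ∀ ξ, 0 < 1 + ζ.1.2 ξ
    · refine boundedC1_norm_le (by positivity) (fun ξ => ?_) (fun ξ => ?_)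
      · rw [(hF1 ζ hζ).1]
        exact (bd1 ζ hζ ξ).trans (le_add_of_nonneg_right (by positivity))
      · rw [(hF1 ζ hζ).2]
        exact (bd2 ζ hζ ξ).trans (le_add_of_nonneg_left (by positivity))
    · rw [hF2 ζ hζ, norm_zero]; positivity
  · change _ ≤ (4 * IM * IN + 2 * (CN * IM + CM * IN)) * ‖ζ₁ - ζ₂‖
    set d := ‖ζ₁ - ζ₂‖ with hd
    have hd0 : 0 ≤ d := norm_nonneg _
    have m1 := (strictMono_shift h₁).monotone
    have m2 := (strictMono_shift h₂).monotone
    have hdist : ∀ ξ, |(shift ζ₁) ξ - (shift ζ₂) ξ| ≤ d := fun ξ => by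
      have := abs_le_norm_fst (ζ₁ - ζ₂) ξ
      convert this using 2
      simp only [shift, add_sub_add_left_eq_sub]; rfl
    have dA := abs_expL_sub_le m1 m2 Mi hdist
    have dB := abs_expR_sub_le m1 m2 Ni hdist
    refine boundedC1_norm_le (by positivity) (fun ξ => ?_) (fun ξ => ?_)
    · have e : (F ζ₁ - F ζ₂).1.1 ξ = (F ζ₁).1.1 ξ - (F ζ₂).1.1 ξ := rfl
      rw [e, (hF1 ζ₁ h₁).1, (hF1 ζ₂ h₂).1, neg_sub_neg, abs_sub_comm]
      refine (abs_mul_sub_mul_le (dA ξ) (dB ξ) (abs_expR_le m1 Ni ξ)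
        (abs_expL_le m2 Mi ξ)).trans ?_
      rw [← hIM, ← hIN]
      have : 0 ≤ 2 * (CN * IM + CM * IN) * d := by positivity
      linarith
    · have e : (F ζ₁ - F ζ₂).1.2 ξ = (F ζ₁).1.2 ξ - (F ζ₂).1.2 ξ := rfl
      rw [e, (hF1 ζ₁ h₁).2, (hF1 ζ₂ h₂).2]
      have e2 : N ξ * expL (shift ζ₁) M ξ - M ξ * expR (shift ζ₁) N ξ
          - (N ξ * expL (shift ζ₂) M ξ - M ξ * expR (shift ζ₂) N ξ)
          = N ξ * (expL (shift ζ₁) M ξ - expL (shift ζ₂) M ξ)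
            - M ξ * (expR (shift ζ₁) N ξ - expR (shift ζ₂) N ξ) := by ring
      rw [e2]
      refine (abs_sub _ _).trans ?_
      rw [abs_mul, abs_mul]
      have t1 := mul_le_mul (hCN ξ) (dA ξ) (abs_nonneg _) CN0
      have t2 := mul_le_mul (hCM ξ) (dB ξ) (abs_nonneg _) CM0
      rw [← hIM] at t1
      rw [← hIN] at t2
      have : 0 ≤ 4 * IM * IN * d := by positivity
      linarith

/-- The characteristic equation is solvable near any time, on an interval whose length depends
only on the lower bound of `y'`. -/
theorem exists_local_characteristic {M N : ℝ → ℝ} (hM : MemX 0 M) (hN : MemX 0 N) {ε : ℝ}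
    (hε : 0 < ε) : ∃ τ > 0, ∀ (t₀ : ℝ) (z₀ : ℝ → ℝ), MemE ε (fun ξ => z₀ ξ - ξ) →
      ∃ z : ℝ → ℝ → ℝ, z t₀ = z₀ ∧ ∀ t ∈ Ioo (t₀ - τ) (t₀ + τ),
        MemE (ε / 2) (fun ξ => z t ξ - ξ) ∧
        Tendsto (fun s => normC 1 (fun ξ => (z s ξ - ξ) - (z t ξ - ξ))) (𝓝 t) (𝓝 0) ∧
        ∀ ξ, HasDerivAt (fun s => z s ξ) (-(expL (z t) M ξ * expR (z t) N ξ)) t := by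
  obtain ⟨F, L, K, hL, hF, hK⟩ := exists_characteristic_field hM hN
  have hL0 : (0 : ℝ) < L + 1 := by positivity
  refine ⟨ε / 2 / (L + 1), by positivity, fun t₀ z₀ hz₀ => ?_⟩
  -- At speed at most L, a time τ moves the curve by at most ε/2 in C^1, so the derivative stays at
  -- least ε/2. The added 1 avoids division by zero when L = 0.
  set τ := ε / 2 / ((L : ℝ) + 1) with hτ
  have hτ0 : 0 < τ := by positivity
  have hLτ : L * τ ≤ ε / 2 := by
    rw [hτ, ← mul_div_assoc, div_le_iff₀ hL0]; nlinarith [L.2]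
  obtain ⟨zd, zc, ⟨C, hC⟩, ⟨C', hC'⟩, hlow⟩ := memE_sub_id_iff.1 hz₀
  obtain ⟨x₀, hx₀, hx₀'⟩ := exists_boundedC1 (f := fun ξ => z₀ ξ - ξ) (f' := fun ξ => deriv z₀ ξ - 1)
    (fun ξ => (zd ξ).hasDerivAt.sub (hasDerivAt_id ξ)) (zc.sub continuous_const) hC hC'
  have hball : ∀ ζ : boundedC1, ‖ζ - x₀‖ ≤ ε / 2 → ∀ ξ, ε / 2 ≤ 1 + ζ.1.2 ξ := by
    intro ζ hζ ξ
    have h1 := (abs_le.1 ((abs_le_norm_snd (ζ - x₀) ξ).trans hζ)).1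
    have h2 : (ζ - x₀).1.2 ξ = ζ.1.2 ξ - x₀.1.2 ξ := rfl
    rw [h2, hx₀'] at h1
    linarith [hlow ξ]
  have hpos : ∀ ζ : boundedC1, ‖ζ - x₀‖ ≤ ε / 2 → ∀ ξ, 0 < 1 + ζ.1.2 ξ := fun ζ hζ ξ =>
    lt_of_lt_of_le (by positivity) (hball ζ hζ ξ)
  -- The extension of the field by 0 need not be continuous. Picard–Lindelöf uses the Lipschitz
  -- bound only on the ball of radius ε/2, where all maps are increasing.
  let T₀ : Icc (t₀ - τ) (t₀ + τ) := ⟨t₀, by constructor <;> linarith⟩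
  have hPL : IsPicardLindelof (fun _ => F) T₀ x₀ ⟨ε / 2, by positivity⟩ 0 L K := by
    refine IsPicardLindelof.of_time_independent (fun x _ => hL x) ?_ ?_
    · refine LipschitzOnWith.of_dist_le_mul fun x hx y hy => ?_
      rw [Metric.mem_closedBall, dist_eq_norm] at hx hy
      rw [dist_eq_norm, dist_eq_norm]
      exact hK x y (hpos x hx) (hpos y hy)
    · change (L : ℝ) * max (t₀ + τ - t₀) (t₀ - (t₀ - τ)) ≤ ε / 2 - 0
      rw [add_sub_cancel_left, sub_sub_cancel, max_self, sub_zero]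
      exact hLτ
  obtain ⟨α, hα0, hα⟩ := hPL.exists_eq_forall_mem_Icc_hasDerivWithinAt₀
  have hα0' : α t₀ = x₀ := hα0
  -- The global bound on the field keeps the curve in the ball, where the field is the true one
  -- rather than its extension.
  have hstay : ∀ t ∈ Icc (t₀ - τ) (t₀ + τ), ‖α t - x₀‖ ≤ ε / 2 := by
    intro t ht
    have h1 := (convex_Icc (t₀ - τ) (t₀ + τ)).norm_image_sub_le_of_norm_hasDerivWithin_le hα
      (fun t _ => hL (α t)) T₀.2 ht
    change ‖α t - α t₀‖ ≤ L * ‖t - t₀‖ at h1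
    rw [hα0'] at h1
    refine h1.trans (le_trans ?_ hLτ)
    gcongr
    rw [Real.norm_eq_abs, abs_le]
    constructor <;> linarith [ht.1, ht.2]
  refine ⟨fun t => (shift (α t)), ?_, fun t ht => ?_⟩
  · ext ξ
    change ξ + (α t₀).1.1 ξ = z₀ ξ
    rw [hα0', hx₀]; ring
  have htI := Ioo_subset_Icc_self ht
  have hda : HasDerivAt α (F (α t)) t := (hα t htI).hasDerivAt (Icc_mem_nhds ht.1 ht.2)
  have hs : ∀ t, deriv (shift (α t)) = fun ξ => 1 + (α t).1.2 ξ := fun t =>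
    funext fun ξ => ((hasDerivAt_shift (α t)) ξ).deriv
  refine ⟨memE_sub_id_iff.2 ⟨fun ξ => ((hasDerivAt_shift (α t)) ξ).differentiableAt, ?_,
    ⟨‖α t‖, fun ξ => ?_⟩, ⟨‖α t‖, fun ξ => ?_⟩, fun ξ => ?_⟩, ?_, fun ξ => ?_⟩
  · rw [hs]; fun_prop
  · simpa [shift] using abs_le_norm_fst (α t) ξ
  · rw [hs]; simpa using abs_le_norm_snd (α t) ξ
  · rw [hs]; exact hball _ (hstay t htI) ξ
  · have hc : Tendsto (fun s => ‖α s - α t‖) (𝓝 t) (𝓝 0) := by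
      have := (hda.continuousAt.sub (continuousAt_const (y := α t))).norm
      simpa [ContinuousAt] using this
    have hc2 : Tendsto (fun s => ENNReal.ofReal ‖α s - α t‖ + ENNReal.ofReal ‖α s - α t‖)
        (𝓝 t) (𝓝 0) := by
      have := (ENNReal.tendsto_ofReal hc).add (ENNReal.tendsto_ofReal hc)
      simpa using this
    refine tendsto_of_tendsto_of_tendsto_of_le_of_le tendsto_const_nhds hc2
      (fun _ => zero_le) fun s => ?_
    have e1 : (fun ξ => ((shift (α s)) ξ - ξ) - ((shift (α t)) ξ - ξ)) = (α s - α t).1.1 := by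
      ext ξ
      change ξ + (α s).1.1 ξ - ξ - (ξ + (α t).1.1 ξ - ξ) = (α s).1.1 ξ - (α t).1.1 ξ
      ring
    have e2 : deriv (α s - α t).1.1 = (α s - α t).1.2 := funext fun ξ => ((α s - α t).2 ξ).deriv
    simp only
    rw [e1, normC_one, e2]
    exact add_le_add (supNorm_le_ofReal (abs_le_norm_fst _)) (supNorm_le_ofReal (abs_le_norm_snd _))
  · have h1 : HasDerivAt (fun s => (α s).1.1 ξ) ((F (α t)).1.1 ξ) t := by
      let ev : boundedC1 →L[ℝ] ℝ := (BoundedContinuousFunction.evalCLM ℝ ξ).comp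
        ((ContinuousLinearMap.fst ℝ (BoundedContinuousFunction ℝ ℝ)
          (BoundedContinuousFunction ℝ ℝ) : BoundedPair →L[ℝ] _).comp boundedC1.subtypeL)
      exact ev.hasFDerivAt.comp_hasDerivAt t hda
    rw [hF (α t) (hpos _ (hstay t htI))] at h1
    exact h1.const_add ξ

/-! ### Time intervals -/

theorem isOpen_timeInterval (S T : EReal) : IsOpen (timeInterval S T) :=
  (isOpen_lt continuous_const continuous_coe_real_ereal).inter
    (isOpen_lt continuous_coe_real_ereal continuous_const)

theorem Icc_subset_timeInterval {S T : EReal} {a b : ℝ} (ha : a ∈ timeInterval S T)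
    (hb : b ∈ timeInterval S T) : Icc a b ⊆ timeInterval S T := fun _ ht =>
  ⟨ha.1.trans_le (EReal.coe_le_coe_iff.2 ht.1), (EReal.coe_le_coe_iff.2 ht.2).trans_lt hb.2⟩

theorem zero_mem_timeInterval {S T : EReal} (hS : 0 < S) (hT : 0 < T) :
    (0 : ℝ) ∈ timeInterval S T := by
  refine ⟨?_, by simpa using hT⟩
  rw [EReal.coe_zero, EReal.neg_lt_comm]; simpa using hS

theorem uIcc_subset_timeInterval {S T : EReal} {a b : ℝ} (ha : a ∈ timeInterval S T)
    (hb : b ∈ timeInterval S T) : uIcc a b ⊆ timeInterval S T := by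
  rcases le_total a b with h | h
  · rw [uIcc_of_le h]; exact Icc_subset_timeInterval ha hb
  · rw [uIcc_of_ge h]; exact Icc_subset_timeInterval hb ha

theorem exists_Icc_subset_of_mem_timeInterval {S T : EReal} {t : ℝ} (ht : t ∈ timeInterval S T) :
    ∃ a ∈ timeInterval S T, ∃ b ∈ timeInterval S T, t ∈ Ioo a b ∧ Icc a b ⊆ timeInterval S T := by
  obtain ⟨ε, hε, h⟩ := Metric.isOpen_iff.1 (isOpen_timeInterval S T) t ht
  have h1 : t - ε / 2 ∈ timeInterval S T := h (by
    rw [Metric.mem_ball, Real.dist_eq, abs_lt]; constructor <;> linarith)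
  have h2 : t + ε / 2 ∈ timeInterval S T := h (by
    rw [Metric.mem_ball, Real.dist_eq, abs_lt]; constructor <;> linarith)
  exact ⟨_, h1, _, h2, ⟨by linarith, by linarith⟩, Icc_subset_timeInterval h1 h2⟩

/-! ### Characteristics on a set of times -/

/-- The density `w₀(y₀) y₀'` of `w₀` in Lagrangian coordinates. -/
def lagDensity (w₀ y₀ : ℝ → ℝ) (η : ℝ) : ℝ := w₀ (y₀ η) * deriv y₀ η

theorem memX_lagDensity {w₀ y₀ : ℝ → ℝ} {c : ℝ} (hc : 0 < c) (hw : MemX 0 w₀)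
    (hy₀ : MemE c (fun ξ => y₀ ξ - ξ)) : MemX 0 (lagDensity w₀ y₀) := by
  obtain ⟨wc, ⟨C, hC⟩, wi⟩ := memX_zero_iff.1 hw
  obtain ⟨yd, yc, -, ⟨C', hC'⟩, -⟩ := memE_sub_id_iff.1 hy₀
  have := yd.continuous
  refine memX_zero_iff.2 ⟨by unfold lagDensity; fun_prop, ⟨C * (C' + 1), fun ξ => ?_⟩, ?_⟩
  · rw [lagDensity, abs_mul]
    refine mul_le_mul (hC _) ?_ (abs_nonneg _) ((abs_nonneg _).trans (hC 0))
    have h1 := abs_le.1 (hC' ξ)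
    rw [abs_le]; constructor <;> linarith
  · exact (integrable_comp_mul_deriv_iff (hy₀.strictMono hc) hy₀.surjective
      fun ξ => (yd ξ).hasDerivAt).1 wi

/-- Splitting the integrals at η = ξ gives U = (A + B)/2 and W = (B - A)/2 for the same density,
hence W - U = -A. In the same way Z + V is the right-hand integral of the other density. -/
theorem lag_velocity_eq {m₀ n₀ y₀ y : ℝ → ℝ} (hM : Integrable (lagDensity m₀ y₀))
    (hN : Integrable (lagDensity n₀ y₀)) (hy : StrictMono y) (ξ : ℝ) :
    (lagW m₀ y₀ y ξ - lagU m₀ y₀ y ξ) * (lagW n₀ y₀ y ξ + lagU n₀ y₀ y ξ)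
      = -(expL y (lagDensity m₀ y₀) ξ * expR y (lagDensity n₀ y₀) ξ) := by
  have a1 := integral_exp_abs_eq hy.monotone hM ξ
  have a2 := integral_exp_abs_eq hy.monotone hN ξ
  have b1 := integral_sign_exp_abs_eq hy hM ξ
  have b2 := integral_sign_exp_abs_eq hy hN ξ
  unfold lagDensity at *
  rw [lagW, lagU, lagW, lagU, a1, a2, b1, b2]
  ring

/-- `y` solves `∂ₜy = -A B`, `A = expL y M`, `B = expR y N`, at the times in `J`, in the class of
curves of increasing `C^1` maps. -/
structure CharOn (M N : ℝ → ℝ) (J : Set ℝ) (y : ℝ → ℝ → ℝ) : Prop where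
  memE : ∀ a ∈ J, ∀ b ∈ J, ∃ l > 0, ∀ t ∈ Icc a b, MemE l (fun ξ => y t ξ - ξ)
  cont : ∀ t ∈ J, Tendsto (fun s => normC 1 (fun ξ => (y s ξ - ξ) - (y t ξ - ξ))) (𝓝 t) (𝓝 0)
  ode : ∀ t ∈ J, ∀ ξ, HasDerivAt (fun s => y s ξ) (-(expL (y t) M ξ * expR (y t) N ξ)) t

theorem CharOn.strictMono {M N : ℝ → ℝ} {J : Set ℝ} {y : ℝ → ℝ → ℝ} (h : CharOn M N J y) {t : ℝ}
    (ht : t ∈ J) : StrictMono (y t) := by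
  obtain ⟨l, hl, h⟩ := h.memE t ht t ht
  exact (h t ⟨le_rfl, le_rfl⟩).strictMono hl

theorem isCharacteristic_iff {m₀ n₀ y₀ : ℝ → ℝ} {S T : EReal} {y : ℝ → ℝ → ℝ}
    (hM : Integrable (lagDensity m₀ y₀)) (hN : Integrable (lagDensity n₀ y₀)) :
    IsCharacteristic m₀ n₀ y₀ S T y ↔
      CharOn (lagDensity m₀ y₀) (lagDensity n₀ y₀) (timeInterval S T) y ∧ ∀ ξ, y 0 ξ = y₀ ξ := by
  constructor
  · intro h
    refine ⟨⟨h.memE, h.cont, fun t ht ξ => ?_⟩, h.init⟩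
    obtain ⟨l, hl, hl'⟩ := h.memE t ht t ht
    have hm := (hl' t ⟨le_rfl, le_rfl⟩).strictMono hl
    rw [← lag_velocity_eq hM hN hm]
    exact h.ode t ht ξ
  · rintro ⟨h, h0⟩
    refine ⟨h.memE, h.cont, h0, fun t ht ξ => ?_⟩
    rw [lag_velocity_eq hM hN (h.strictMono ht)]
    exact h.ode t ht ξ

/-- At the junction the velocity depends only on the common map at that time, so the two one-sided
derivatives agree and form a two-sided one. The positive lower bounds on the two sides combine by
their minimum. -/
theorem CharOn.glue {M N : ℝ → ℝ} {J J₁ J₂ : Set ℝ} {y₁ y₂ : ℝ → ℝ → ℝ} {t₀ : ℝ}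
    (h₁ : CharOn M N J₁ y₁) (h₂ : CharOn M N J₂ y₂) (ht₁ : t₀ ∈ J₁) (ht₂ : t₀ ∈ J₂)
    (heq : y₁ t₀ = y₂ t₀) (hJ₁ : ∀ t ∈ J, t ≤ t₀ → t ∈ J₁) (hJ₂ : ∀ t ∈ J, t₀ ≤ t → t ∈ J₂) :
    CharOn M N J (fun t => if t ≤ t₀ then y₁ t else y₂ t) := by
  have e1 : ∀ t ≤ t₀, (if t ≤ t₀ then y₁ t else y₂ t) = y₁ t := fun t ht => if_pos ht
  have e2 : ∀ t, t₀ ≤ t → (if t ≤ t₀ then y₁ t else y₂ t) = y₂ t := fun t ht => by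
    rcases ht.eq_or_lt with h | h
    · subst h; rw [if_pos le_rfl, heq]
    · rw [if_neg (not_le.2 h)]
  have ev1 : ∀ t < t₀, ∀ᶠ s in 𝓝 t, s ≤ t₀ := fun t ht =>
    (eventually_lt_nhds ht).mono fun s hs => le_of_lt hs
  have ev2 : ∀ t, t₀ < t → ∀ᶠ s in 𝓝 t, t₀ ≤ s := fun t ht =>
    (eventually_gt_nhds ht).mono fun s hs => le_of_lt hs
  refine ⟨fun a ha b hb => ?_, fun t ht => ?_, fun t ht ξ => ?_⟩
  · have k1 : ∃ l > 0, ∀ t ∈ Icc a b, t ≤ t₀ → MemE l (fun ξ => y₁ t ξ - ξ) := by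
      rcases le_total a t₀ with h | h
      · obtain ⟨l, hl, hl'⟩ := h₁.memE a (hJ₁ a ha h) t₀ ht₁
        exact ⟨l, hl, fun t ht hle => hl' t ⟨ht.1, hle⟩⟩
      · obtain ⟨l, hl, hl'⟩ := h₁.memE t₀ ht₁ t₀ ht₁
        exact ⟨l, hl, fun t ht hle => hl' t ⟨h.trans ht.1, hle⟩⟩
    have k2 : ∃ l > 0, ∀ t ∈ Icc a b, t₀ ≤ t → MemE l (fun ξ => y₂ t ξ - ξ) := by
      rcases le_total b t₀ with h | h
      · obtain ⟨l, hl, hl'⟩ := h₂.memE t₀ ht₂ t₀ ht₂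
        exact ⟨l, hl, fun t ht hle => hl' t ⟨hle, ht.2.trans h⟩⟩
      · obtain ⟨l, hl, hl'⟩ := h₂.memE t₀ ht₂ b (hJ₂ b hb h)
        exact ⟨l, hl, fun t ht hle => hl' t ⟨hle, ht.2⟩⟩
    obtain ⟨l₁, hl₁, k1⟩ := k1
    obtain ⟨l₂, hl₂, k2⟩ := k2
    refine ⟨min l₁ l₂, lt_min hl₁ hl₂, fun t ht => ?_⟩
    rcases le_total t t₀ with h | h
    · simp only [e1 t h]; exact (k1 t ht h).mono (min_le_left _ _)
    · simp only [e2 t h]; exact (k2 t ht h).mono (min_le_right _ _)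
  · rcases lt_trichotomy t t₀ with h | h | h
    · simp only [e1 t h.le]
      refine (h₁.cont t (hJ₁ t ht h.le)).congr' ?_
      filter_upwards [ev1 t h] with s hs
      rw [e1 s hs]
    · subst h
      have := (h₁.cont t ht₁).add (h₂.cont t ht₂)
      rw [add_zero] at this
      refine tendsto_of_tendsto_of_tendsto_of_le_of_le tendsto_const_nhds this
        (fun _ => zero_le) fun s => ?_
      rcases le_total s t with h | h
      · simp only [e1 s h, e1 t le_rfl]; exact le_self_add
      · simp only [e2 s h, e2 t le_rfl]; exact le_add_self
    · simp only [e2 t h.le]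
      refine (h₂.cont t (hJ₂ t ht h.le)).congr' ?_
      filter_upwards [ev2 t h] with s hs
      rw [e2 s hs]
  · rcases lt_trichotomy t t₀ with h | h | h
    · simp only [e1 t h.le]
      refine (h₁.ode t (hJ₁ t ht h.le) ξ).congr_of_eventuallyEq ?_
      filter_upwards [ev1 t h] with s hs
      rw [e1 s hs]
    · subst h
      have d1 := (h₁.ode t ht₁ ξ).hasDerivWithinAt (s := Iic t)
      have d2 := (h₂.ode t ht₂ ξ).hasDerivWithinAt (s := Ici t)
      rw [← heq] at d2
      simp only [e1 t le_rfl]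
      have d1' : HasDerivWithinAt (fun s => (if s ≤ t then y₁ s else y₂ s) ξ) _ (Iic t) t :=
        d1.congr (fun s hs => by rw [e1 s hs]) (by rw [e1 t le_rfl])
      have d2' : HasDerivWithinAt (fun s => (if s ≤ t then y₁ s else y₂ s) ξ) _ (Ici t) t :=
        d2.congr (fun s hs => by rw [e2 s hs]) (by rw [e2 t le_rfl])
      have := d1'.union d2'
      rwa [Iic_union_Ici, hasDerivWithinAt_univ] at this
    · simp only [e2 t h.le]
      refine (h₂.ode t (hJ₂ t ht h.le) ξ).congr_of_eventuallyEq ?_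
      filter_upwards [ev2 t h] with s hs
      rw [e2 s hs]

theorem exists_local_charOn {M N : ℝ → ℝ} (hM : MemX 0 M) (hN : MemX 0 N) {ε : ℝ}
    (hε : 0 < ε) : ∃ τ > 0, ∀ (t₀ : ℝ) (z₀ : ℝ → ℝ), MemE ε (fun ξ => z₀ ξ - ξ) →
      ∃ z : ℝ → ℝ → ℝ, z t₀ = z₀ ∧ CharOn M N (Ioo (t₀ - τ) (t₀ + τ)) z := by
  obtain ⟨τ, hτ, h⟩ := exists_local_characteristic hM hN hε
  refine ⟨τ, hτ, fun t₀ z₀ hz₀ => ?_⟩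
  obtain ⟨z, hz, h⟩ := h t₀ z₀ hz₀
  exact ⟨z, hz, fun a ha b hb => ⟨ε / 2, by positivity, fun t ht =>
    (h t ⟨ha.1.trans_le ht.1, ht.2.trans_lt hb.2⟩).1⟩, fun t ht => (h t ht).2.1,
    fun t ht => (h t ht).2.2⟩

/-! ### Breaking of the characteristics at the end of the maximal interval -/

theorem memE_of_forall_le {l ε : ℝ} {y : ℝ → ℝ} (h : MemE l (fun ξ => y ξ - ξ))
    (hε : ∀ ξ, ε ≤ deriv y ξ) : MemE ε (fun ξ => y ξ - ξ) := by
  obtain ⟨h1, h2, h3, h4, -⟩ := memE_sub_id_iff.1 h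
  exact memE_sub_id_iff.2 ⟨h1, h2, h3, h4, hε⟩

section Breaking

variable {m₀ n₀ y₀ : ℝ → ℝ} {S T : EReal} {y : ℝ → ℝ → ℝ}

/-- If the derivative were at least ε everywhere at a time t closer to the end than the uniform
existence time τ, restarting at t and gluing would extend the characteristic to t + τ, past the end
of the maximal interval. -/
theorem IsMaximalCharacteristic.eventually_exists_deriv_lt_right
    (hM : MemX 0 (lagDensity m₀ y₀)) (hN : MemX 0 (lagDensity n₀ y₀))
    (hy : IsMaximalCharacteristic m₀ n₀ y₀ S T y) {b : ℝ} (hb : T = b) {ε : ℝ} (hε : 0 < ε) :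
    ∀ᶠ t in 𝓝[<] b, ∃ ξ, deriv (y t) ξ < ε := by
  have Mi := (memX_zero_iff.1 hM).2.2
  have Ni := (memX_zero_iff.1 hN).2.2
  obtain ⟨hc, h0⟩ := (isCharacteristic_iff Mi Ni).1 hy.isChar
  obtain ⟨τ, hτ, hloc⟩ := exists_local_charOn hM hN hε
  have hb0 : 0 < b := by have := hy.pos_right; rw [hb] at this; exact_mod_cast this
  have hmem : Ioo (max 0 (b - τ)) b ∈ 𝓝[<] b :=
    Ioo_mem_nhdsLT (max_lt hb0 (by linarith))
  filter_upwards [hmem] with t ht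
  by_contra! hcon
  have ht0 : 0 < t := (le_max_left _ _).trans_lt ht.1
  have htτ : b - τ < t := (le_max_right _ _).trans_lt ht.1
  have htI : t ∈ timeInterval S T := by
    refine ⟨(zero_mem_timeInterval hy.pos_left hy.pos_right).1.trans ?_, ?_⟩
    · exact_mod_cast ht0
    · rw [hb]; exact_mod_cast ht.2
  obtain ⟨l, -, hl⟩ := hc.memE t htI t htI
  obtain ⟨z, hz, hzc⟩ := hloc t (y t) (memE_of_forall_le (hl t ⟨le_rfl, le_rfl⟩) hcon)
  have hg := CharOn.glue (J := timeInterval S ((t + τ : ℝ) : EReal)) hc hzc htI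
    ⟨by linarith, by linarith⟩ hz.symm (fun s hs hst => ⟨hs.1, ?_⟩) (fun s hs hst => ⟨?_, ?_⟩)
  · have := (hy.maximal S ((t + τ : ℝ) : EReal) _ hy.pos_left (by exact_mod_cast (by linarith))
      ((isCharacteristic_iff Mi Ni).2 ⟨hg, fun ξ => ?_⟩)).2
    · rw [hb, EReal.coe_le_coe_iff] at this
      linarith
    · rw [if_pos ht0.le]; exact h0 ξ
  · exact (EReal.coe_le_coe_iff.2 hst).trans_lt htI.2
  · linarith
  · have := hs.2; exact_mod_cast this

theorem IsMaximalCharacteristic.eventually_exists_deriv_lt_left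
    (hM : MemX 0 (lagDensity m₀ y₀)) (hN : MemX 0 (lagDensity n₀ y₀))
    (hy : IsMaximalCharacteristic m₀ n₀ y₀ S T y) {a : ℝ} (ha : S = a) {ε : ℝ} (hε : 0 < ε) :
    ∀ᶠ t in 𝓝[>] (-a), ∃ ξ, deriv (y t) ξ < ε := by
  have Mi := (memX_zero_iff.1 hM).2.2
  have Ni := (memX_zero_iff.1 hN).2.2
  obtain ⟨hc, h0⟩ := (isCharacteristic_iff Mi Ni).1 hy.isChar
  obtain ⟨τ, hτ, hloc⟩ := exists_local_charOn hM hN hε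
  have ha0 : 0 < a := by have := hy.pos_left; rw [ha] at this; exact_mod_cast this
  have hmem : Ioo (-a) (min 0 (-a + τ)) ∈ 𝓝[>] (-a) :=
    Ioo_mem_nhdsGT (lt_min (by linarith) (by linarith))
  filter_upwards [hmem] with t ht
  by_contra! hcon
  have ht0 : t < 0 := ht.2.trans_le (min_le_left _ _)
  have htτ : t < -a + τ := ht.2.trans_le (min_le_right _ _)
  have htI : t ∈ timeInterval S T := by
    refine ⟨?_, lt_trans ?_ (zero_mem_timeInterval hy.pos_left hy.pos_right).2⟩
    · rw [ha]; exact_mod_cast ht.1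
    · exact_mod_cast ht0
  obtain ⟨l, -, hl⟩ := hc.memE t htI t htI
  obtain ⟨z, hz, hzc⟩ := hloc t (y t) (memE_of_forall_le (hl t ⟨le_rfl, le_rfl⟩) hcon)
  -- The extended interval starts at t - τ, and `timeInterval` takes the negative of the left end
  -- point, hence τ - t.
  have hneg : ∀ s ∈ timeInterval ((τ - t : ℝ) : EReal) T, t - τ < s := fun s hs => by
    have := hs.1
    rw [← EReal.coe_neg, EReal.coe_lt_coe_iff] at this
    linarith
  have hg := CharOn.glue (J := timeInterval ((τ - t : ℝ) : EReal) T) hzc hc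
    ⟨by linarith, by linarith⟩ htI hz (fun s hs hst => ⟨hneg s hs, by linarith⟩)
    (fun s hs hst => ⟨htI.1.trans_le (EReal.coe_le_coe_iff.2 hst), hs.2⟩)
  have := (hy.maximal ((τ - t : ℝ) : EReal) T _ (by exact_mod_cast (by linarith)) hy.pos_right
      ((isCharacteristic_iff Mi Ni).2 ⟨hg, fun ξ => ?_⟩)).1
  · rw [ha, EReal.coe_le_coe_iff] at this
    linarith
  · rw [if_neg (not_le.2 ht0)]; exact h0 ξ

end Breaking

/-! ### Interchanging the derivatives in time and space -/

/-- Integrate the equation in time, differentiate in x under the integral (the uniform bound on G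
dominates), and apply the fundamental theorem of calculus in time. No continuity of G in x is
needed. -/
theorem hasDerivAt_deriv_of_hasDerivAt {w F G : ℝ → ℝ → ℝ} {a b : ℝ}
    (hw : ∀ s ∈ Icc a b, ∀ x, HasDerivAt (fun s => w s x) (F s x) s)
    (hwd : ∀ s ∈ Icc a b, Differentiable ℝ (w s))
    (hF : ∀ s ∈ Icc a b, ∀ x, HasDerivAt (F s) (G s x) x)
    (hFc : ∀ x, ContinuousOn (fun s => F s x) (Icc a b))
    (hGc : ∀ x, ContinuousOn (fun s => G s x) (Icc a b))
    {C : ℝ} (hGb : ∀ s ∈ Icc a b, ∀ x, |G s x| ≤ C) {t : ℝ} (ht : t ∈ Ioo a b) (x : ℝ) :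
    HasDerivAt (fun s => deriv (w s) x) (G t x) t := by
  have hab : a ≤ b := (ht.1.trans ht.2).le
  have haI : a ∈ Icc a b := ⟨le_rfl, hab⟩
  have hsub : ∀ s ∈ Icc a b, uIcc a s ⊆ Icc a b := fun s hs => by
    rw [uIcc_of_le hs.1]; exact Icc_subset_Icc_right hs.2
  have hsub' : ∀ s ∈ Icc a b, uIoc a s ⊆ Icc a b := fun s hs =>
    uIoc_subset_uIcc.trans (hsub s hs)
  have key : ∀ s ∈ Icc a b, deriv (w s) x = deriv (w a) x + ∫ τ in a..s, G τ x := by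
    intro s hs
    have h1 : ∀ z, w s z = w a z + ∫ τ in a..s, F τ z := fun z => by
      rw [intervalIntegral.integral_eq_sub_of_hasDerivAt (f := fun s => w s z)
        (fun τ hτ => hw τ (hsub s hs hτ) z) ((hFc z).mono (hsub s hs)).intervalIntegrable]
      ring
    have h2 := (intervalIntegral.hasDerivAt_integral_of_dominated_loc_of_deriv_le
      (μ := volume) (a := a) (b := s) (F := fun z τ => F τ z) (F' := fun z τ => G τ z) (x₀ := x)
      (bound := fun _ => C) (Metric.ball_mem_nhds x one_pos)
      (Eventually.of_forall fun z => (((hFc z).mono (hsub' s hs)).aestronglyMeasurable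
        measurableSet_uIoc))
      ((hFc x).mono (hsub s hs)).intervalIntegrable
      (((hGc x).mono (hsub' s hs)).aestronglyMeasurable measurableSet_uIoc)
      (Eventually.of_forall fun τ hτ z _ => hGb τ (hsub' s hs hτ) z)
      intervalIntegrable_const
      (Eventually.of_forall fun τ hτ z _ => hF τ (hsub' s hs hτ) z)).2
    have h3 := ((hwd a haI x).hasDerivAt.add h2).deriv
    rw [← h3]
    congr 1
    exact funext h1
  have hn : Icc a b ∈ 𝓝 t := Icc_mem_nhds ht.1 ht.2
  have h4 : HasDerivAt (fun s => deriv (w a) x + ∫ τ in a..s, G τ x) (G t x) t := by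
    refine (intervalIntegral.integral_hasDerivAt_right
      ((hGc x).mono (hsub t (Ioo_subset_Icc_self ht))).intervalIntegrable
      (((hGc x).mono Ioo_subset_Icc_self).stronglyMeasurableAtFilter isOpen_Ioo t ht)
      ((hGc x).continuousAt hn)).const_add _
  exact h4.congr_of_eventuallyEq (by filter_upwards [hn] with s hs using key s hs)

/-! ### Regularity in time of the characteristics -/

theorem CharOn.eventually_close {M N : ℝ → ℝ} {S T : EReal} {y : ℝ → ℝ → ℝ}
    (h : CharOn M N (timeInterval S T) y) {t : ℝ} (ht : t ∈ timeInterval S T) {ε : ℝ}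
    (hε : 0 < ε) : ∀ᶠ s in 𝓝 t, s ∈ timeInterval S T ∧
      ∀ ξ, |y s ξ - y t ξ| ≤ ε ∧ |deriv (y s) ξ - deriv (y t) ξ| ≤ ε := by
  have h1 := (h.cont t ht).eventually_le_const (ENNReal.ofReal_pos.2 hε)
  filter_upwards [h1, (isOpen_timeInterval S T).mem_nhds ht] with s hs hsI
  refine ⟨hsI, fun ξ => ?_⟩
  obtain ⟨l, -, hl⟩ := h.memE t ht t ht
  obtain ⟨l', -, hl'⟩ := h.memE s hsI s hsI
  have d1 := (memE_sub_id_iff.1 (hl t ⟨le_rfl, le_rfl⟩)).1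
  have d2 := (memE_sub_id_iff.1 (hl' s ⟨le_rfl, le_rfl⟩)).1
  rw [normC_one] at hs
  have e1 := abs_le_of_supNorm_le hε.le (le_self_add.trans hs) ξ
  have e2 := abs_le_of_supNorm_le hε.le (le_add_self.trans hs) ξ
  have e3 : (fun ξ => y s ξ - ξ - (y t ξ - ξ)) = fun ξ => y s ξ - y t ξ := by ext; ring
  have e4 : HasDerivAt (fun ξ => y s ξ - y t ξ) (deriv (y s) ξ - deriv (y t) ξ) ξ :=
    (d2 ξ).hasDerivAt.sub (d1 ξ).hasDerivAt
  rw [e3, e4.deriv] at e2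
  rw [sub_sub_sub_cancel_right] at e1
  exact ⟨e1, e2⟩

theorem tendsto_of_eventually_abs_sub_le {α : Type*} {l : Filter α} {f : α → ℝ} {x : ℝ}
    (h : ∀ ε > 0, ∀ᶠ a in l, |f a - x| ≤ ε) : Tendsto f l (𝓝 x) := by
  rw [Metric.tendsto_nhds]
  intro ε hε
  filter_upwards [h (ε / 2) (by positivity)] with a ha
  rw [Real.dist_eq]; linarith

section Euler

variable {M N : ℝ → ℝ} {S T : EReal} {y : ℝ → ℝ → ℝ}

theorem CharOn.continuousAt_expL (h : CharOn M N (timeInterval S T) y) {P : ℝ → ℝ}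
    (hP : Integrable P) {t : ℝ} (ht : t ∈ timeInterval S T) (ξ : ℝ) :
    ContinuousAt (fun s => expL (y s) P ξ) t := by
  refine tendsto_of_eventually_abs_sub_le fun ε hε => ?_
  have hI : 0 ≤ ∫ η, |P η| := integral_nonneg fun _ => abs_nonneg _
  have hδ : 0 < ε / (2 * ((∫ η, |P η|) + 1)) := by positivity
  filter_upwards [h.eventually_close ht hδ] with s hs
  refine (abs_expL_sub_le (h.strictMono hs.1).monotone (h.strictMono ht).monotone hP
    (fun ξ => (hs.2 ξ).1) ξ).trans ?_
  rw [mul_div_assoc', div_mul_eq_mul_div, div_le_iff₀ (by positivity)]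
  nlinarith

theorem CharOn.continuousAt_expR (h : CharOn M N (timeInterval S T) y) {P : ℝ → ℝ}
    (hP : Integrable P) {t : ℝ} (ht : t ∈ timeInterval S T) (ξ : ℝ) :
    ContinuousAt (fun s => expR (y s) P ξ) t := by
  refine tendsto_of_eventually_abs_sub_le fun ε hε => ?_
  have hI : 0 ≤ ∫ η, |P η| := integral_nonneg fun _ => abs_nonneg _
  have hδ : 0 < ε / (2 * ((∫ η, |P η|) + 1)) := by positivity
  filter_upwards [h.eventually_close ht hδ] with s hs
  refine (abs_expR_sub_le (h.strictMono hs.1).monotone (h.strictMono ht).monotone hP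
    (fun ξ => (hs.2 ξ).1) ξ).trans ?_
  rw [mul_div_assoc', div_mul_eq_mul_div, div_le_iff₀ (by positivity)]
  nlinarith

theorem CharOn.spec (h : CharOn M N (timeInterval S T) y) {t : ℝ} (ht : t ∈ timeInterval S T) :
    (∀ ξ, HasDerivAt (y t) (deriv (y t) ξ) ξ) ∧ Continuous (deriv (y t)) ∧ StrictMono (y t) ∧
    Function.Surjective (y t) ∧ (∀ ξ, 0 < deriv (y t) ξ) := by
  obtain ⟨l, hl0, hl⟩ := h.memE t ht t ht
  have hl := hl t ⟨le_rfl, le_rfl⟩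
  obtain ⟨h1, h2, -, -, h5⟩ := memE_sub_id_iff.1 hl
  exact ⟨fun ξ => (h1 ξ).hasDerivAt, h2, hl.strictMono hl0, hl.surjective,
    fun ξ => hl0.trans_le (h5 ξ)⟩

/-- `∂ₜ∂_ξ y = N A - M B`. -/
theorem CharOn.hasDerivAt_deriv (h : CharOn M N (timeInterval S T) y) (hM : MemX 0 M)
    (hN : MemX 0 N) {t : ℝ} (ht : t ∈ timeInterval S T) (ξ : ℝ) :
    HasDerivAt (fun s => deriv (y s) ξ) (N ξ * expL (y t) M ξ - M ξ * expR (y t) N ξ) t := by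
  obtain ⟨Mc, ⟨CM, hCM⟩, Mi⟩ := memX_zero_iff.1 hM
  obtain ⟨Nc, ⟨CN, hCN⟩, Ni⟩ := memX_zero_iff.1 hN
  obtain ⟨a, ha, b, hb, htab, hab⟩ := exists_Icc_subset_of_mem_timeInterval ht
  refine hasDerivAt_deriv_of_hasDerivAt (w := y) (a := a) (b := b)
    (F := fun s ξ => -(expL (y s) M ξ * expR (y s) N ξ))
    (G := fun s ξ => N ξ * expL (y s) M ξ - M ξ * expR (y s) N ξ)
    (C := CN * (∫ η, |M η|) + CM * ∫ η, |N η|)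
    (fun s hs x => h.ode s (hab hs) x)
    (fun s hs x => ((h.spec (hab hs)).1 x).differentiableAt)
    (fun s hs x => hasDerivAt_expL_mul_expR (h.strictMono (hab hs)).monotone (h.spec (hab hs)).1
      hM hN x)
    (fun x s hs => ContinuousAt.continuousWithinAt ?_)
    (fun x s hs => ContinuousAt.continuousWithinAt ?_) (fun s hs x => ?_) htab ξ
  · exact ((h.continuousAt_expL Mi (hab hs) x).mul (h.continuousAt_expR Ni (hab hs) x)).neg
  · exact (continuousAt_const.mul (h.continuousAt_expL Mi (hab hs) x)).sub
      (continuousAt_const.mul (h.continuousAt_expR Ni (hab hs) x))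
  · refine (abs_sub _ _).trans ?_
    have hm := (h.strictMono (hab hs)).monotone
    rw [abs_mul, abs_mul]
    exact add_le_add (mul_le_mul (hCN x) (abs_expL_le hm Mi x) (abs_nonneg _)
      ((abs_nonneg _).trans (hCN 0)))
      (mul_le_mul (hCM x) (abs_expR_le hm Ni x) (abs_nonneg _) ((abs_nonneg _).trans (hCM 0)))

/-! ### The momentum density in Eulerian coordinates -/

/-- The density `P` in the coordinate `x = y(ξ)`. -/
def eulerDensity (P y : ℝ → ℝ) (x : ℝ) : ℝ :=
  P (Function.invFun y x) / deriv y (Function.invFun y x)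

theorem eulerDensity_apply (P : ℝ → ℝ) {y : ℝ → ℝ} (hy : StrictMono y) (ξ : ℝ) :
    eulerDensity P y (y ξ) = P ξ / deriv y ξ := by
  rw [eulerDensity, Function.leftInverse_invFun hy.injective ξ]

theorem CharOn.eulerDensity_mul (h : CharOn M N (timeInterval S T) y) (P : ℝ → ℝ) {t : ℝ}
    (ht : t ∈ timeInterval S T) (ξ : ℝ) :
    eulerDensity P (y t) (y t ξ) * deriv (y t) ξ = P ξ := by
  rw [eulerDensity_apply P (h.strictMono ht), div_mul_cancel₀ _ ((h.spec ht).2.2.2.2 ξ).ne']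

/-- The inverse maps are Lipschitz with constant 1/l, uniformly over times with the same lower bound
l > 0. -/
theorem CharOn.mul_abs_sub_le (h : CharOn M N (timeInterval S T) y) {t l : ℝ}
    (ht : t ∈ timeInterval S T) (hl : ∀ ξ, l ≤ deriv (y t) ξ) (ξ η : ℝ) :
    l * |ξ - η| ≤ |y t ξ - y t η| := by
  have key : ∀ ξ η, η ≤ ξ → l * (ξ - η) ≤ y t ξ - y t η := fun ξ η hle =>
    mul_sub_le_image_sub_of_le_deriv (fun ξ => ((h.spec ht).1 ξ).differentiableAt) hl hle
  rcases le_total η ξ with hle | hle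
  · rw [abs_of_nonneg (sub_nonneg.2 hle)]
    exact (key ξ η hle).trans (le_abs_self _)
  · rw [abs_sub_comm ξ, abs_sub_comm (y t ξ), abs_of_nonneg (sub_nonneg.2 hle)]
    exact (key η ξ hle).trans (le_abs_self _)

theorem CharOn.exists_lower_bound (h : CharOn M N (timeInterval S T) y) {a b : ℝ}
    (ha : a ∈ timeInterval S T) (hb : b ∈ timeInterval S T) :
    ∃ l > 0, ∀ t ∈ Icc a b, ∀ ξ, l ≤ deriv (y t) ξ := by
  obtain ⟨l, hl0, hl⟩ := h.memE a ha b hb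
  exact ⟨l, hl0, fun t ht => (memE_sub_id_iff.1 (hl t ht)).2.2.2.2⟩

/-- Joint continuity of the inverse comes from |y(s)⁻¹(x) - ξ| ≤ |x - y(s, ξ)|/l with l locally
uniform in time. The derivative at the moving label then converges because the maps converge
uniformly in C^1. -/
theorem CharOn.continuousAt_eulerDensity (h : CharOn M N (timeInterval S T) y) {P : ℝ → ℝ}
    (hP : Continuous P) {t : ℝ} (ht : t ∈ timeInterval S T) (x : ℝ) :
    ContinuousAt (fun p : ℝ × ℝ => eulerDensity P (y p.1) p.2) (t, x) := by
  obtain ⟨a, ha, b, hb, htab, hab⟩ := exists_Icc_subset_of_mem_timeInterval ht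
  obtain ⟨l, hl0, hl⟩ := h.exists_lower_bound ha hb
  obtain ⟨-, qc, hmono, hsurj, hq⟩ := h.spec ht
  obtain ⟨ξ, rfl⟩ := hsurj x
  have hI : ∀ᶠ p : ℝ × ℝ in 𝓝 (t, y t ξ), p.1 ∈ Icc a b :=
    continuous_fst.continuousAt.eventually (Icc_mem_nhds htab.1 htab.2)
  have hinv : Tendsto (fun p : ℝ × ℝ => Function.invFun (y p.1) p.2) (𝓝 (t, y t ξ)) (𝓝 ξ) := by
    rw [tendsto_iff_norm_sub_tendsto_zero]
    have h0 : Tendsto (fun p : ℝ × ℝ => l⁻¹ * |p.2 - y p.1 ξ|) (𝓝 (t, y t ξ)) (𝓝 0) := by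
      have h1 : ContinuousAt (fun p : ℝ × ℝ => y p.1 ξ) (t, y t ξ) :=
        ContinuousAt.comp (f := Prod.fst) (g := fun s => y s ξ) (x := (t, y t ξ))
            (h.ode t ht ξ).continuousAt continuousAt_fst
      have h2 := (((continuousAt_snd (p := (t, y t ξ))).sub h1).abs).const_mul l⁻¹
      simpa [ContinuousAt] using h2
    refine squeeze_zero' (Eventually.of_forall fun _ => norm_nonneg _) ?_ h0
    filter_upwards [hI] with p hp
    have hs := (h.spec (hab hp)).2.2.2.1
    have h3 := h.mul_abs_sub_le (hab hp) (hl p.1 hp) (Function.invFun (y p.1) p.2) ξ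
    rw [Function.rightInverse_invFun hs p.2] at h3
    rw [Real.norm_eq_abs, ← div_eq_inv_mul, le_div_iff₀ hl0]
    linarith
  have hq' : Tendsto (fun p : ℝ × ℝ => deriv (y p.1) (Function.invFun (y p.1) p.2)) (𝓝 (t, y t ξ))
      (𝓝 (deriv (y t) ξ)) := by
    refine tendsto_of_eventually_abs_sub_le fun ε hε => ?_
    have e1 := (continuous_fst.continuousAt (x := (t, y t ξ))).eventually
      (h.eventually_close ht (half_pos hε))
    have e2 := (Metric.tendsto_nhds.1 ((qc.tendsto ξ).comp hinv)) (ε / 2) (half_pos hε)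
    filter_upwards [e1, e2] with p h1 h2
    have h3 := (h1.2 (Function.invFun (y p.1) p.2)).2
    rw [Function.comp, Real.dist_eq] at h2
    have := abs_sub_le (deriv (y p.1) (Function.invFun (y p.1) p.2))
      (deriv (y t) (Function.invFun (y p.1) p.2)) (deriv (y t) ξ)
    linarith
  unfold ContinuousAt
  simp only
  rw [eulerDensity_apply P hmono]
  exact ((hP.tendsto ξ).comp hinv).div hq' (hq ξ).ne'

theorem CharOn.continuous_eulerDensity (h : CharOn M N (timeInterval S T) y) {P : ℝ → ℝ}
    (hP : Continuous P) {t : ℝ} (ht : t ∈ timeInterval S T) :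
    Continuous (eulerDensity P (y t)) :=
  continuous_iff_continuousAt.2 fun x =>
    (h.continuousAt_eulerDensity hP ht x).comp (f := fun x => (t, x)) (by fun_prop)

theorem CharOn.integrable_eulerDensity (h : CharOn M N (timeInterval S T) y) {P : ℝ → ℝ}
    (hP : Integrable P) {t : ℝ} (ht : t ∈ timeInterval S T) :
    Integrable (eulerDensity P (y t)) := by
  obtain ⟨hd, -, hmono, hsurj, -⟩ := h.spec ht
  rw [integrable_comp_mul_deriv_iff hmono hsurj hd]
  simpa only [h.eulerDensity_mul P ht] using hP

theorem CharOn.integral_abs_eulerDensity (h : CharOn M N (timeInterval S T) y) (P : ℝ → ℝ)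
    {t : ℝ} (ht : t ∈ timeInterval S T) :
    ∫ x, |eulerDensity P (y t) x| = ∫ ξ, |P ξ| := by
  obtain ⟨hd, -, hmono, hsurj, hq⟩ := h.spec ht
  rw [integral_comp_mul_deriv_of_strictMono hmono hsurj hd]
  congr 1; ext ξ
  rw [← h.eulerDensity_mul P ht ξ, abs_mul, abs_of_pos (hq ξ)]

theorem CharOn.abs_eulerDensity_le (h : CharOn M N (timeInterval S T) y) {P : ℝ → ℝ} {C l : ℝ}
    (hP : ∀ ξ, |P ξ| ≤ C) (hl0 : 0 < l) {t : ℝ} (ht : t ∈ timeInterval S T)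
    (hl : ∀ ξ, l ≤ deriv (y t) ξ) (x : ℝ) : |eulerDensity P (y t) x| ≤ C / l := by
  obtain ⟨hd, -, hmono, hsurj, hq⟩ := h.spec ht
  obtain ⟨ξ, rfl⟩ := hsurj x
  rw [eulerDensity_apply P hmono, abs_div, abs_of_pos (hq ξ)]
  exact div_le_div₀ ((abs_nonneg _).trans (hP 0)) (hP ξ) hl0 (hl ξ)

theorem CharOn.memX_eulerDensity (h : CharOn M N (timeInterval S T) y) {P : ℝ → ℝ}
    (hP : MemX 0 P) {t : ℝ} (ht : t ∈ timeInterval S T) : MemX 0 (eulerDensity P (y t)) := by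
  obtain ⟨Pc, ⟨C, hC⟩, Pi⟩ := memX_zero_iff.1 hP
  obtain ⟨l, hl0, hl⟩ := h.exists_lower_bound ht ht
  exact memX_zero_iff.2 ⟨h.continuous_eulerDensity Pc ht,
    ⟨C / l, h.abs_eulerDensity_le hC hl0 ht (hl t ⟨le_rfl, le_rfl⟩)⟩,
    h.integrable_eulerDensity Pi ht⟩

theorem CharOn.expL_eulerDensity (h : CharOn M N (timeInterval S T) y) (P : ℝ → ℝ) {t : ℝ}
    (ht : t ∈ timeInterval S T) (ξ : ℝ) :
    expL id (eulerDensity P (y t)) (y t ξ) = expL (y t) P ξ := by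
  obtain ⟨hd, -, hmono, hsurj, -⟩ := h.spec ht
  rw [expL_comp hmono hsurj hd]
  simp only [h.eulerDensity_mul P ht]

theorem CharOn.expR_eulerDensity (h : CharOn M N (timeInterval S T) y) (P : ℝ → ℝ) {t : ℝ}
    (ht : t ∈ timeInterval S T) (ξ : ℝ) :
    expR id (eulerDensity P (y t)) (y t ξ) = expR (y t) P ξ := by
  obtain ⟨hd, -, hmono, hsurj, -⟩ := h.spec ht
  rw [expR_comp hmono hsurj hd]
  simp only [h.eulerDensity_mul P ht]

/-! ### Continuity of the density in `L^1` -/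

/-- Pointwise convergence with equal L^1 norms implies L^1 convergence. The functions |f| - |f - g|
are dominated by |g| and tend to |g|, so dominated convergence applies to them even though the
family f itself has no majorant. For Eulerian densities the norms agree because transport preserves
the integral of |P|. -/
theorem tendsto_lintegral_enorm_sub_of_integral_abs_eq {ι : Type*} {l : Filter ι}
    [l.IsCountablyGenerated] {f : ι → ℝ → ℝ} {g : ℝ → ℝ} (hf : ∀ᶠ i in l, Integrable (f i))
    (hg : Integrable g) (hlim : ∀ x, Tendsto (fun i => f i x) l (𝓝 (g x)))
    (heq : ∀ᶠ i in l, ∫ x, |f i x| = ∫ x, |g x|) :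
    Tendsto (fun i => ∫⁻ x, ‖f i x - g x‖ₑ) l (𝓝 0) := by
  have h1 : Tendsto (fun i => ∫ x, (|f i x| - |f i x - g x|)) l (𝓝 (∫ x, |g x|)) := by
    refine tendsto_integral_filter_of_dominated_convergence (fun x => |g x|) ?_ ?_ hg.abs ?_
    · filter_upwards [hf] with i hi
      exact (hi.abs.sub (hi.sub hg).abs).aestronglyMeasurable
    · refine Eventually.of_forall fun i => Eventually.of_forall fun x => ?_
      rw [Real.norm_eq_abs]
      have := abs_abs_sub_abs_le_abs_sub (f i x) (f i x - g x)
      rwa [sub_sub_cancel] at this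
    · refine Eventually.of_forall fun x => ?_
      have := (hlim x).abs.sub ((hlim x).sub_const (g x)).abs
      simpa using this
  have h2 : Tendsto (fun i => (∫ x, |g x|) - ∫ x, (|f i x| - |f i x - g x|)) l (𝓝 0) := by
    simpa using h1.const_sub (∫ x, |g x|)
  have h3 := ENNReal.tendsto_ofReal h2
  rw [ENNReal.ofReal_zero] at h3
  refine h3.congr' ?_
  filter_upwards [hf, heq] with i hi he
  have h4 : ∫ x, (|f i x| - |f i x - g x|) = (∫ x, |f i x|) - ∫ x, |f i x - g x| :=
    integral_sub hi.abs (hi.sub hg).abs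
  rw [h4, he, sub_sub_cancel]
  exact ofReal_integral_abs (hi.sub hg)

theorem CharOn.tendsto_lintegral_eulerDensity (h : CharOn M N (timeInterval S T) y) {P : ℝ → ℝ}
    (hP : Continuous P) (hPi : Integrable P) {t : ℝ} (ht : t ∈ timeInterval S T) :
    Tendsto (fun s => ∫⁻ x, ‖eulerDensity P (y s) x - eulerDensity P (y t) x‖ₑ) (𝓝 t) (𝓝 0) := by
  have hI := (isOpen_timeInterval S T).mem_nhds ht
  refine tendsto_lintegral_enorm_sub_of_integral_abs_eq ?_ (h.integrable_eulerDensity hPi ht)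
    (fun x => ?_) ?_
  · filter_upwards [hI] with s hs using h.integrable_eulerDensity hPi hs
  · exact ((h.continuousAt_eulerDensity hP ht x).comp (f := fun s => (s, x)) (by fun_prop)).tendsto
  · filter_upwards [hI] with s hs
    rw [h.integral_abs_eulerDensity P hs, h.integral_abs_eulerDensity P ht]

end Euler

/-! ### The solution generated by a characteristic -/

/-- The solution component with density `P` in Lagrangian coordinates. -/
def eulerField (P : ℝ → ℝ) (y : ℝ → ℝ → ℝ) (t : ℝ) : ℝ → ℝ := helmholtzInv (eulerDensity P (y t))

theorem hasDerivAt_exp_neg_abs_comp {g : ℝ → ℝ} {g' t : ℝ} (hg : HasDerivAt g g' t) (h : g t ≠ 0) :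
    HasDerivAt (fun s => Real.exp (-|g s|)) (-(Real.sign (g t) * g') * Real.exp (-|g t|)) t := by
  rcases lt_or_gt_of_ne h with h | h
  · have h1 := ((hasDerivAt_abs_neg h).comp t hg).neg.exp
    rw [Real.sign_of_neg h]
    convert! h1 using 1
    simp [mul_comm]
  · have h1 := ((hasDerivAt_abs_pos h).comp t hg).neg.exp
    rw [Real.sign_of_pos h]
    convert! h1 using 1
    simp [mul_comm]

theorem abs_exp_neg_abs_sub_le (a b : ℝ) : |Real.exp (-|a|) - Real.exp (-|b|)| ≤ |a - b| := by
  refine (abs_exp_sub_exp_le (by simp) (by simp)).trans ?_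
  rw [neg_sub_neg, abs_sub_comm a b]
  exact abs_abs_sub_abs_le_abs_sub b a

section Euler

variable {M N : ℝ → ℝ} {S T : EReal} {y : ℝ → ℝ → ℝ}

theorem CharOn.momentum_eulerField (h : CharOn M N (timeInterval S T) y) {P : ℝ → ℝ}
    (hP : MemX 0 P) {t : ℝ} (ht : t ∈ timeInterval S T) :
    momentum (eulerField P y t) = eulerDensity P (y t) := by
  obtain ⟨c, -, i⟩ := memX_zero_iff.1 (h.memX_eulerDensity hP ht)
  exact momentum_helmholtzInv i c

theorem CharOn.velocity_eulerField (h : CharOn M N (timeInterval S T) y) (hM : MemX 0 M)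
    (hN : MemX 0 N) {t : ℝ} (ht : t ∈ timeInterval S T) (ξ : ℝ) :
    velocity (eulerField M y t) (eulerField N y t) (y t ξ) = expL (y t) M ξ * expR (y t) N ξ := by
  obtain ⟨c, -, i⟩ := memX_zero_iff.1 (h.memX_eulerDensity hM ht)
  obtain ⟨c', -, i'⟩ := memX_zero_iff.1 (h.memX_eulerDensity hN ht)
  rw [eulerField, eulerField, velocity_helmholtzInv i c i' c', h.expL_eulerDensity M ht,
    h.expR_eulerDensity N ht]

theorem continuous_velocity {f g : ℝ → ℝ} (hf : MemX 2 f) (hg : MemX 2 g) :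
    Continuous (velocity f g) := by
  have h1 := hf.two_spec.1
  have h2 := hg.two_spec.1
  have := h1.1.continuous
  have := h1.2.1.continuous
  have := h2.1.continuous
  have := h2.2.1.continuous
  unfold velocity
  fun_prop

theorem exists_abs_velocity_le {f g : ℝ → ℝ} (hf : MemX 2 f) (hg : MemX 2 g) :
    ∃ C, ∀ x, |velocity f g x| ≤ C := by
  obtain ⟨-, ⟨a, ha⟩, ⟨b, hb⟩, -⟩ := hf.two_spec
  obtain ⟨-, ⟨c, hc⟩, ⟨d, hd⟩, -⟩ := hg.two_spec
  refine ⟨(a + b) * (c + d), fun x => ?_⟩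
  rw [velocity, abs_mul]
  refine mul_le_mul ((abs_sub _ _).trans (add_le_add (ha x) (hb x)))
    ((abs_add_le _ _).trans (add_le_add (hc x) (hd x))) (abs_nonneg _) ?_
  have := (abs_nonneg _).trans (ha 0)
  have := (abs_nonneg _).trans (hb 0)
  positivity

theorem memX_mul_velocity {m f g : ℝ → ℝ} (hm : MemX 0 m) (hf : MemX 2 f) (hg : MemX 2 g) :
    MemX 0 (fun x => m x * velocity f g x) := by
  obtain ⟨c, ⟨C, hC⟩, i⟩ := memX_zero_iff.1 hm
  have hv := continuous_velocity hf hg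
  obtain ⟨D, hD⟩ := exists_abs_velocity_le hf hg
  refine memX_zero_iff.2 ⟨c.mul hv, ⟨C * D, fun x => ?_⟩, ?_⟩
  · rw [abs_mul]
    exact mul_le_mul (hC x) (hD x) (abs_nonneg _) ((abs_nonneg _).trans (hC 0))
  · exact i.mul_bdd hv.aestronglyMeasurable (Eventually.of_forall hD)

theorem CharOn.memX_eulerField (h : CharOn M N (timeInterval S T) y) {P : ℝ → ℝ}
    (hP : MemX 0 P) {t : ℝ} (ht : t ∈ timeInterval S T) : MemX 2 (eulerField P y t) :=
  memX_two_helmholtzInv (h.memX_eulerDensity hP ht)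

theorem CharOn.eulerField_sub (h : CharOn M N (timeInterval S T) y) {P : ℝ → ℝ}
    (hP : MemX 0 P) {s t : ℝ} (hs : s ∈ timeInterval S T) (ht : t ∈ timeInterval S T) :
    eulerField P y s - eulerField P y t =
      helmholtzInv (eulerDensity P (y s) - eulerDensity P (y t)) :=
  (helmholtzInv_sub (memX_zero_iff.1 (h.memX_eulerDensity hP hs)).2.2
    (memX_zero_iff.1 (h.memX_eulerDensity hP ht)).2.2).symm

theorem MemX.mono_two_zero {w : ℝ → ℝ} (h : MemX 2 w) : MemX 0 w := by
  obtain ⟨h1, h2, -, h3, -⟩ := h.two_spec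
  exact memX_zero_iff.2 ⟨h1.1.continuous, h2, h3⟩

/-- Continuity in X^0 needs only L^1 convergence of the densities, since `(1 - ∂ₓ²)⁻¹` gains the sup
norm. The local X^2 bounds come from |P|/∂_ξ y ≤ C/l. -/
theorem CharOn.isRegular_eulerField (h : CharOn M N (timeInterval S T) y) {P : ℝ → ℝ}
    (hP : MemX 0 P) : IsRegular (timeInterval S T) (eulerField P y) := by
  obtain ⟨Pc, ⟨C, hC⟩, Pi⟩ := memX_zero_iff.1 hP
  refine ⟨fun t ht => ⟨(h.memX_eulerField hP ht).mono_two_zero, ?_⟩,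
    fun t ht => h.memX_eulerField hP ht, fun a ha b hb => ?_, fun p hp => ?_⟩
  · have h1 := h.tendsto_lintegral_eulerDensity Pc Pi ht
    have h2 : Tendsto (fun s => 2 * ∫⁻ x, ‖eulerDensity P (y s) x - eulerDensity P (y t) x‖ₑ)
        (𝓝[timeInterval S T] t) (𝓝 0) := by
      have := ENNReal.Tendsto.const_mul (a := 2) h1 (Or.inr (by norm_num))
      rw [mul_zero] at this
      exact this.mono_left nhdsWithin_le_nhds
    refine tendsto_of_tendsto_of_tendsto_of_le_of_le' tendsto_const_nhds h2
      (Eventually.of_forall fun _ => zero_le) ?_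
    filter_upwards [self_mem_nhdsWithin] with s hs
    rw [h.eulerField_sub hP hs ht]
    obtain ⟨cs, -, is⟩ := memX_zero_iff.1 (h.memX_eulerDensity hP hs)
    obtain ⟨ct, -, it⟩ := memX_zero_iff.1 (h.memX_eulerDensity hP ht)
    exact normX_zero_helmholtzInv_le (is.sub it) (cs.sub ct)
  · obtain ⟨l, hl0, hl⟩ := h.exists_lower_bound ha hb
    refine ⟨7 * (ENNReal.ofReal (C / l) + ENNReal.ofReal (∫ ξ, |P ξ|)),
      ENNReal.mul_lt_top (by norm_num) (by simp), fun t ht => ?_⟩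
    have htI := Icc_subset_timeInterval ha hb ht
    obtain ⟨ct, -, it⟩ := memX_zero_iff.1 (h.memX_eulerDensity hP htI)
    refine (normX_two_helmholtzInv_le it ct).trans ?_
    rw [normX_zero, ← ofReal_integral_abs it, h.integral_abs_eulerDensity P htI]
    gcongr
    exact supNorm_le_ofReal (h.abs_eulerDensity_le hC hl0 htI (hl t ht))
  · have h1 := h.continuousAt_eulerDensity Pc hp.1 p.2
    have h2 : ∀ᶠ q : ℝ × ℝ in 𝓝 p, q.1 ∈ timeInterval S T :=
      continuous_fst.continuousAt.eventually ((isOpen_timeInterval S T).mem_nhds hp.1)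
    refine (h1.congr ?_).continuousWithinAt
    filter_upwards [h2] with q hq
    rw [h.momentum_eulerField hP hq]

theorem CharOn.abs_sub_le (h : CharOn M N (timeInterval S T) y) (hM : MemX 0 M)
    (hN : MemX 0 N) {s t : ℝ} (hs : s ∈ timeInterval S T) (ht : t ∈ timeInterval S T) (ξ : ℝ) :
    |y s ξ - y t ξ| ≤ (∫ η, |M η|) * (∫ η, |N η|) * |s - t| := by
  have Mi := (memX_zero_iff.1 hM).2.2
  have Ni := (memX_zero_iff.1 hN).2.2
  have hsub := uIcc_subset_timeInterval ht hs
  have := (convex_uIcc t s).norm_image_sub_le_of_norm_hasDerivWithin_le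
    (f := fun s => y s ξ) (C := (∫ η, |M η|) * (∫ η, |N η|))
    (fun x hx => (h.ode x (hsub hx) ξ).hasDerivWithinAt) (fun x hx => ?_)
    left_mem_uIcc right_mem_uIcc
  · exact this
  · rw [norm_neg, norm_mul]
    have hm := (h.strictMono (hsub hx)).monotone
    exact mul_le_mul (abs_expL_le hm Mi ξ) (abs_expR_le hm Ni ξ) (norm_nonneg _)
      (integral_nonneg fun _ => abs_nonneg _)

/-- In Lagrangian variables the density P is fixed and time enters only through the kernel, so the
field can be differentiated in time although nothing is known about ∂ₜm. -/
theorem CharOn.eulerField_eq_integral (h : CharOn M N (timeInterval S T) y) (P : ℝ → ℝ)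
    {t : ℝ} (ht : t ∈ timeInterval S T) (x : ℝ) :
    eulerField P y t x = (1 / 2) * ∫ η, Real.exp (-|x - y t η|) * P η := by
  obtain ⟨hd, -, hmono, hsurj, -⟩ := h.spec ht
  rw [eulerField, helmholtzInv, integral_comp_mul_deriv_of_strictMono hmono hsurj hd]
  simp only [mul_assoc, h.eulerDensity_mul P ht]

/-- Differentiate the kernel exp(-|x - y(t, η)|) in time. Its kink is met only at the label η with
y(t, η) = x, a null set, and the bounded speed of the characteristics gives an integrable Lipschitz
constant. Since ∂ₜy = -AB, the result is -(1/2)∫ sgn · exp · P A B, which is ∂ₓ(1 - ∂ₓ²)⁻¹ of the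
flux written in Lagrangian variables. -/
theorem CharOn.hasDerivAt_eulerField (h : CharOn M N (timeInterval S T) y) (hM : MemX 0 M)
    (hN : MemX 0 N) {P : ℝ → ℝ} (hP : MemX 0 P) {t : ℝ} (ht : t ∈ timeInterval S T) (x : ℝ) :
    HasDerivAt (fun s => eulerField P y s x) (deriv (helmholtzInv fun z =>
      momentum (eulerField P y t) z * velocity (eulerField M y t) (eulerField N y t) z) x) t := by
  obtain ⟨Pc, ⟨C, hC⟩, Pi⟩ := memX_zero_iff.1 hP
  obtain ⟨hd, -, hmono, hsurj, -⟩ := h.spec ht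
  obtain ⟨ξ, rfl⟩ := hsurj x
  have hI := (isOpen_timeInterval S T).mem_nhds ht
  have hgX : MemX 0 (fun z => momentum (eulerField P y t) z *
      velocity (eulerField M y t) (eulerField N y t) z) := by
    rw [h.momentum_eulerField hP ht]
    exact memX_mul_velocity (h.memX_eulerDensity hP ht) (h.memX_eulerField hM ht)
      (h.memX_eulerField hN ht)
  obtain ⟨gc, -, gi⟩ := memX_zero_iff.1 hgX
  set V : ℝ → ℝ := fun η => expL (y t) M η * expR (y t) N η with hV
  set Q : ℝ → ℝ := fun η => P η * V η with hQ
  have hgQ : (fun η => momentum (eulerField P y t) (y t η) *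
      velocity (eulerField M y t) (eulerField N y t) (y t η) * deriv (y t) η) = Q := by
    ext η
    rw [h.velocity_eulerField hM hN ht, h.momentum_eulerField hP ht, hQ]
    simp only
    rw [← h.eulerDensity_mul P ht η]; ring
  have hQi : Integrable Q := by
    rw [← hgQ]
    exact (integrable_comp_mul_deriv_iff hmono hsurj hd).1 gi
  have hcongr : (fun s => (1 / 2) * ∫ η, Real.exp (-|y t ξ - y s η|) * P η) =ᶠ[𝓝 t]
      fun s => eulerField P y s (y t ξ) := by
    filter_upwards [hI] with s hs using (h.eulerField_eq_integral P hs _).symm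
  have hmeas : ∀ s ∈ timeInterval S T,
      AEStronglyMeasurable (fun η => Real.exp (-|y t ξ - y s η|) * P η) := fun s hs =>
    (integrable_exp_abs (h.strictMono hs).monotone.measurable Pi _).aestronglyMeasurable
  have hder := (hasDerivAt_integral_of_dominated_loc_of_lip (μ := volume)
    (F := fun s η => Real.exp (-|y t ξ - y s η|) * P η)
    (F' := fun η => -(Real.sign (y t ξ - y t η) * Real.exp (-|y t ξ - y t η|) * Q η))
    (x₀ := t) (s := timeInterval S T)
    (bound := fun η => (∫ η, |M η|) * (∫ η, |N η|) * |P η|) hI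
    (by filter_upwards [hI] with s hs using hmeas s hs)
    (integrable_exp_abs hmono.monotone.measurable Pi _)
    (integrable_sign_exp_abs hmono.monotone.measurable hQi _).aestronglyMeasurable.neg
    (Eventually.of_forall fun η => ?_) (Pi.abs.const_mul _) ?_).2
  · refine HasDerivAt.congr_of_eventuallyEq ?_ hcongr.symm
    convert! hder.const_mul (1 / 2) using 1
    rw [integral_neg, integral_sign_exp_abs_eq hmono hQi, deriv_helmholtzInv gi gc]
    simp only
    rw [expR_comp hmono hsurj hd, expL_comp hmono hsurj hd, hgQ]
    ring
  · refine LipschitzOnWith.of_dist_le_mul fun s hs s' hs' => ?_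
    have hb : 0 ≤ (∫ η, |M η|) * (∫ η, |N η|) * |P η| :=
      mul_nonneg (mul_nonneg (integral_nonneg fun _ => abs_nonneg _)
        (integral_nonneg fun _ => abs_nonneg _)) (abs_nonneg _)
    rw [Real.coe_nnabs, abs_of_nonneg hb, Real.dist_eq, Real.dist_eq, ← sub_mul, abs_mul]
    have h1 := abs_exp_neg_abs_sub_le (y t ξ - y s η) (y t ξ - y s' η)
    rw [sub_sub_sub_cancel_left, abs_sub_comm (y s' η)] at h1
    have h2 := h1.trans (h.abs_sub_le hM hN hs hs' η)
    refine (mul_le_mul_of_nonneg_right h2 (abs_nonneg _)).trans_eq (by ring)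
  · have hne : ∀ᵐ η : ℝ, η ≠ ξ := by simp [ae_iff]
    filter_upwards [hne] with η hη
    have h1 : y t ξ - y t η ≠ 0 := sub_ne_zero.2 fun he => hη (hmono.injective he).symm
    have h2 := (hasDerivAt_exp_neg_abs_comp ((h.ode t ht η).const_sub (y t ξ)) h1).mul_const (P η)
    convert! h2 using 1
    rw [hQ, hV]; ring

theorem CharOn.isSolution (h : CharOn M N (timeInterval S T) y) {m₀ n₀ : ℝ → ℝ}
    (hM : MemX 0 M) (hN : MemX 0 N) (h0 : (0 : ℝ) ∈ timeInterval S T)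
    (hm₀ : ∀ ξ, m₀ (y 0 ξ) * deriv (y 0) ξ = M ξ) (hn₀ : ∀ ξ, n₀ (y 0 ξ) * deriv (y 0) ξ = N ξ) :
    IsSolution m₀ n₀ S T (eulerField M y) (eulerField N y) := by
  obtain ⟨-, -, hmono, hsurj, hq⟩ := h.spec h0
  refine ⟨h.isRegular_eulerField hM, h.isRegular_eulerField hN, fun x => ?_, fun x => ?_,
    fun t ht x => h.hasDerivAt_eulerField hM hN hM ht x,
    fun t ht x => h.hasDerivAt_eulerField hM hN hN ht x⟩
  · obtain ⟨ξ, rfl⟩ := hsurj x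
    rw [h.momentum_eulerField hM h0, eulerDensity_apply M hmono, ← hm₀,
      mul_div_cancel_right₀ _ (hq ξ).ne']
  · obtain ⟨ξ, rfl⟩ := hsurj x
    rw [h.momentum_eulerField hN h0, eulerDensity_apply N hmono, ← hn₀,
      mul_div_cancel_right₀ _ (hq ξ).ne']

/-! ### Continuity in `X^2` for data vanishing at infinity -/

theorem CharOn.tendsto_eulerDensity_cocompact (h : CharOn M N (timeInterval S T) y) {P : ℝ → ℝ}
    (hP0 : Tendsto P (cocompact ℝ) (𝓝 0)) {t : ℝ} (ht : t ∈ timeInterval S T) :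
    Tendsto (eulerDensity P (y t)) (cocompact ℝ) (𝓝 0) := by
  obtain ⟨l, hl0, hl⟩ := h.memE t ht t ht
  obtain ⟨-, -, ⟨C, hC⟩, -, hq⟩ := memE_sub_id_iff.1 (hl t ⟨le_rfl, le_rfl⟩)
  have hsurj := (h.spec ht).2.2.2.1
  have hinv : Tendsto (Function.invFun (y t)) (cocompact ℝ) (cocompact ℝ) := by
    rw [← Metric.cobounded_eq_cocompact, ← tendsto_norm_atTop_iff_cobounded]
    refine tendsto_atTop_mono (f := fun x => ‖x‖ - C) (fun x => ?_)
      (tendsto_atTop_add_const_right _ (-C) tendsto_norm_cobounded_atTop)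
    have h1 := hC (Function.invFun (y t) x)
    rw [Function.rightInverse_invFun hsurj x] at h1
    have h2 := norm_sub_norm_le x (Function.invFun (y t) x)
    rw [Real.norm_eq_abs (x - _)] at h2
    linarith
  have h3 : Tendsto (fun x => l⁻¹ * |P (Function.invFun (y t) x)|) (cocompact ℝ) (𝓝 0) := by
    simpa using ((hP0.comp hinv).abs).const_mul l⁻¹
  refine squeeze_zero_norm (fun x => ?_) h3
  rw [eulerDensity, Real.norm_eq_abs, abs_div, div_eq_inv_mul]
  have h4 := hq (Function.invFun (y t) x)
  rw [abs_of_pos (hl0.trans_le h4)]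
  gcongr

/-- At x = y(s, ξ) compare the density at time s with its value at time t and position y(t, ξ): the
numerator P(ξ) is the same, and only ∂_ξ y has changed. The remaining step from y(t, ξ) to y(s, ξ)
at the fixed time t uses uniform continuity, which is where vanishing at infinity enters. -/
theorem CharOn.contInX_eulerField (h : CharOn M N (timeInterval S T) y) {P : ℝ → ℝ}
    (hP : MemX 0 P) (hP0 : Tendsto P (cocompact ℝ) (𝓝 0)) :
    ContInX 2 (timeInterval S T) (eulerField P y) := by
  obtain ⟨Pc, ⟨C, hC⟩, Pi⟩ := memX_zero_iff.1 hP
  intro t ht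
  refine ⟨h.memX_eulerField hP ht, ?_⟩
  have hI := (isOpen_timeInterval S T).mem_nhds ht
  obtain ⟨a, ha, b, hb, htab, hab⟩ := exists_Icc_subset_of_mem_timeInterval ht
  obtain ⟨l, hl0, hl⟩ := h.exists_lower_bound ha hb
  have hC0 : 0 ≤ C := (abs_nonneg _).trans (hC 0)
  have huc : UniformContinuous (eulerDensity P (y t)) :=
    (h.continuous_eulerDensity Pc ht).uniformContinuous_of_tendsto_cocompact
      (h.tendsto_eulerDensity_cocompact hP0 ht)
  have hsup : Tendsto (fun s => supNorm (eulerDensity P (y s) - eulerDensity P (y t)))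
      (𝓝 t) (𝓝 0) := by
    rw [ENNReal.tendsto_nhds_zero]
    intro e he
    obtain ⟨ε, hε, hεe⟩ : ∃ ε : ℝ, 0 < ε ∧ ENNReal.ofReal ε ≤ e := by
      rcases eq_or_ne e ⊤ with h | h
      · exact ⟨1, one_pos, by simp [h]⟩
      · exact ⟨e.toReal, ENNReal.toReal_pos he.ne' h, ENNReal.ofReal_toReal_le⟩
    obtain ⟨δ, hδ, hδ'⟩ := Metric.uniformContinuous_iff.1 huc (ε / 2) (half_pos hε)
    -- If the derivatives differ by at most this, the two quotients differ by at most C/l² times it,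
    -- hence by at most ε/2. The added 1 covers C = 0.
    have hρ : 0 < ε / 2 * l ^ 2 / (C + 1) := by positivity
    filter_upwards [h.eventually_close ht (half_pos hδ), h.eventually_close ht hρ,
      Icc_mem_nhds htab.1 htab.2] with s h1 h2 h3
    refine le_trans (supNorm_le_ofReal fun x => ?_) hεe
    obtain ⟨-, -, hmono, hsurj, hq⟩ := h.spec h1.1
    obtain ⟨-, -, hmono', -, hq'⟩ := h.spec ht
    obtain ⟨ξ, rfl⟩ := hsurj x
    rw [_root_.Pi.sub_apply]
    refine (_root_.abs_sub_le _ (eulerDensity P (y t) (y t ξ)) _).trans ?_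
    have k1 : |eulerDensity P (y t) (y t ξ) - eulerDensity P (y t) (y s ξ)| ≤ ε / 2 := by
      refine le_of_lt (hδ' ?_)
      rw [Real.dist_eq, abs_sub_comm]
      linarith [(h1.2 ξ).1]
    have k2 : |eulerDensity P (y s) (y s ξ) - eulerDensity P (y t) (y t ξ)| ≤ ε / 2 := by
      rw [eulerDensity_apply P hmono, eulerDensity_apply P hmono',
        div_sub_div _ _ (hq ξ).ne' (hq' ξ).ne', mul_comm (deriv (y s) ξ) (P ξ), ← mul_sub, abs_div,
        abs_mul, abs_of_pos (mul_pos (hq ξ) (hq' ξ)), div_le_iff₀ (mul_pos (hq ξ) (hq' ξ))]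
      have e1 := (h2.2 ξ).2
      rw [abs_sub_comm, le_div_iff₀ (by positivity)] at e1
      have e2 : l ^ 2 ≤ deriv (y s) ξ * deriv (y t) ξ := by
        rw [sq]
        exact mul_le_mul (hl s h3 ξ) (hl t (Ioo_subset_Icc_self htab) ξ) hl0.le (hq ξ).le
      have e3 := hC ξ
      have e4 := abs_nonneg (deriv (y t) ξ - deriv (y s) ξ)
      have e5 : |P ξ| * |deriv (y t) ξ - deriv (y s) ξ| ≤ C * |deriv (y t) ξ - deriv (y s) ξ| :=
        mul_le_mul_of_nonneg_right e3 e4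
      have e6 : ε / 2 * l ^ 2 ≤ ε / 2 * (deriv (y s) ξ * deriv (y t) ξ) :=
        mul_le_mul_of_nonneg_left e2 (by positivity)
      nlinarith
    linarith
  have hx0 : Tendsto (fun s => 7 * normX 0 (eulerDensity P (y s) - eulerDensity P (y t)))
      (𝓝[timeInterval S T] t) (𝓝 0) := by
    have h1 := hsup.add (h.tendsto_lintegral_eulerDensity Pc Pi ht)
    rw [add_zero] at h1
    have h2 := ENNReal.Tendsto.const_mul (a := 7) h1 (Or.inr (by norm_num))
    rw [mul_zero] at h2
    refine (h2.mono_left nhdsWithin_le_nhds).congr fun s => ?_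
    rw [normX_zero]; rfl
  refine tendsto_of_tendsto_of_tendsto_of_le_of_le' tendsto_const_nhds hx0
    (Eventually.of_forall fun _ => zero_le) ?_
  filter_upwards [self_mem_nhdsWithin] with s hs
  rw [h.eulerField_sub hP hs ht]
  obtain ⟨cs, -, is⟩ := memX_zero_iff.1 (h.memX_eulerDensity hP hs)
  obtain ⟨ct, -, it⟩ := memX_zero_iff.1 (h.memX_eulerDensity hP ht)
  exact normX_two_helmholtzInv_le (is.sub it) (cs.sub ct)

end Euler

/-! ### A Grönwall lemma for families -/

/-- The supremum over the family need not be differentiable or attained, so the integral inequality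
is iterated on each member. If every member is at most B 2⁻ⁿ e^{2L(t-a)}, integrating L times this
bound halves the constant. -/
theorem eq_zero_of_deriv_le_forward {ι : Type*} {δ δ' : ℝ → ι → ℝ} {a b L B : ℝ}
    (hd : ∀ t ∈ Icc a b, ∀ i, HasDerivAt (fun s => δ s i) (δ' t i) t)
    (hL : ∀ t ∈ Icc a b, ∀ K, (∀ i, |δ t i| ≤ K) → ∀ i, |δ' t i| ≤ L * K)
    (hB : ∀ t ∈ Icc a b, ∀ i, |δ t i| ≤ B) (hL0 : 0 ≤ L) (h0 : ∀ i, δ a i = 0) :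
    ∀ t ∈ Icc a b, ∀ i, δ t i = 0 := by
  have key : ∀ n : ℕ, ∀ t ∈ Icc a b, ∀ i,
      |δ t i| ≤ B * (1 / 2) ^ n * Real.exp (2 * L * (t - a)) := by
    intro n
    induction n with
    | zero =>
      intro t ht i
      have h1 : 0 ≤ B := (abs_nonneg _).trans (hB t ht i)
      have h2 : 1 ≤ Real.exp (2 * L * (t - a)) :=
        Real.one_le_exp (mul_nonneg (by positivity) (sub_nonneg.2 ht.1))
      rw [pow_zero, mul_one]
      exact (hB t ht i).trans (le_mul_of_one_le_right h1 h2)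
    | succ n ih =>
      intro t ht i
      have h1 : 0 ≤ B := (abs_nonneg _).trans (hB t ht i)
      refine image_norm_le_of_norm_deriv_right_le_deriv_boundary (f := fun s => δ s i)
        (f' := fun s => δ' s i) (B := fun t => B * (1 / 2) ^ (n + 1) * Real.exp (2 * L * (t - a)))
        (B' := fun t => L * (B * (1 / 2) ^ n * Real.exp (2 * L * (t - a))))
        (fun s hs => (hd s hs i).continuousAt.continuousWithinAt)
        (fun s hs => (hd s (Ico_subset_Icc_self hs) i).hasDerivWithinAt) ?_ (fun s => ?_)
        (fun s hs => hL s (Ico_subset_Icc_self hs) _ (ih s (Ico_subset_Icc_self hs)) i) ht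
      · rw [h0, norm_zero]; positivity
      · have := ((((hasDerivAt_id s).sub_const a).const_mul (2 * L)).exp).const_mul
          (B * (1 / 2) ^ (n + 1))
        convert! this using 1
        simp only [id, pow_succ]; ring
  intro t ht i
  have h1 : Tendsto (fun n : ℕ => B * (1 / 2) ^ n * Real.exp (2 * L * (t - a))) atTop (𝓝 0) := by
    have := ((tendsto_pow_atTop_nhds_zero_of_lt_one (r := (1 / 2 : ℝ)) (by norm_num)
      (by norm_num)).const_mul B).mul_const (Real.exp (2 * L * (t - a)))
    simpa using this
  have h2 := ge_of_tendsto' h1 fun n => key n t ht i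
  exact abs_nonpos_iff.1 h2

theorem eq_zero_of_deriv_le {ι : Type*} {δ δ' : ℝ → ι → ℝ} {a b L B : ℝ}
    (hd : ∀ t ∈ uIcc a b, ∀ i, HasDerivAt (fun s => δ s i) (δ' t i) t)
    (hL : ∀ t ∈ uIcc a b, ∀ K, (∀ i, |δ t i| ≤ K) → ∀ i, |δ' t i| ≤ L * K)
    (hB : ∀ t ∈ uIcc a b, ∀ i, |δ t i| ≤ B) (hL0 : 0 ≤ L) (h0 : ∀ i, δ a i = 0) (i : ι) :
    δ b i = 0 := by
  rcases le_total a b with h | h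
  · rw [uIcc_of_le h] at hd hL hB
    exact eq_zero_of_deriv_le_forward hd hL hB hL0 h0 b ⟨h, le_rfl⟩ i
  · rw [uIcc_of_ge h] at hd hL hB
    have hm : ∀ t ∈ Icc (-a) (-b), -t ∈ Icc b a := fun t ht =>
      ⟨by linarith [ht.2], by linarith [ht.1]⟩
    have := eq_zero_of_deriv_le_forward (δ := fun t i => δ (-t) i) (δ' := fun t i => -δ' (-t) i)
      (a := -a) (b := -b) (L := L) (B := B) (fun t ht i => ?_) (fun t ht K hK i => ?_)
      (fun t ht i => hB _ (hm t ht) i) hL0 (by simpa using h0) (-b) ⟨by linarith, le_rfl⟩ i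
    · simpa using this
    · have := HasDerivAt.scomp t (hd (-t) (hm t ht) i) (hasDerivAt_neg t)
      simpa [Function.comp_def] using! this
    · rw [abs_neg]; exact hL _ (hm t ht) K hK i

/-! ### Control by the oscillation of the mass function -/

/-- The bounded solution of p' + p = D' satisfies p(x₀) = ∫ e^{z - x₀} (D(x₀) - D(z)) dz over z ≤
x₀, an average of differences of D. Instead of integrating, the proof sets h = eˣ(p - (D - D(x₀))),
for which h + Keˣ and Keˣ - h are nondecreasing and tend to 0 at -∞. -/
theorem abs_le_of_osc_le {p D f : ℝ → ℝ} {C K : ℝ} (hD : ∀ x, HasDerivAt D (f x) x)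
    (hp : ∀ x, HasDerivAt p (f x - p x) x) (hC : ∀ x, |p x| ≤ C)
    (hK : ∀ x z, |D x - D z| ≤ K) (x₀ : ℝ) : |p x₀| ≤ K := by
  set h : ℝ → ℝ := fun x => Real.exp x * (p x - (D x - D x₀)) with hh
  have hd : ∀ x, HasDerivAt h (-Real.exp x * (D x - D x₀)) x := fun x => by
    convert! (Real.hasDerivAt_exp x).mul ((hp x).sub ((hD x).sub_const (D x₀))) using 1
    simp only [Pi.sub_apply]; ring
  have hlim : Tendsto h atBot (𝓝 0) := by
    refine squeeze_zero_norm (a := fun x => Real.exp x * (C + K)) (fun x => ?_) ?_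
    · rw [hh, norm_mul, Real.norm_eq_abs, Real.abs_exp]
      exact mul_le_mul_of_nonneg_left ((abs_sub _ _).trans (add_le_add (hC x) (hK x x₀)))
        (Real.exp_pos x).le
    · simpa using Real.tendsto_exp_atBot.mul_const (C + K)
  have hKlim : Tendsto (fun x => K * Real.exp x) atBot (𝓝 0) := by
    simpa using Real.tendsto_exp_atBot.const_mul K
  have e1 : Monotone (fun x => h x + K * Real.exp x) := by
    refine monotone_of_hasDerivAt_nonneg (fun x => (hd x).add ((Real.hasDerivAt_exp x).const_mul K))
      fun x => ?_
    have := (abs_le.1 (hK x x₀)).2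
    have := Real.exp_pos x
    simp only [Pi.zero_apply]
    nlinarith
  have e2 : Monotone (fun x => K * Real.exp x - h x) := by
    refine monotone_of_hasDerivAt_nonneg (fun x => ((Real.hasDerivAt_exp x).const_mul K).sub (hd x))
      fun x => ?_
    have := (abs_le.1 (hK x x₀)).1
    have := Real.exp_pos x
    simp only [Pi.zero_apply]
    nlinarith
  have f1 : 0 ≤ h x₀ + K * Real.exp x₀ := by
    have := hlim.add hKlim
    rw [add_zero] at this
    exact e1.le_of_tendsto this x₀
  have f2 : 0 ≤ K * Real.exp x₀ - h x₀ := by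
    have := hKlim.sub hlim
    rw [sub_zero] at this
    exact e2.le_of_tendsto this x₀
  have hx : h x₀ = Real.exp x₀ * p x₀ := by simp [hh]
  have hpos := Real.exp_pos x₀
  rw [hx] at f1 f2
  rw [abs_le]
  constructor
  · by_contra! hc
    nlinarith
  · by_contra! hc
    nlinarith

theorem abs_sub_deriv_le_of_osc_le {w w' f D : ℝ → ℝ} {C C' K : ℝ}
    (h1 : ∀ x, HasDerivAt w (w' x) x) (h2 : ∀ x, HasDerivAt w' (w x - f x) x)
    (hD : ∀ x, HasDerivAt D (f x) x) (hC : ∀ x, |w x| ≤ C) (hC' : ∀ x, |w' x| ≤ C')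
    (hK : ∀ x z, |D x - D z| ≤ K) (x : ℝ) : |w x - w' x| ≤ K ∧ |w x + w' x| ≤ K := by
  constructor
  · exact abs_le_of_osc_le (p := fun x => w x - w' x) (C := C + C') hD
      (fun x => by convert! (h1 x).sub (h2 x) using 1; ring)
      (fun x => (abs_sub _ _).trans (add_le_add (hC x) (hC' x))) hK x
  · have hn : ∀ {g : ℝ → ℝ} {g' x : ℝ}, HasDerivAt g g' (-x) →
        HasDerivAt (fun x => g (-x)) (-g') x := fun {g g' x} hg => by
      have := HasDerivAt.scomp x hg (hasDerivAt_neg x)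
      simpa [Function.comp_def] using! this
    have := abs_le_of_osc_le (p := fun x => w (-x) + w' (-x)) (D := fun x => -D (-x))
      (f := fun x => f (-x)) (C := C + C') (K := K)
      (fun x => by convert! (hn (hD (-x))).neg using 1; ring)
      (fun x => by convert! (hn (h1 (-x))).add (hn (h2 (-x))) using 1; ring)
      (fun x => (abs_add_le _ _).trans (add_le_add (hC _) (hC' _)))
      (fun x z => by rw [neg_sub_neg]; exact hK _ _) (-x)
    simpa using this

/-! ### Differentiation along a curve -/

/-- A chain rule that asks for the time derivative only at the fixed position y(t), together with
joint continuity of the space derivative at that point. The increment from y(t) to y(s) is estimated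
at time s by the mean value inequality. -/
theorem hasDerivAt_comp_curve {R r : ℝ → ℝ → ℝ} {y : ℝ → ℝ} {t p y' : ℝ}
    (hR : ∀ᶠ s in 𝓝 t, ∀ x, HasDerivAt (R s) (r s x) x)
    (hr : ContinuousAt (fun q : ℝ × ℝ => r q.1 q.2) (t, y t))
    (hp : HasDerivAt (fun s => R s (y t)) p t) (hy : HasDerivAt y y' t) :
    HasDerivAt (fun s => R s (y s)) (p + r t (y t) * y') t := by
  have h1 : (fun s => (R s (y s) - R s (y t)) - r t (y t) * (y s - y t)) =o[𝓝 t]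
      fun s => y s - y t := by
    rw [Asymptotics.isLittleO_iff]
    intro ε hε
    obtain ⟨δ, hδ, hδ'⟩ := Metric.continuousAt_iff.1 hr ε hε
    filter_upwards [hR, Metric.ball_mem_nhds t hδ,
      hy.continuousAt.eventually (Metric.ball_mem_nhds (y t) hδ)] with s hs hst hys
    have := (convex_ball (y t) δ).norm_image_sub_le_of_norm_hasDerivWithin_le
      (f := fun x => R s x - r t (y t) * x) (f' := fun x => r s x - r t (y t) * 1) (C := ε)
      (fun x _ => ((hs x).sub ((hasDerivAt_id x).const_mul _)).hasDerivWithinAt)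
      (fun x hx => ?_) (Metric.mem_ball_self hδ) hys
    · have e : R s (y s) - R s (y t) - r t (y t) * (y s - y t) =
          R s (y s) - r t (y t) * y s - (R s (y t) - r t (y t) * y t) := by ring
      rw [e]; exact this
    · rw [mul_one, Real.norm_eq_abs, ← Real.dist_eq]
      refine le_of_lt (hδ' (x := (s, x)) ?_)
      rw [Prod.dist_eq]
      exact max_lt hst hx
  have h2 : HasDerivAt (fun s => R s (y s) - R s (y t)) (r t (y t) * y') t := by
    rw [hasDerivAt_iff_isLittleO]
    have h3 := h1.trans_isBigO hy.isBigO_sub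
    have h4 := (hasDerivAt_iff_isLittleO.1 hy).const_mul_left (r t (y t))
    refine (h3.add h4).congr_left fun s => ?_
    simp only [smul_eq_mul, sub_self]
    ring
  convert! hp.add h2 using 1
  ext s
  simp

/-! ### Solutions: bounds and continuity -/

theorem IsRegular.exists_bound {I : Set ℝ} {w : ℝ → ℝ → ℝ} (h : IsRegular I w) {a b : ℝ}
    (ha : a ∈ I) (hb : b ∈ I) (hI : Icc a b ⊆ I) : ∃ C, 0 ≤ C ∧ ∀ t ∈ Icc a b,
      (∀ x, |w t x| ≤ C) ∧ (∀ x, |deriv (w t) x| ≤ C) ∧ (∀ x, |momentum (w t) x| ≤ C) ∧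
      ∫ x, |w t x| ≤ C := by
  obtain ⟨D, hD, hw⟩ := h.bdd a ha b hb
  have hD0 : 0 ≤ D.toReal := ENNReal.toReal_nonneg
  refine ⟨2 * D.toReal, by positivity, fun t ht => ?_⟩
  have h1 := hw t ht
  rw [normX_two] at h1
  have hDD : ENNReal.ofReal D.toReal = D := ENNReal.ofReal_toReal hD.ne
  have k0 : ∀ x, |w t x| ≤ D.toReal := abs_le_of_supNorm_le hD0 (by
    rw [hDD]; exact (le_self_add.trans (le_self_add.trans le_self_add)).trans h1)
  have k1 : ∀ x, |deriv (w t) x| ≤ D.toReal := abs_le_of_supNorm_le hD0 (by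
    rw [hDD]; exact (le_add_self.trans (le_self_add.trans le_self_add)).trans h1)
  have k2 : ∀ x, |deriv (deriv (w t)) x| ≤ D.toReal := abs_le_of_supNorm_le hD0 (by
    rw [hDD]; exact (le_add_self.trans le_self_add).trans h1)
  refine ⟨fun x => by linarith [k0 x], fun x => by linarith [k1 x], fun x => ?_, ?_⟩
  · rw [momentum_eq]
    exact (abs_sub _ _).trans (by linarith [k0 x, k2 x])
  · have hi := (h.memX t (hI ht)).two_spec.2.2.2.1
    have h2 : ENNReal.ofReal (∫ x, |w t x|) ≤ ENNReal.ofReal D.toReal := by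
      rw [ofReal_integral_abs hi, hDD]
      exact (le_self_add.trans (le_self_add.trans le_add_self)).trans h1
    have := (ENNReal.ofReal_le_ofReal_iff hD0).1 h2
    linarith

theorem integrableOn_exp_sub_Iic (C x : ℝ) :
    IntegrableOn (fun z => Real.exp (z - x) * C) (Iic x) := by
  have : (fun z => Real.exp (z - x) * C) = fun z => Real.exp z * (Real.exp (-x) * C) := by
    ext z; rw [← mul_assoc, ← Real.exp_add, sub_eq_add_neg]
  rw [this]
  exact (integrableOn_exp_Iic x).mul_const _

theorem abs_expL_id_le_of_forall_le {f : ℝ → ℝ} {C : ℝ} (hf : ∀ x, |f x| ≤ C) (x : ℝ) :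
    |expL id f x| ≤ C := by
  have h1 : ‖expL id f x‖ ≤ ∫ z in Iic x, Real.exp (z - x) * C := by
    refine norm_integral_le_of_norm_le (integrableOn_exp_sub_Iic C x)
      (Eventually.of_forall fun z => ?_)
    rw [norm_mul, Real.norm_eq_abs, Real.abs_exp]
    exact mul_le_mul_of_nonneg_left (hf z) (Real.exp_pos _).le
  refine h1.trans_eq ?_
  have : (fun z => Real.exp (z - x) * C) = fun z => Real.exp z * (Real.exp (-x) * C) := by
    ext z; rw [← mul_assoc, ← Real.exp_add, sub_eq_add_neg]
  rw [this, integral_mul_const, integral_exp_Iic, ← mul_assoc, ← Real.exp_add]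
  simp

theorem expR_id_eq (f : ℝ → ℝ) (x : ℝ) : expR id f x = expL id (fun z => f (-z)) (-x) := by
  rw [expR_eq_expL]; simp only [id, neg_neg]; rfl

theorem abs_expR_id_le_of_forall_le {f : ℝ → ℝ} {C : ℝ} (hf : ∀ x, |f x| ≤ C) (x : ℝ) :
    |expR id f x| ≤ C := by
  rw [expR_id_eq]
  exact abs_expL_id_le_of_forall_le (fun x => hf (-x)) _

/-- The kernel times a uniform bound is integrable on the half-line, so pointwise continuity in time
suffices by dominated convergence. -/
theorem continuousOn_expL_id {f : ℝ → ℝ → ℝ} {K : Set ℝ} {C : ℝ} (hi : ∀ s ∈ K, Integrable (f s))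
    (hC : ∀ s ∈ K, ∀ x, |f s x| ≤ C) (hc : ∀ x, ContinuousOn (fun s => f s x) K) (x : ℝ) :
    ContinuousOn (fun s => expL id (f s) x) K := by
  intro t ht
  refine tendsto_integral_filter_of_dominated_convergence (fun z => Real.exp (z - x) * C) ?_ ?_
    (integrableOn_exp_sub_Iic C x) (Eventually.of_forall fun z => ?_)
  · filter_upwards [self_mem_nhdsWithin] with s hs
    exact (expL_integrableOn monotone_id (hi s hs) x).aestronglyMeasurable
  · filter_upwards [self_mem_nhdsWithin] with s hs
    refine Eventually.of_forall fun z => ?_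
    rw [norm_mul, Real.norm_eq_abs, Real.abs_exp]
    exact mul_le_mul_of_nonneg_left (hC s hs z) (Real.exp_pos _).le
  · exact (hc z t ht).const_mul _

theorem continuousOn_expR_id {f : ℝ → ℝ → ℝ} {K : Set ℝ} {C : ℝ} (hi : ∀ s ∈ K, Integrable (f s))
    (hC : ∀ s ∈ K, ∀ x, |f s x| ≤ C) (hc : ∀ x, ContinuousOn (fun s => f s x) K) (x : ℝ) :
    ContinuousOn (fun s => expR id (f s) x) K := by
  simp_rw [expR_id_eq]
  exact continuousOn_expL_id (f := fun s z => f s (-z)) (fun s hs => (hi s hs).comp_neg)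
    (fun s hs x => hC s hs (-x)) (fun x => hc (-x)) (-x)

theorem IsRegular.continuousOn_momentum {I K : Set ℝ} {w : ℝ → ℝ → ℝ} (h : IsRegular I w)
    (hK : K ⊆ I) (x : ℝ) : ContinuousOn (fun s => momentum (w s) x) K :=
  h.cont_momentum.comp (f := fun s => (s, x)) (by fun_prop) fun s hs => ⟨hK hs, mem_univ _⟩

theorem velocity_eq_expL_mul_expR {f g : ℝ → ℝ} (hf : MemX 2 f) (hg : MemX 2 g) (x : ℝ) :
    velocity f g x = expL id (momentum f) x * expR id (momentum g) x := by
  obtain ⟨c, -, i⟩ := memX_zero_iff.1 hf.two_spec.2.2.2.2.2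
  obtain ⟨c', -, i'⟩ := memX_zero_iff.1 hg.two_spec.2.2.2.2.2
  rw [← velocity_helmholtzInv i c i' c', helmholtzInv_momentum hf, helmholtzInv_momentum hg]

/-- The mass function `∫₀ˣ (w - ∂ₓ²w)`, up to a constant. -/
def massFun (w : ℝ → ℝ) (x : ℝ) : ℝ := (∫ z in (0 : ℝ)..x, w z) - deriv w x

theorem hasDerivAt_massFun {w : ℝ → ℝ} (h : MemX 2 w) (x : ℝ) :
    HasDerivAt (massFun w) (momentum w x) x := by
  obtain ⟨h1, h2, -⟩ := h.two_spec.1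
  rw [momentum_eq]
  exact (intervalIntegral.integral_hasDerivAt_right (h1.continuous.intervalIntegrable _ _)
    (h1.continuous.stronglyMeasurableAtFilter _ _) h1.continuous.continuousAt).sub
    (h2 x).hasDerivAt

theorem abs_massFun_le {w : ℝ → ℝ} {C C' : ℝ} (hw : Integrable w) (h : ∫ x, |w x| ≤ C)
    (h' : ∀ x, |deriv w x| ≤ C') (x : ℝ) : |massFun w x| ≤ C + C' := by
  refine (abs_sub _ _).trans (add_le_add ?_ (h' x))
  refine le_trans ?_ h
  refine (intervalIntegral.norm_integral_le_integral_norm_uIoc (f := w) (μ := volume)).trans ?_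
  exact setIntegral_le_integral hw.norm (Eventually.of_forall fun _ => norm_nonneg _)

/-! ### Evolution of the mass function -/

section Evolution

variable {u v w : ℝ → ℝ → ℝ} {S T : EReal}

/-- The flux `m (u - ∂ₓu)(v + ∂ₓv)` of the component `w`. -/
def flux (u v w : ℝ → ℝ → ℝ) (t z : ℝ) : ℝ := momentum (w t) z * velocity (u t) (v t) z

theorem IsRegular.memX_flux {I : Set ℝ} (hu : IsRegular I u) (hv : IsRegular I v)
    (hw : IsRegular I w) {t : ℝ} (ht : t ∈ I) : MemX 0 (flux u v w t) :=
  memX_mul_velocity (hw.memX t ht).two_spec.2.2.2.2.2 (hu.memX t ht) (hv.memX t ht)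

/-- With g the flux and H = (1 - ∂ₓ²)⁻¹, the equation ∂ₜw = ∂ₓHg gives Hg(x) - Hg(0) for the
integral term and ∂ₜ∂ₓw = Hg - g for the other. The nonlocal term survives only as the constant
Hg(0). This is the conservation law ∂ₜm = ∂ₓg in integrated form, which needs no derivative of m. -/
theorem IsRegular.hasDerivAt_massFun_time (hu : IsRegular (timeInterval S T) u)
    (hv : IsRegular (timeInterval S T) v) (hw : IsRegular (timeInterval S T) w)
    (heq : ∀ t ∈ timeInterval S T, ∀ x, HasDerivAt (fun s => w s x)
      (deriv (helmholtzInv (flux u v w t)) x) t) {t : ℝ} (ht : t ∈ timeInterval S T) (x : ℝ) :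
    HasDerivAt (fun s => massFun (w s) x) (flux u v w t x - helmholtzInv (flux u v w t) 0) t := by
  obtain ⟨a, ha, b, hb, htab, hab⟩ := exists_Icc_subset_of_mem_timeInterval ht
  obtain ⟨Cu, Cu0, hCu⟩ := hu.exists_bound ha hb hab
  obtain ⟨Cv, Cv0, hCv⟩ := hv.exists_bound ha hb hab
  obtain ⟨Cw, Cw0, hCw⟩ := hw.exists_bound ha hb hab
  have hmu : ∀ s ∈ Icc a b, Integrable (momentum (u s)) := fun s hs =>
    (memX_zero_iff.1 (hu.memX s (hab hs)).two_spec.2.2.2.2.2).2.2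
  have hmv : ∀ s ∈ Icc a b, Integrable (momentum (v s)) := fun s hs =>
    (memX_zero_iff.1 (hv.memX s (hab hs)).two_spec.2.2.2.2.2).2.2
  have hgi : ∀ s ∈ Icc a b, Integrable (flux u v w s) := fun s hs =>
    (memX_zero_iff.1 (hu.memX_flux hv hw (hab hs))).2.2
  have hgc : ∀ s ∈ Icc a b, Continuous (flux u v w s) := fun s hs =>
    (memX_zero_iff.1 (hu.memX_flux hv hw (hab hs))).1
  have hgb : ∀ s ∈ Icc a b, ∀ x, |flux u v w s x| ≤ Cw * (Cu * Cv) := fun s hs x => by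
    rw [flux, velocity_eq_expL_mul_expR (hu.memX s (hab hs)) (hv.memX s (hab hs)), abs_mul, abs_mul]
    have h1 := abs_expL_id_le_of_forall_le (hCu s hs).2.2.1 x
    have h2 := abs_expR_id_le_of_forall_le (hCv s hs).2.2.1 x
    have h3 := (hCw s hs).2.2.1 x
    gcongr
  have hgt : ∀ x, ContinuousOn (fun s => flux u v w s x) (Icc a b) := fun x => by
    have h1 := continuousOn_expL_id hmu (fun s hs => (hCu s hs).2.2.1)
      (fun x => hu.continuousOn_momentum hab x) x
    have h2 := continuousOn_expR_id hmv (fun s hs => (hCv s hs).2.2.1)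
      (fun x => hv.continuousOn_momentum hab x) x
    refine ((hw.continuousOn_momentum hab x).mul (h1.mul h2)).congr fun s hs => ?_
    rw [flux, velocity_eq_expL_mul_expR (hu.memX s (hab hs)) (hv.memX s (hab hs))]; rfl
  have hLc := continuousOn_expL_id hgi hgb hgt
  have hRc := continuousOn_expR_id hgi hgb hgt
  have hLb : ∀ s ∈ Icc a b, ∀ x, |expL id (flux u v w s) x| ≤ Cw * (Cu * Cv) := fun s hs x =>
    abs_expL_id_le_of_forall_le (hgb s hs) x
  have hRb : ∀ s ∈ Icc a b, ∀ x, |expR id (flux u v w s) x| ≤ Cw * (Cu * Cv) := fun s hs x =>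
    abs_expR_id_le_of_forall_le (hgb s hs) x
  have hFb : ∀ s ∈ Icc a b, ∀ x, |deriv (helmholtzInv (flux u v w s)) x| ≤ Cw * (Cu * Cv) :=
    fun s hs x => by
    rw [deriv_helmholtzInv (hgi s hs) (hgc s hs)]
    have h1 := abs_le.1 (hLb s hs x)
    have h2 := abs_le.1 (hRb s hs x)
    rw [abs_le]; constructor <;> linarith
  have hHb : ∀ s ∈ Icc a b, ∀ x, |helmholtzInv (flux u v w s) x| ≤ Cw * (Cu * Cv) :=
    fun s hs x => by
    rw [helmholtzInv_eq (hgi s hs)]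
    have h1 := abs_le.1 (hLb s hs x)
    have h2 := abs_le.1 (hRb s hs x)
    rw [abs_le]; constructor <;> linarith
  have hd1 : HasDerivAt (fun s => deriv (w s) x)
      (helmholtzInv (flux u v w t) x - flux u v w t x) t := by
    refine hasDerivAt_deriv_of_hasDerivAt (w := w) (a := a) (b := b)
      (F := fun s x => deriv (helmholtzInv (flux u v w s)) x)
      (G := fun s x => helmholtzInv (flux u v w s) x - flux u v w s x)
      (C := Cw * (Cu * Cv) + Cw * (Cu * Cv))
      (fun s hs x => heq s (hab hs) x) (fun s hs => (hw.memX s (hab hs)).two_spec.1.1)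
      (fun s hs x => hasDerivAt_deriv_helmholtzInv (hgi s hs) (hgc s hs) x)
      (fun x => ?_) (fun x => ?_) (fun s hs x => ?_) htab x
    · refine ((continuousOn_const (c := 1 / 2)).mul ((hRc x).sub (hLc x))).congr fun s hs => ?_
      rw [deriv_helmholtzInv (hgi s hs) (hgc s hs)]; rfl
    · refine (((continuousOn_const (c := 1 / 2)).mul ((hLc x).add (hRc x))).sub (hgt x)).congr
        fun s hs => ?_
      rw [helmholtzInv_eq (hgi s hs)]; rfl
    · exact (abs_sub _ _).trans (add_le_add (hHb s hs x) (hgb s hs x))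
  have htI : t ∈ Icc a b := Ioo_subset_Icc_self htab
  have hn : Icc a b ∈ 𝓝 t := Icc_mem_nhds htab.1 htab.2
  have hwc : ∀ s ∈ Icc a b, Continuous (w s) := fun s hs =>
    (hw.memX s (hab hs)).two_spec.1.1.continuous
  have hcd : Continuous (deriv (helmholtzInv (flux u v w t))) := by
    rw [deriv_helmholtzInv (hgi t htI) (hgc t htI)]
    exact continuous_const.mul ((continuous_expR_id (hgi t htI) (hgc t htI)).sub
      (continuous_expL_id (hgi t htI) (hgc t htI)))
  have hd2 := (intervalIntegral.hasDerivAt_integral_of_dominated_loc_of_deriv_le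
      (μ := volume) (a := 0) (b := x) (F := fun s z => w s z)
      (F' := fun s z => deriv (helmholtzInv (flux u v w s)) z) (x₀ := t)
      (bound := fun _ => Cw * (Cu * Cv)) hn
      (by filter_upwards [hn] with s hs using (hwc s hs).aestronglyMeasurable)
      ((hwc t htI).intervalIntegrable _ _) hcd.aestronglyMeasurable
      (Eventually.of_forall fun z _ s hs => hFb s hs z)
      intervalIntegrable_const
      (Eventually.of_forall fun z _ s hs => heq s (hab hs) z)).2
  rw [intervalIntegral.integral_eq_sub_of_hasDerivAt (f := helmholtzInv (flux u v w t))
    (fun z _ => (hasDerivAt_helmholtzInv (hgi t htI) (hgc t htI) z).differentiableAt.hasDerivAt)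
    (hcd.intervalIntegrable _ _)] at hd2
  convert! hd2.sub hd1 using 1
  ring

/-- The mass function along a curve. -/
theorem IsRegular.hasDerivAt_massFun_curve (hu : IsRegular (timeInterval S T) u)
    (hv : IsRegular (timeInterval S T) v) (hw : IsRegular (timeInterval S T) w)
    (heq : ∀ t ∈ timeInterval S T, ∀ x, HasDerivAt (fun s => w s x)
      (deriv (helmholtzInv (flux u v w t)) x) t) {t : ℝ} (ht : t ∈ timeInterval S T)
    {y : ℝ → ℝ} {y' : ℝ} (hy : HasDerivAt y y' t) :
    HasDerivAt (fun s => massFun (w s) (y s))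
      (flux u v w t (y t) - helmholtzInv (flux u v w t) 0 + momentum (w t) (y t) * y') t := by
  have hI := (isOpen_timeInterval S T).mem_nhds ht
  refine hasDerivAt_comp_curve (R := fun s => massFun (w s)) (r := fun s => momentum (w s)) ?_ ?_
    (hu.hasDerivAt_massFun_time hv hw heq ht (y t)) hy
  · filter_upwards [hI] with s hs x using hasDerivAt_massFun (hw.memX s hs) x
  · exact hw.cont_momentum.continuousAt (prod_mem_nhds hI univ_mem)

end Evolution

/-! ### Uniqueness of the solution -/

theorem min_mem_timeInterval {S T : EReal} {a b : ℝ} (ha : a ∈ timeInterval S T)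
    (hb : b ∈ timeInterval S T) : a ⊓ b ∈ timeInterval S T := by
  rcases le_total a b with h | h
  · rwa [inf_eq_left.2 h]
  · rwa [inf_eq_right.2 h]

theorem max_mem_timeInterval {S T : EReal} {a b : ℝ} (ha : a ∈ timeInterval S T)
    (hb : b ∈ timeInterval S T) : a ⊔ b ∈ timeInterval S T := by
  rcases le_total a b with h | h
  · rwa [sup_eq_right.2 h]
  · rwa [sup_eq_left.2 h]

theorem IsRegular.exists_bound_uIcc {S T : EReal} {w : ℝ → ℝ → ℝ}
    (h : IsRegular (timeInterval S T) w) {a b : ℝ} (ha : a ∈ timeInterval S T)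
    (hb : b ∈ timeInterval S T) : ∃ C, 0 ≤ C ∧ ∀ t ∈ uIcc a b,
      (∀ x, |w t x| ≤ C) ∧ (∀ x, |deriv (w t) x| ≤ C) ∧ (∀ x, |momentum (w t) x| ≤ C) ∧
      ∫ x, |w t x| ≤ C :=
  h.exists_bound (min_mem_timeInterval ha hb) (max_mem_timeInterval ha hb)
    (uIcc_subset_timeInterval ha hb)

/-- The factors of the velocity are controlled by the oscillation of the mass difference alone. -/
theorem abs_sub_deriv_sub_le {f g : ℝ → ℝ} (hf : MemX 2 f) (hg : MemX 2 g) {K : ℝ}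
    (hK : ∀ x z, |(massFun f x - massFun g x) - (massFun f z - massFun g z)| ≤ K) (x : ℝ) :
    |(f x - deriv f x) - (g x - deriv g x)| ≤ K ∧ |(f x + deriv f x) - (g x + deriv g x)| ≤ K := by
  obtain ⟨⟨f1, f2, -⟩, ⟨Cf, hCf⟩, ⟨Df, hDf⟩, -⟩ := hf.two_spec
  obtain ⟨⟨g1, g2, -⟩, ⟨Cg, hCg⟩, ⟨Dg, hDg⟩, -⟩ := hg.two_spec
  have := abs_sub_deriv_le_of_osc_le (w := fun x => f x - g x) (w' := fun x => deriv f x - deriv g x)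
    (f := fun x => momentum f x - momentum g x) (D := fun x => massFun f x - massFun g x)
    (C := Cf + Cg) (C' := Df + Dg)
    (fun x => (f1 x).hasDerivAt.sub (g1 x).hasDerivAt)
    (fun x => by
      convert! (f2 x).hasDerivAt.sub (g2 x).hasDerivAt using 1
      rw [momentum_eq, momentum_eq]; ring)
    (fun x => (hasDerivAt_massFun hf x).sub (hasDerivAt_massFun hg x))
    (fun x => (abs_sub _ _).trans (add_le_add (hCf x) (hCg x)))
    (fun x => (abs_sub _ _).trans (add_le_add (hDf x) (hDg x))) hK x
  constructor
  · convert this.1 using 2; ring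
  · convert this.2 using 2; ring

theorem eq_of_massFun_sub_const {f g : ℝ → ℝ} (hf : MemX 2 f) (hg : MemX 2 g)
    (hK : ∀ x z, |(massFun f x - massFun g x) - (massFun f z - massFun g z)| ≤ 0) : f = g := by
  ext x
  obtain ⟨h1, h2⟩ := abs_sub_deriv_sub_le hf hg hK x
  have e1 := abs_nonpos_iff.1 h1
  have e2 := abs_nonpos_iff.1 h2
  linarith

/-! ### Difference of two solutions along characteristics -/

section Difference

variable {u v u' v' y : ℝ → ℝ → ℝ}

/-- The difference of the mass functions of two fields, between two characteristics. -/
def massDiff (w w' y : ℝ → ℝ → ℝ) (s : ℝ) (p : ℝ × ℝ) : ℝ :=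
  (massFun (w' s) (y s p.1) - massFun (w s) (y s p.1)) -
    (massFun (w' s) (y s p.2) - massFun (w s) (y s p.2))

/-- The derivative in time of `massDiff`. -/
def massDiffDeriv (u v u' v' w' y : ℝ → ℝ → ℝ) (s : ℝ) (p : ℝ × ℝ) : ℝ :=
  momentum (w' s) (y s p.1) *
    (velocity (u' s) (v' s) (y s p.1) - velocity (u s) (v s) (y s p.1)) -
  momentum (w' s) (y s p.2) *
    (velocity (u' s) (v' s) (y s p.2) - velocity (u s) (v s) (y s p.2))

/-- Along a characteristic of (u, v) the flux of w cancels against its transport term, and for w'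
there remains its momentum times the difference of the velocities. The constants left by the
nonlocal terms disappear because values at two labels are subtracted. -/
theorem hasDerivAt_massDiff {w w' : ℝ → ℝ → ℝ} {S T S' T' : EReal}
    (hu : IsRegular (timeInterval S T) u) (hv : IsRegular (timeInterval S T) v)
    (hw : IsRegular (timeInterval S T) w)
    (heq : ∀ t ∈ timeInterval S T, ∀ x, HasDerivAt (fun s => w s x)
      (deriv (helmholtzInv (flux u v w t)) x) t)
    (hu' : IsRegular (timeInterval S' T') u') (hv' : IsRegular (timeInterval S' T') v')
    (hw' : IsRegular (timeInterval S' T') w')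
    (heq' : ∀ t ∈ timeInterval S' T', ∀ x, HasDerivAt (fun s => w' s x)
      (deriv (helmholtzInv (flux u' v' w' t)) x) t) {t : ℝ} (ht : t ∈ timeInterval S T)
    (ht' : t ∈ timeInterval S' T')
    (hy : ∀ ξ, HasDerivAt (fun s => y s ξ) (-velocity (u t) (v t) (y t ξ)) t) (p : ℝ × ℝ) :
    HasDerivAt (fun s => massDiff w w' y s p) (massDiffDeriv u v u' v' w' y t p) t := by
  have h1 := fun ξ => hu.hasDerivAt_massFun_curve hv hw heq ht (hy ξ)
  have h2 := fun ξ => hu'.hasDerivAt_massFun_curve hv' hw' heq' ht' (hy ξ)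
  convert! ((h2 p.1).sub (h1 p.1)).sub ((h2 p.2).sub (h1 p.2)) using 1
  simp only [massDiffDeriv, flux]
  ring

theorem abs_massDiff_le {w w' : ℝ → ℝ → ℝ} {s C C' : ℝ} (hw : MemX 2 (w s)) (hw' : MemX 2 (w' s))
    (h1 : ∀ x, |deriv (w s) x| ≤ C) (h2 : ∫ x, |w s x| ≤ C)
    (h1' : ∀ x, |deriv (w' s) x| ≤ C') (h2' : ∫ x, |w' s x| ≤ C') (p : ℝ × ℝ) :
    |massDiff w w' y s p| ≤ 4 * (C + C') := by
  have k := abs_massFun_le hw.two_spec.2.2.2.1 h2 h1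
  have k' := abs_massFun_le hw'.two_spec.2.2.2.1 h2' h1'
  have a1 := abs_le.1 (k (y s p.1))
  have a2 := abs_le.1 (k (y s p.2))
  have a3 := abs_le.1 (k' (y s p.1))
  have a4 := abs_le.1 (k' (y s p.2))
  rw [massDiff, abs_le]
  constructor <;> linarith

/-- This closes the Grönwall loop: surjectivity of y turns bounds over pairs of labels into
oscillation bounds, which control the velocity difference by 4CK. The momentum contributes a factor
C, and the two labels a factor 2. -/
theorem abs_massDiffDeriv_le {w' : ℝ → ℝ → ℝ} {s C K : ℝ} (hu : MemX 2 (u s)) (hv : MemX 2 (v s))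
    (hu' : MemX 2 (u' s)) (hv' : MemX 2 (v' s)) (hy : Function.Surjective (y s))
    (hKu : ∀ p, |massDiff u u' y s p| ≤ K) (hKv : ∀ p, |massDiff v v' y s p| ≤ K)
    (hw' : ∀ x, |momentum (w' s) x| ≤ C)
    (u1 : ∀ x, |u s x| ≤ C) (u2 : ∀ x, |deriv (u s) x| ≤ C)
    (v1 : ∀ x, |v' s x| ≤ C) (v2 : ∀ x, |deriv (v' s) x| ≤ C) (p : ℝ × ℝ) :
    |massDiffDeriv u v u' v' w' y s p| ≤ 8 * C ^ 2 * K := by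
  have ou : ∀ x z, |(massFun (u' s) x - massFun (u s) x) -
      (massFun (u' s) z - massFun (u s) z)| ≤ K := fun x z => by
    obtain ⟨ξ, rfl⟩ := hy x
    obtain ⟨η, rfl⟩ := hy z
    exact hKu (ξ, η)
  have ov : ∀ x z, |(massFun (v' s) x - massFun (v s) x) -
      (massFun (v' s) z - massFun (v s) z)| ≤ K := fun x z => by
    obtain ⟨ξ, rfl⟩ := hy x
    obtain ⟨η, rfl⟩ := hy z
    exact hKv (ξ, η)
  have key : ∀ x, |momentum (w' s) x * (velocity (u' s) (v' s) x - velocity (u s) (v s) x)| ≤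
      C * (K * (C + C) + (C + C) * K) := fun x => by
    rw [abs_mul]
    refine mul_le_mul (hw' x) ?_ (abs_nonneg _) ((abs_nonneg _).trans (hw' x))
    exact abs_mul_sub_mul_le (abs_sub_deriv_sub_le hu' hu ou x).1
      (abs_sub_deriv_sub_le hv' hv ov x).2
      ((abs_add_le _ _).trans (add_le_add (v1 x) (v2 x)))
      ((abs_sub _ _).trans (add_le_add (u1 x) (u2 x)))
  refine (abs_sub _ _).trans ((add_le_add (key _) (key _)).trans_eq (by ring))

end Difference

/-- Only the first solution needs characteristics, since the second is read along them. The velocity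
involves both components, so the mass differences of u and v over all pairs of labels form a single
family for the Grönwall lemma. It vanishes at time 0 because the momentum determines the field. -/
theorem IsSolution.eq_of_characteristic {m₀ n₀ : ℝ → ℝ} {S T S' T' : EReal}
    {u v u' v' y : ℝ → ℝ → ℝ} (h : IsSolution m₀ n₀ S T u v) (h' : IsSolution m₀ n₀ S' T' u' v')
    (h0 : (0 : ℝ) ∈ timeInterval S T) (h0' : (0 : ℝ) ∈ timeInterval S' T')
    (hy : ∀ t ∈ timeInterval S T, ∀ ξ,
      HasDerivAt (fun s => y s ξ) (-velocity (u t) (v t) (y t ξ)) t)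
    (hsurj : ∀ t ∈ timeInterval S T, Function.Surjective (y t)) {t : ℝ}
    (ht : t ∈ timeInterval S T) (ht' : t ∈ timeInterval S' T') : u' t = u t ∧ v' t = v t := by
  have hI := uIcc_subset_timeInterval h0 ht
  have hI' := uIcc_subset_timeInterval h0' ht'
  obtain ⟨C₁, c₁, k₁⟩ := h.regular_u.exists_bound_uIcc h0 ht
  obtain ⟨C₂, c₂, k₂⟩ := h.regular_v.exists_bound_uIcc h0 ht
  obtain ⟨C₃, c₃, k₃⟩ := h'.regular_u.exists_bound_uIcc h0' ht'
  obtain ⟨C₄, c₄, k₄⟩ := h'.regular_v.exists_bound_uIcc h0' ht'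
  set C := C₁ + C₂ + C₃ + C₄ with hC
  have l₁ : C₁ ≤ C := by linarith
  have l₂ : C₂ ≤ C := by linarith
  have l₃ : C₃ ≤ C := by linarith
  have l₄ : C₄ ≤ C := by linarith
  have iu : u' 0 = u 0 := by
    rw [← helmholtzInv_momentum (h.regular_u.memX 0 h0),
      ← helmholtzInv_momentum (h'.regular_u.memX 0 h0'), funext h.init_u, funext h'.init_u]
  have iv : v' 0 = v 0 := by
    rw [← helmholtzInv_momentum (h.regular_v.memX 0 h0),
      ← helmholtzInv_momentum (h'.regular_v.memX 0 h0'), funext h.init_v, funext h'.init_v]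
  have main := eq_zero_of_deriv_le (ι := (ℝ × ℝ) ⊕ (ℝ × ℝ)) (a := 0) (b := t)
    (δ := fun s => Sum.elim (massDiff u u' y s) (massDiff v v' y s))
    (δ' := fun s => Sum.elim (massDiffDeriv u v u' v' u' y s) (massDiffDeriv u v u' v' v' y s))
    (L := 8 * C ^ 2) (B := 4 * (C + C)) (fun s hs i => ?_) (fun s hs K hK => ?_) (fun s hs i => ?_)
    (by positivity) (fun i => ?_)
  · constructor
    · refine eq_of_massFun_sub_const (h'.regular_u.memX t ht') (h.regular_u.memX t ht)
        fun x z => ?_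
      obtain ⟨ξ, rfl⟩ := hsurj t ht x
      obtain ⟨η, rfl⟩ := hsurj t ht z
      exact abs_nonpos_iff.2 (main (Sum.inl (ξ, η)))
    · refine eq_of_massFun_sub_const (h'.regular_v.memX t ht') (h.regular_v.memX t ht)
        fun x z => ?_
      obtain ⟨ξ, rfl⟩ := hsurj t ht x
      obtain ⟨η, rfl⟩ := hsurj t ht z
      exact abs_nonpos_iff.2 (main (Sum.inr (ξ, η)))
  · rcases i with p | p
    · exact hasDerivAt_massDiff h.regular_u h.regular_v h.regular_u h.eq_u h'.regular_u
        h'.regular_v h'.regular_u h'.eq_u (hI hs) (hI' hs) (hy s (hI hs)) p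
    · exact hasDerivAt_massDiff h.regular_u h.regular_v h.regular_v h.eq_v h'.regular_u
        h'.regular_v h'.regular_v h'.eq_v (hI hs) (hI' hs) (hy s (hI hs)) p
  · have b : ∀ w' : ℝ → ℝ → ℝ, (∀ x, |momentum (w' s) x| ≤ C) →
        ∀ p, |massDiffDeriv u v u' v' w' y s p| ≤ 8 * C ^ 2 * K := fun w' hw' =>
      abs_massDiffDeriv_le (h.regular_u.memX s (hI hs)) (h.regular_v.memX s (hI hs))
        (h'.regular_u.memX s (hI' hs)) (h'.regular_v.memX s (hI' hs)) (hsurj s (hI hs))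
        (fun p => hK (Sum.inl p)) (fun p => hK (Sum.inr p)) hw'
        (fun x => ((k₁ s hs).1 x).trans l₁) (fun x => ((k₁ s hs).2.1 x).trans l₁)
        (fun x => ((k₄ s hs).1 x).trans l₄) (fun x => ((k₄ s hs).2.1 x).trans l₄)
    rintro (p | p)
    · exact b u' (fun x => ((k₃ s hs).2.2.1 x).trans l₃) p
    · exact b v' (fun x => ((k₄ s hs).2.2.1 x).trans l₄) p
  · rcases i with p | p
    · exact abs_massDiff_le (h.regular_u.memX s (hI hs)) (h'.regular_u.memX s (hI' hs))
        (fun x => ((k₁ s hs).2.1 x).trans l₁) ((k₁ s hs).2.2.2.trans l₁)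
        (fun x => ((k₃ s hs).2.1 x).trans l₃) ((k₃ s hs).2.2.2.trans l₃) p
    · exact abs_massDiff_le (h.regular_v.memX s (hI hs)) (h'.regular_v.memX s (hI' hs))
        (fun x => ((k₂ s hs).2.1 x).trans l₂) ((k₂ s hs).2.2.2.trans l₂)
        (fun x => ((k₄ s hs).2.1 x).trans l₄) ((k₄ s hs).2.2.2.trans l₄) p
  · rcases i with p | p <;> simp [massDiff, iu, iv]

/-! ### Blow-up criteria -/

theorem mul_exp_le_of_neg_mul_le_deriv {p p' : ℝ → ℝ} {D s t : ℝ} (hst : s ≤ t)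
    (hp : ∀ r ∈ Icc s t, HasDerivAt p (p' r) r) (hD : ∀ r ∈ Icc s t, -(D * p r) ≤ p' r) :
    p s * Real.exp (-(D * (t - s))) ≤ p t := by
  have hd : ∀ r ∈ Icc s t, HasDerivAt (fun r => p r * Real.exp (D * r))
      ((p' r + D * p r) * Real.exp (D * r)) r := fun r hr => by
    convert! (hp r hr).mul ((hasDerivAt_id r).const_mul D).exp using 1
    simp only [id]; ring
  have hmono : MonotoneOn (fun r => p r * Real.exp (D * r)) (Icc s t) := by
    refine monotoneOn_of_hasDerivWithinAt_nonneg (convex_Icc s t)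
      (fun r hr => (hd r hr).continuousAt.continuousWithinAt)
      (fun r hr => (hd r (interior_subset hr)).hasDerivWithinAt) fun r hr => ?_
    have := hD r (interior_subset hr)
    exact mul_nonneg (by linarith) (Real.exp_pos _).le
  have h1 := hmono ⟨le_rfl, hst⟩ ⟨hst, le_rfl⟩ hst
  simp only at h1
  have h2 := mul_le_mul_of_nonneg_right h1 (Real.exp_pos (-(D * t))).le
  rw [mul_assoc, mul_assoc, ← Real.exp_add, ← Real.exp_add, add_neg_cancel, Real.exp_zero,
    mul_one] at h2
  rwa [show -(D * (t - s)) = D * s + -(D * t) by ring]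

theorem mul_exp_le_of_deriv_le_mul {p p' : ℝ → ℝ} {D s t : ℝ} (hst : t ≤ s)
    (hp : ∀ r ∈ Icc t s, HasDerivAt p (p' r) r) (hD : ∀ r ∈ Icc t s, p' r ≤ D * p r) :
    p s * Real.exp (-(D * (s - t))) ≤ p t := by
  have hm : ∀ r ∈ Icc (-s) (-t), -r ∈ Icc t s := fun r hr =>
    ⟨by linarith [hr.2], by linarith [hr.1]⟩
  have := mul_exp_le_of_neg_mul_le_deriv (p := fun r => p (-r)) (p' := fun r => -p' (-r)) (D := D)
    (neg_le_neg hst) (fun r hr => ?_) (fun r hr => neg_le_neg (hD _ (hm r hr)))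
  · simp only [neg_neg] at this
    convert this using 4; ring
  · have := HasDerivAt.scomp r (hp (-r) (hm r hr)) (hasDerivAt_neg r)
    simpa [Function.comp_def] using! this

section BlowUp

variable {M N : ℝ → ℝ} {S T : EReal} {y : ℝ → ℝ → ℝ}

/-- The bracket is mB - nA, since u - ∂ₓu = A and v + ∂ₓv = B along the characteristic.
Multiplication by ∂_ξ y turns m and n into M and N, so the right-hand side is -∂ₜ∂_ξ y. -/
theorem CharOn.compression_mul (h : CharOn M N (timeInterval S T) y) (hM : MemX 0 M)
    (hN : MemX 0 N) {t : ℝ} (ht : t ∈ timeInterval S T) (ξ : ℝ) :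
    compression (eulerField M y) (eulerField N y) t (y t ξ) * deriv (y t) ξ =
      -(N ξ * expL (y t) M ξ - M ξ * expR (y t) N ξ) := by
  obtain ⟨Mc, -, Mi⟩ := memX_zero_iff.1 (h.memX_eulerDensity hM ht)
  obtain ⟨Nc, -, Ni⟩ := memX_zero_iff.1 (h.memX_eulerDensity hN ht)
  have e1 : eulerField M y t (y t ξ) - deriv (eulerField M y t) (y t ξ) = expL (y t) M ξ := by
    rw [← h.expL_eulerDensity M ht]; exact helmholtzInv_sub_deriv Mi Mc _
  have e2 : eulerField N y t (y t ξ) + deriv (eulerField N y t) (y t ξ) = expR (y t) N ξ := by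
    rw [← h.expR_eulerDensity N ht]; exact helmholtzInv_add_deriv Ni Nc _
  rw [compression, h.momentum_eulerField hM ht, h.momentum_eulerField hN ht, ← e1, ← e2,
    ← h.eulerDensity_mul M ht ξ, ← h.eulerDensity_mul N ht ξ]
  ring

theorem CharOn.ofReal_le_size (h : CharOn M N (timeInterval S T) y) (hM : MemX 0 M)
    (hN : MemX 0 N) {t : ℝ} (ht : t ∈ timeInterval S T) (ξ : ℝ) :
    ENNReal.ofReal ((|M ξ| + |N ξ|) / deriv (y t) ξ) ≤
      size (eulerField M y) (eulerField N y) t := by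
  obtain ⟨-, -, hmono, -, hq⟩ := h.spec ht
  have e : ∀ P : ℝ → ℝ, ENNReal.ofReal (|P ξ| / deriv (y t) ξ) ≤
      supNorm (eulerDensity P (y t)) := fun P => by
    refine le_trans (le_of_eq ?_) (enorm_le_supNorm _ (y t ξ))
    rw [eulerDensity_apply P hmono, ← ofReal_norm, Real.norm_eq_abs, abs_div, abs_of_pos (hq ξ)]
  rw [size, h.momentum_eulerField hM ht, h.momentum_eulerField hN ht, add_div,
    ENNReal.ofReal_add (div_nonneg (abs_nonneg _) (hq ξ).le) (div_nonneg (abs_nonneg _) (hq ξ).le)]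
  exact add_le_add (e M) (e N)

/-- The factor |M(ξ)| + |N(ξ)| is kept at the same label: labels carrying little momentum are hardly
compressed, and division by ∂_ξ y gives |m| + |n| there. -/
theorem CharOn.abs_deriv_time_le (h : CharOn M N (timeInterval S T) y) (hM : MemX 0 M)
    (hN : MemX 0 N) {t : ℝ} (ht : t ∈ timeInterval S T) (ξ : ℝ) :
    |N ξ * expL (y t) M ξ - M ξ * expR (y t) N ξ| ≤
      ((∫ η, |M η|) + ∫ η, |N η|) * (|M ξ| + |N ξ|) := by
  have hm := (h.strictMono ht).monotone
  have h1 := abs_expL_le hm (memX_zero_iff.1 hM).2.2 ξ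
  have h2 := abs_expR_le hm (memX_zero_iff.1 hN).2.2 ξ
  have i1 := (abs_nonneg _).trans h1
  have i2 := (abs_nonneg _).trans h2
  refine (abs_sub _ _).trans ?_
  rw [abs_mul, abs_mul]
  have e1 := mul_le_mul_of_nonneg_left h1 (abs_nonneg (N ξ))
  have e2 := mul_le_mul_of_nonneg_left h2 (abs_nonneg (M ξ))
  have e3 := mul_nonneg i1 (abs_nonneg (M ξ))
  have e4 := mul_nonneg i2 (abs_nonneg (N ξ))
  linarith

theorem CharOn.tendsto_iInf_deriv (h : CharOn M N (timeInterval S T) y) {F : Filter ℝ}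
    (hF : ∀ᶠ t in F, t ∈ timeInterval S T)
    (hbr : ∀ ε > 0, ∀ᶠ t in F, ∃ ξ, deriv (y t) ξ < ε) :
    Tendsto (fun t => ⨅ ξ, deriv (y t) ξ) F (𝓝 0) := by
  refine tendsto_of_eventually_abs_sub_le fun ε hε => ?_
  filter_upwards [hF, hbr ε hε] with t ht hξ
  obtain ⟨ξ, hξ⟩ := hξ
  have hq := (h.spec ht).2.2.2.2
  have h1 : 0 ≤ ⨅ ξ, deriv (y t) ξ := le_ciInf fun ξ => (hq ξ).le
  have h2 : ⨅ ξ, deriv (y t) ξ ≤ deriv (y t) ξ :=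
    ciInf_le ⟨0, by rintro _ ⟨ξ, rfl⟩; exact (hq ξ).le⟩ ξ
  rw [sub_zero, abs_of_nonneg h1]
  linarith

/-- To fall from at least c to below c/2 in bounded time, ∂_ξ y at a label needs |M| + |N| bounded
below there. The quotient by the vanishing ∂_ξ y then diverges. The argument applies at every time
near the end, so it gives a limit and not only an upper limit. -/
theorem CharOn.tendsto_size (h : CharOn M N (timeInterval S T) y) (hM : MemX 0 M)
    (hN : MemX 0 N) (h0 : (0 : ℝ) ∈ timeInterval S T) {c : ℝ} (hc : 0 < c)
    (hq0 : ∀ ξ, c ≤ deriv (y 0) ξ) {F : Filter ℝ} (hF : ∀ᶠ t in F, t ∈ timeInterval S T) {B : ℝ}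
    (hB : ∀ᶠ t in F, |t| ≤ B) (hbr : ∀ ε > 0, ∀ᶠ t in F, ∃ ξ, deriv (y t) ξ < ε) :
    Tendsto (size (eulerField M y) (eulerField N y)) F (𝓝 ⊤) := by
  set K := (∫ η, |M η|) + ∫ η, |N η| with hK
  have hK0 : 0 ≤ K := add_nonneg (integral_nonneg fun _ => abs_nonneg _)
    (integral_nonneg fun _ => abs_nonneg _)
  -- From c - K(|M| + |N|)|B| < c/2 one gets |M| + |N| ≥ κ. The added 1 keeps the denominator
  -- positive.
  set κ := c / (2 * (K * |B| + 1)) with hκ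
  have hκ0 : 0 < κ := by positivity
  rw [ENNReal.tendsto_nhds_top_iff_nnreal]
  intro x
  have hx : (0 : ℝ) < x + 1 := by positivity
  filter_upwards [hF, hB, hbr (min (c / 2) (κ / (x + 1))) (by positivity)] with t ht htB hξ
  obtain ⟨ξ, hξ⟩ := hξ
  have hsub := uIcc_subset_timeInterval h0 ht
  have hq := (h.spec ht).2.2.2.2 ξ
  have h1 := (convex_uIcc 0 t).norm_image_sub_le_of_norm_hasDerivWithin_le
    (f := fun s => deriv (y s) ξ) (C := K * (|M ξ| + |N ξ|))
    (fun s hs => (h.hasDerivAt_deriv hM hN (hsub hs) ξ).hasDerivWithinAt)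
    (fun s hs => h.abs_deriv_time_le hM hN (hsub hs) ξ) left_mem_uIcc right_mem_uIcc
  rw [Real.norm_eq_abs, Real.norm_eq_abs, sub_zero] at h1
  have h2 := (abs_le.1 h1).1
  have h3 := hq0 ξ
  have h4 : deriv (y t) ξ < c / 2 := hξ.trans_le (min_le_left _ _)
  have h5 : deriv (y t) ξ < κ / (x + 1) := hξ.trans_le (min_le_right _ _)
  have hs0 : 0 ≤ |M ξ| + |N ξ| := by positivity
  have h6 : K * (|M ξ| + |N ξ|) * |t| ≤ K * (|M ξ| + |N ξ|) * |B| :=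
    mul_le_mul_of_nonneg_left (htB.trans (le_abs_self B)) (mul_nonneg hK0 hs0)
  have h7 : κ ≤ |M ξ| + |N ξ| := by
    rw [hκ, div_le_iff₀ (by positivity)]
    nlinarith
  refine lt_of_lt_of_le ?_ (h.ofReal_le_size hM hN ht ξ)
  rw [ENNReal.lt_ofReal_iff_toReal_lt ENNReal.coe_ne_top, ENNReal.coe_toReal, lt_div_iff₀ hq]
  rw [lt_div_iff₀ hx] at h5
  nlinarith

/-- If the integral were finite, log ∂_ξ y would vary by at most J, uniformly in ξ, because |∂ₜ log
∂_ξ y| ≤ K(‖m‖ + ‖n‖). This contradicts the breaking. The set A and the filter are abstract so that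
both ends of the interval are covered. -/
theorem CharOn.lintegral_size_eq_top (h : CharOn M N (timeInterval S T) y) (hM : MemX 0 M)
    (hN : MemX 0 N) (h0 : (0 : ℝ) ∈ timeInterval S T) {c : ℝ} (hc : 0 < c)
    (hq0 : ∀ ξ, c ≤ deriv (y 0) ξ) {F : Filter ℝ} [F.NeBot] {A : Set ℝ}
    (hF : ∀ᶠ t in F, t ∈ timeInterval S T)
    (hA : ∀ᶠ t in F, ∀ f : ℝ → ℝ≥0∞, ∫⁻ s in uIoc 0 t, f s ≤ ∫⁻ s in A, f s)
    (hbr : ∀ ε > 0, ∀ᶠ t in F, ∃ ξ, deriv (y t) ξ < ε) :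
    ∫⁻ t in A, size (eulerField M y) (eulerField N y) t = ⊤ := by
  by_contra hne
  set K := (∫ η, |M η|) + ∫ η, |N η| with hK
  set J := ENNReal.ofReal K * ∫⁻ t in A, size (eulerField M y) (eulerField N y) t with hJ
  have hJ' : J ≠ ⊤ := ENNReal.mul_ne_top ENNReal.ofReal_ne_top hne
  -- The threshold c e^{-J} is the least value that an initial value at least c and a logarithmic
  -- variation at most J allow.
  obtain ⟨t, ht, htA, ξ, hξ⟩ :=
    (hF.and (hA.and (hbr (c * Real.exp (-J.toReal)) (by positivity)))).exists
  have hsub := uIcc_subset_timeInterval h0 ht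
  have hq : ∀ s ∈ uIcc 0 t, 0 < deriv (y s) ξ := fun s hs => (h.spec (hsub hs)).2.2.2.2 ξ
  set k : ℝ → ℝ := fun s =>
    (N ξ * expL (y s) M ξ - M ξ * expR (y s) N ξ) / deriv (y s) ξ with hk
  have hd : ∀ s ∈ uIcc 0 t, HasDerivAt (fun s => Real.log (deriv (y s) ξ)) (k s) s := fun s hs =>
    (h.hasDerivAt_deriv hM hN (hsub hs) ξ).log (hq s hs).ne'
  have hkc : ContinuousOn k (uIcc 0 t) := fun s hs => by
    refine ContinuousAt.continuousWithinAt (ContinuousAt.div ?_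
      (h.hasDerivAt_deriv hM hN (hsub hs) ξ).continuousAt (hq s hs).ne')
    exact (continuousAt_const.mul (h.continuousAt_expL (memX_zero_iff.1 hM).2.2 (hsub hs) ξ)).sub
      (continuousAt_const.mul (h.continuousAt_expR (memX_zero_iff.1 hN).2.2 (hsub hs) ξ))
  have hintg := intervalIntegral.integral_eq_sub_of_hasDerivAt hd hkc.intervalIntegrable
  have hle : ∫⁻ s in uIoc 0 t, ‖k s‖ₑ ≤ J := by
    calc ∫⁻ s in uIoc 0 t, ‖k s‖ₑ
        ≤ ∫⁻ s in uIoc 0 t, ENNReal.ofReal K * size (eulerField M y) (eulerField N y) s := by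
          refine setLIntegral_mono' measurableSet_uIoc fun s hs => ?_
          have hsI := hsub (uIoc_subset_uIcc hs)
          refine le_trans ?_ (mul_le_mul_right (h.ofReal_le_size hM hN hsI ξ) _)
          have hK0 : 0 ≤ K := add_nonneg (integral_nonneg fun _ => abs_nonneg _)
            (integral_nonneg fun _ => abs_nonneg _)
          rw [← ENNReal.ofReal_mul hK0, ← ofReal_norm, Real.norm_eq_abs, hk, abs_div,
            abs_of_pos (hq s (uIoc_subset_uIcc hs)), ← mul_div_assoc]
          exact ENNReal.ofReal_le_ofReal (div_le_div_of_nonneg_right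
            (h.abs_deriv_time_le hM hN hsI ξ) (hq s (uIoc_subset_uIcc hs)).le)
      _ = ENNReal.ofReal K * ∫⁻ s in uIoc 0 t, size (eulerField M y) (eulerField N y) s :=
          lintegral_const_mul' _ _ ENNReal.ofReal_ne_top
      _ ≤ J := mul_le_mul_right (htA _) _
  have habs : |∫ s in (0 : ℝ)..t, k s| ≤ J.toReal := by
    have h1 := intervalIntegral.norm_integral_eq_norm_integral_uIoc (μ := volume) (a := 0) (b := t) k
    have h2 := enorm_integral_le_lintegral_enorm (μ := volume.restrict (uIoc 0 t)) k
    rw [← Real.norm_eq_abs, h1, ← toReal_enorm]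
    exact ENNReal.toReal_mono hJ' (h2.trans hle)
  rw [hintg] at habs
  have h3 := (abs_le.1 habs).1
  have h4 : Real.log (deriv (y 0) ξ) ≥ Real.log c := Real.log_le_log hc (hq0 ξ)
  have h5 : Real.log c - J.toReal ≤ Real.log (deriv (y t) ξ) := by linarith
  rw [Real.le_log_iff_exp_le (hq t right_mem_uIcc), sub_eq_add_neg, Real.exp_add,
    Real.exp_log hc] at h5
  linarith

theorem exists_real_of_limsup_ne_top {F : Filter ℝ} {f : ℝ → ℝ → ℝ}
    (h : limsup (fun t => ⨆ x, (f t x : EReal)) F ≠ ⊤) : ∃ D : ℝ, ∀ᶠ t in F, ∀ x, f t x ≤ D := by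
  obtain ⟨D, hD, -⟩ := EReal.lt_iff_exists_real_btwn.1 (lt_top_iff_ne_top.2 h)
  refine ⟨D, (eventually_lt_of_limsup_lt hD).mono fun t ht x => ?_⟩
  exact EReal.coe_le_coe_iff.1 ((le_iSup (fun x => (f t x : EReal)) x).trans ht.le)

/-- If the bracket stayed below D near the end, then ∂ₜq ≥ -|D|q for q = ∂_ξ y. From a fixed time s
on, q would stay above a positive constant uniform in ξ, contradicting the breaking. -/
theorem CharOn.limsup_compression_right (h : CharOn M N (timeInterval S T) y) (hM : MemX 0 M)
    (hN : MemX 0 N) {b : ℝ} (hF : ∀ᶠ t in 𝓝[<] b, t ∈ timeInterval S T)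
    (hbr : ∀ ε > 0, ∀ᶠ t in 𝓝[<] b, ∃ ξ, deriv (y t) ξ < ε) :
    limsup (fun t => ⨆ x, (compression (eulerField M y) (eulerField N y) t x : EReal))
      (𝓝[<] b) = ⊤ := by
  by_contra hne
  obtain ⟨D, hD⟩ := exists_real_of_limsup_ne_top hne
  obtain ⟨t₀, ht₀, hI⟩ := mem_nhdsLT_iff_exists_Ioo_subset.1 (hD.and hF)
  obtain ⟨s, hs₀, hsb⟩ := exists_between (mem_Iio.1 ht₀)
  have hsI := (hI ⟨hs₀, hsb⟩).2
  obtain ⟨l, hl0, hl⟩ := h.exists_lower_bound hsI hsI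
  obtain ⟨t, ⟨ξ, hξ⟩, hst, htb⟩ := ((hbr (l * Real.exp (-(|D| * (b - s)))) (by positivity)).and
    (Ioo_mem_nhdsLT hsb)).exists
  have hmem : ∀ r ∈ Icc s t, r ∈ Ioo t₀ b := fun r hr => ⟨hs₀.trans_le hr.1, hr.2.trans_lt htb⟩
  have h1 := mul_exp_le_of_neg_mul_le_deriv (p := fun r => deriv (y r) ξ) (D := |D|) hst.le
    (fun r hr => h.hasDerivAt_deriv hM hN (hI (hmem r hr)).2 ξ) (fun r hr => ?_)
  · have h2 := hl s ⟨le_rfl, le_rfl⟩ ξ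
    have h3 : Real.exp (-(|D| * (b - s))) ≤ Real.exp (-(|D| * (t - s))) := by
      refine Real.exp_le_exp.2 (neg_le_neg (mul_le_mul_of_nonneg_left ?_ (abs_nonneg D)))
      linarith
    have h4 := mul_le_mul h2 h3 (Real.exp_pos _).le (hl0.le.trans h2)
    linarith
  · have h2 := h.compression_mul hM hN (hI (hmem r hr)).2 ξ
    have h3 := (h.spec (hI (hmem r hr)).2).2.2.2.2 ξ
    have h4 := ((hI (hmem r hr)).1 (y r ξ)).trans (le_abs_self D)
    have h5 := mul_le_mul_of_nonneg_right h4 h3.le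
    linarith

/-- Followed backward in time, q = ∂_ξ y shrinks when ∂ₜq > 0, that is, when the bracket is
negative. Hence the change of sign. -/
theorem CharOn.limsup_compression_left (h : CharOn M N (timeInterval S T) y) (hM : MemX 0 M)
    (hN : MemX 0 N) {a : ℝ} (hF : ∀ᶠ t in 𝓝[>] a, t ∈ timeInterval S T)
    (hbr : ∀ ε > 0, ∀ᶠ t in 𝓝[>] a, ∃ ξ, deriv (y t) ξ < ε) :
    limsup (fun t => ⨆ x, ((-compression (eulerField M y) (eulerField N y) t x : ℝ) : EReal))
      (𝓝[>] a) = ⊤ := by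
  by_contra hne
  obtain ⟨D, hD⟩ := exists_real_of_limsup_ne_top
    (f := fun t x => -compression (eulerField M y) (eulerField N y) t x) hne
  obtain ⟨t₀, ht₀, hI⟩ := mem_nhdsGT_iff_exists_Ioo_subset.1 (hD.and hF)
  obtain ⟨s, hsa, hs₀⟩ := exists_between (mem_Ioi.1 ht₀)
  have hsI := (hI ⟨hsa, hs₀⟩).2
  obtain ⟨l, hl0, hl⟩ := h.exists_lower_bound hsI hsI
  obtain ⟨t, ⟨ξ, hξ⟩, hat, hts⟩ := ((hbr (l * Real.exp (-(|D| * (s - a)))) (by positivity)).and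
    (Ioo_mem_nhdsGT hsa)).exists
  have hmem : ∀ r ∈ Icc t s, r ∈ Ioo a t₀ := fun r hr => ⟨hat.trans_le hr.1, hr.2.trans_lt hs₀⟩
  have h1 := mul_exp_le_of_deriv_le_mul (p := fun r => deriv (y r) ξ) (D := |D|) hts.le
    (fun r hr => h.hasDerivAt_deriv hM hN (hI (hmem r hr)).2 ξ) (fun r hr => ?_)
  · have h2 := hl s ⟨le_rfl, le_rfl⟩ ξ
    have h3 : Real.exp (-(|D| * (s - a))) ≤ Real.exp (-(|D| * (s - t))) := by
      refine Real.exp_le_exp.2 (neg_le_neg (mul_le_mul_of_nonneg_left ?_ (abs_nonneg D)))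
      linarith
    have h4 := mul_le_mul h2 h3 (Real.exp_pos _).le (hl0.le.trans h2)
    linarith
  · have h2 := h.compression_mul hM hN (hI (hmem r hr)).2 ξ
    have h3 := (h.spec (hI (hmem r hr)).2).2.2.2.2 ξ
    have h4 := ((hI (hmem r hr)).1 (y r ξ)).trans (le_abs_self D)
    have h5 := mul_le_mul_of_nonneg_right h4 h3.le
    linarith

/-- A finite end point of the maximal interval lies outside the interval of existence of every
solution that agrees with `(u, v)`. -/
theorem IsSolution.not_tendsto_size {m₀ n₀ : ℝ → ℝ} {S' T' : EReal} {u v u' v' : ℝ → ℝ → ℝ}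
    (h' : IsSolution m₀ n₀ S' T' u' v') {b : ℝ} (h0 : (0 : ℝ) ∈ timeInterval S' T')
    (hb : b ∈ timeInterval S' T') {F : Filter ℝ} [F.NeBot]
    (hF : ∀ᶠ t in F, t ∈ uIcc 0 b ∧ u' t = u t ∧ v' t = v t) :
    ¬ Tendsto (size u v) F (𝓝 ⊤) := by
  intro ht
  obtain ⟨C₁, -, k₁⟩ := h'.regular_u.exists_bound_uIcc h0 hb
  obtain ⟨C₂, -, k₂⟩ := h'.regular_v.exists_bound_uIcc h0 hb
  have h1 := ht.eventually_const_lt (u := ENNReal.ofReal C₁ + ENNReal.ofReal C₂) (by simp)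
  obtain ⟨t, h2, h3, h4, h5⟩ := (h1.and hF).exists
  refine absurd h2 (not_lt.2 ?_)
  rw [size, ← h4, ← h5]
  exact add_le_add (supNorm_le_ofReal (k₁ t h3).2.2.1) (supNorm_le_ofReal (k₂ t h3).2.2.1)

end BlowUp

end

end Peakon

/-! ### Assembly of the theorem -/

theorem theorem4p5 (m₀ n₀ : ℝ → ℝ) (hm₀ : MemX 0 m₀) (hn₀ : MemX 0 n₀)
    (y₀ : ℝ → ℝ) (c : ℝ) (hc : 0 < c)
    (hy₀ : MemX 1 (fun ξ => y₀ ξ - ξ)) (hy₀c : MemE c (fun ξ => y₀ ξ - ξ))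
    (S T : EReal) (y : ℝ → ℝ → ℝ) (hy : IsMaximalCharacteristic m₀ n₀ y₀ S T y) :
    ∃ u v : ℝ → ℝ → ℝ,
      -- `(u, v)` is the unique solution, and `(-S, T)` is its maximal interval of existence
      IsSolution m₀ n₀ S T u v ∧
      (∀ (S' T' : EReal) (u' v' : ℝ → ℝ → ℝ), 0 < S' → 0 < T' → IsSolution m₀ n₀ S' T' u' v' →
        S' ≤ S ∧ T' ≤ T ∧ ∀ t ∈ timeInterval S' T', u' t = u t ∧ v' t = v t) ∧
      (Tendsto m₀ (cocompact ℝ) (𝓝 0) → Tendsto n₀ (cocompact ℝ) (𝓝 0) →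
        ContInX 2 (timeInterval S T) u ∧ ContInX 2 (timeInterval S T) v) ∧
      -- a finite forward blow-up time
      (∀ b : ℝ, T = (b : EReal) →
        Tendsto (size u v) (𝓝[<] b) (𝓝 ⊤) ∧
        List.TFAE [
          limsup (size u v) (𝓝[<] b) = ⊤,
          Tendsto (fun t => ⨅ ξ, deriv (y t) ξ) (𝓝[<] b) (𝓝 0),
          limsup (fun t => ⨆ x, (compression u v t x : EReal)) (𝓝[<] b) = ⊤,
          ∫⁻ t in Ioo 0 b, size u v t = ⊤]) ∧
      -- a finite backward blow-up time
      (∀ a : ℝ, S = (a : EReal) →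
        Tendsto (size u v) (𝓝[>] (-a)) (𝓝 ⊤) ∧
        List.TFAE [
          limsup (size u v) (𝓝[>] (-a)) = ⊤,
          Tendsto (fun t => ⨅ ξ, deriv (y t) ξ) (𝓝[>] (-a)) (𝓝 0),
          limsup (fun t => ⨆ x, ((-compression u v t x : ℝ) : EReal)) (𝓝[>] (-a)) = ⊤,
          ∫⁻ t in Ioo (-a) 0, size u v t = ⊤]) := by
  have hM : MemX 0 (lagDensity m₀ y₀) := memX_lagDensity hc hm₀ hy₀c
  have hN : MemX 0 (lagDensity n₀ y₀) := memX_lagDensity hc hn₀ hy₀c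
  obtain ⟨h, hinit⟩ := (isCharacteristic_iff (memX_zero_iff.1 hM).2.2
    (memX_zero_iff.1 hN).2.2).1 hy.isChar
  have hy0 : y 0 = y₀ := funext hinit
  have h0 := zero_mem_timeInterval hy.pos_left hy.pos_right
  have hq0 : ∀ ξ, c ≤ deriv (y 0) ξ := by
    rw [hy0]; exact (memE_sub_id_iff.1 hy₀c).2.2.2.2
  have hsol := h.isSolution (m₀ := m₀) (n₀ := n₀) hM hN h0 (fun ξ => by rw [hy0]; rfl)
    (fun ξ => by rw [hy0]; rfl)
  set u := eulerField (lagDensity m₀ y₀) y with hu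
  set v := eulerField (lagDensity n₀ y₀) y with hv
  have huniq : ∀ (S' T' : EReal) (u' v' : ℝ → ℝ → ℝ), 0 < S' → 0 < T' →
      IsSolution m₀ n₀ S' T' u' v' → ∀ t ∈ timeInterval S T, t ∈ timeInterval S' T' →
      u' t = u t ∧ v' t = v t := fun S' T' u' v' hS' hT' h' t ht ht' => by
    refine hsol.eq_of_characteristic h' h0 (zero_mem_timeInterval hS' hT') (y := y)
      (fun s hs ξ => ?_) (fun s hs => (h.spec hs).2.2.2.1) ht ht'
    rw [h.velocity_eulerField hM hN hs]
    exact h.ode s hs ξ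
  have brR : ∀ b : ℝ, T = b → ∀ ε > 0, ∀ᶠ t in 𝓝[<] b, ∃ ξ, deriv (y t) ξ < ε :=
    fun b hb ε hε => hy.eventually_exists_deriv_lt_right hM hN hb hε
  have brL : ∀ a : ℝ, S = a → ∀ ε > 0, ∀ᶠ t in 𝓝[>] (-a), ∃ ξ, deriv (y t) ξ < ε :=
    fun a ha ε hε => hy.eventually_exists_deriv_lt_left hM hN ha hε
  have nbR : ∀ b : ℝ, T = b → 0 < b ∧ ∀ t ∈ Ioo 0 b, t ∈ timeInterval S T := fun b hb => by
    refine ⟨by have := hy.pos_right; rw [hb] at this; exact_mod_cast this, fun t ht => ⟨?_, ?_⟩⟩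
    · exact h0.1.trans (by exact_mod_cast ht.1)
    · rw [hb]; exact_mod_cast ht.2
  have nbL : ∀ a : ℝ, S = a → 0 < a ∧ ∀ t ∈ Ioo (-a) 0, t ∈ timeInterval S T := fun a ha => by
    refine ⟨by have := hy.pos_left; rw [ha] at this; exact_mod_cast this, fun t ht => ⟨?_, ?_⟩⟩
    · rw [ha]; exact_mod_cast ht.1
    · exact lt_trans (by exact_mod_cast ht.2) h0.2
  have evR : ∀ b : ℝ, T = b → ∀ᶠ t in 𝓝[<] b, t ∈ Ioo 0 b := fun b hb =>
    Ioo_mem_nhdsLT (nbR b hb).1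
  have evL : ∀ a : ℝ, S = a → ∀ᶠ t in 𝓝[>] (-a), t ∈ Ioo (-a) 0 := fun a ha =>
    Ioo_mem_nhdsGT (neg_lt_zero.2 (nbL a ha).1)
  have sizeR : ∀ b : ℝ, T = b → Tendsto (size u v) (𝓝[<] b) (𝓝 ⊤) := fun b hb =>
    h.tendsto_size hM hN h0 hc hq0 ((evR b hb).mono (nbR b hb).2)
      ((evR b hb).mono fun t ht => abs_le.2 ⟨by linarith [ht.1, (nbR b hb).1], ht.2.le⟩) (brR b hb)
  have sizeL : ∀ a : ℝ, S = a → Tendsto (size u v) (𝓝[>] (-a)) (𝓝 ⊤) := fun a ha =>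
    h.tendsto_size hM hN h0 hc hq0 ((evL a ha).mono (nbL a ha).2)
      ((evL a ha).mono fun t ht => abs_le.2 ⟨ht.1.le, by linarith [ht.2, (nbL a ha).1]⟩) (brL a ha)
  refine ⟨u, v, hsol, fun S' T' u' v' hS' hT' h' => ?_, fun hm hn => ?_,
    fun b hb => ⟨sizeR b hb, ?_⟩, fun a ha => ⟨sizeL a ha, ?_⟩⟩
  · have h0' := zero_mem_timeInterval hS' hT'
    -- If T < T', then T is a real time inside the interval of the other solution. The momentum
    -- there is locally bounded, and the two solutions agree before T, which contradicts the
    -- divergence of the norms.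
    have hT : T' ≤ T := by
      by_contra! hlt
      obtain ⟨b, rfl⟩ : ∃ b : ℝ, T = b :=
        ⟨T.toReal, (EReal.coe_toReal hlt.ne_top (ne_bot_of_gt hy.pos_right)).symm⟩
      have hbI : b ∈ timeInterval S' T' :=
        ⟨h0'.1.trans (EReal.coe_lt_coe_iff.2 (nbR b rfl).1), hlt⟩
      refine h'.not_tendsto_size h0' hbI (F := 𝓝[<] b) ?_ (sizeR b rfl)
      filter_upwards [evR b rfl] with t ht
      have htu : t ∈ uIcc 0 b := by
        rw [uIcc_of_le (nbR b rfl).1.le]; exact Ioo_subset_Icc_self ht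
      exact ⟨htu, huniq S' T' u' v' hS' hT' h' t ((nbR b rfl).2 t ht)
        (uIcc_subset_timeInterval h0' hbI htu)⟩
    have hS : S' ≤ S := by
      by_contra! hlt
      obtain ⟨a, rfl⟩ : ∃ a : ℝ, S = a :=
        ⟨S.toReal, (EReal.coe_toReal hlt.ne_top (ne_bot_of_gt hy.pos_left)).symm⟩
      have haI : -a ∈ timeInterval S' T' := by
        refine ⟨?_, lt_trans (EReal.coe_lt_coe_iff.2 (neg_lt_zero.2 (nbL a rfl).1)) h0'.2⟩
        rw [EReal.coe_neg]; exact EReal.neg_lt_neg_iff.2 hlt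
      refine h'.not_tendsto_size h0' haI (F := 𝓝[>] (-a)) ?_ (sizeL a rfl)
      filter_upwards [evL a rfl] with t ht
      have htu : t ∈ uIcc 0 (-a) := by
        rw [uIcc_of_ge (neg_nonpos.2 (nbL a rfl).1.le)]; exact Ioo_subset_Icc_self ht
      exact ⟨htu, huniq S' T' u' v' hS' hT' h' t ((nbL a rfl).2 t ht)
        (uIcc_subset_timeInterval h0' haI htu)⟩
    exact ⟨hS, hT, fun t ht => huniq S' T' u' v' hS' hT' h' t
      ⟨(EReal.neg_le_neg_iff.2 hS).trans_lt ht.1, ht.2.trans_le hT⟩ ht⟩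
  · obtain ⟨-, -, ⟨C, hC⟩, ⟨C', hC'⟩, -⟩ := memE_sub_id_iff.1 hy₀c
    -- y₀ stays at bounded distance from the identity, so decay of the data passes to the Lagrangian
    -- densities, whose extra factor y₀' is bounded.
    have hcoc : Tendsto y₀ (cocompact ℝ) (cocompact ℝ) := by
      rw [← Metric.cobounded_eq_cocompact, ← tendsto_norm_atTop_iff_cobounded]
      refine tendsto_atTop_mono (f := fun x => ‖x‖ - C) (fun x => ?_)
        (tendsto_atTop_add_const_right _ (-C) tendsto_norm_cobounded_atTop)
      have h1 := hC x
      rw [abs_sub_comm] at h1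
      have h2 := norm_sub_norm_le x (y₀ x)
      rw [Real.norm_eq_abs (x - _)] at h2
      linarith
    have key : ∀ w₀ : ℝ → ℝ, Tendsto w₀ (cocompact ℝ) (𝓝 0) →
        Tendsto (lagDensity w₀ y₀) (cocompact ℝ) (𝓝 0) := fun w₀ hw => by
      have h3 : Tendsto (fun x => |w₀ (y₀ x)| * (C' + 1)) (cocompact ℝ) (𝓝 0) := by
        simpa using ((hw.comp hcoc).abs).mul_const (C' + 1)
      refine squeeze_zero_norm (fun x => ?_) h3
      rw [lagDensity, norm_mul, Real.norm_eq_abs, Real.norm_eq_abs]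
      gcongr
      have := abs_le.1 (hC' x)
      rw [abs_le]; constructor <;> linarith
    exact ⟨h.contInX_eulerField hM (key m₀ hm), h.contInX_eulerField hN (key n₀ hn)⟩
  · have e1 := (sizeR b hb).limsup_eq
    have e2 := h.tendsto_iInf_deriv ((evR b hb).mono (nbR b hb).2) (brR b hb)
    have e3 := h.limsup_compression_right hM hN ((evR b hb).mono (nbR b hb).2) (brR b hb)
    have e4 := h.lintegral_size_eq_top hM hN h0 hc hq0 (A := Ioo 0 b)
      ((evR b hb).mono (nbR b hb).2) ((evR b hb).mono fun t ht f => ?_) (brR b hb)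
    -- All four conditions have been established outright at a finite end point, so each equivalence
    -- joins two true statements.
    · tfae_have 1 ↔ 2 := iff_of_true e1 e2
      tfae_have 2 ↔ 3 := iff_of_true e2 e3
      tfae_have 3 ↔ 4 := iff_of_true e3 e4
      tfae_finish
    · rw [uIoc_of_le ht.1.le]
      exact lintegral_mono_set (Ioc_subset_Ioo_right ht.2)
  · have e1 := (sizeL a ha).limsup_eq
    have e2 := h.tendsto_iInf_deriv ((evL a ha).mono (nbL a ha).2) (brL a ha)
    have e3 := h.limsup_compression_left hM hN ((evL a ha).mono (nbL a ha).2) (brL a ha)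
    have e4 := h.lintegral_size_eq_top hM hN h0 hc hq0 (A := Ioo (-a) 0)
      ((evL a ha).mono (nbL a ha).2) ((evL a ha).mono fun t ht f => ?_) (brL a ha)
    · tfae_have 1 ↔ 2 := iff_of_true e1 e2
      tfae_have 2 ↔ 3 := iff_of_true e2 e3
      tfae_have 3 ↔ 4 := iff_of_true e3 e4
      tfae_finish
    · rw [uIoc_of_ge ht.2.le, ← setLIntegral_congr Ioo_ae_eq_Ioc]
      exact lintegral_mono_set (Ioo_subset_Ioo_left ht.1.le)
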